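/- Let $p>1$, $s\in(0,1)$, $0\le m<p-1$, $\lambda>0$, let $N>p$ be an integer, and let $\Omega\subset\mathbb R^N$ be a bounded domain with smooth boundary, $d(x)=\operatorname{dist}(x,\partial\Omega)$. Let $\gamma<\tfrac12$ and, if $m>0$, let $\delta\in(0,m)$. Let $g_0\in L^r(\Omega)$ with $r\ge 2$ be nonnegative a.e. in $\Omega$. Write $[t]^{p-1}:=|t|^{p-2}t$ and $\mathbf{WL}:=W^{1,p}_0(\Omega)\cap L^{2(m+1)}(\Omega)$, where functions in $W^{1,p}_0(\Omega)$ are extended by zero to $\mathbb R^N$. Consider the problem $$u^{2m+1}-\lambda\Delta_p u+\lambda(-\Delta)^s_p u=g_0(x)\,u^m+\lambda m\,d(x)^{-\gamma}u^\delta\ \text{ in }\Omega,\qquad u>0\ \text{ in }\Omega,\qquad u=0\ \text{ in }\mathbb R^N\setminus\Omega. \tag{$S_\lambda$}$$ A function $u\in\mathbf{WL}$ with $u\ge0$ a.e. in $\Omega$ and $u\not\equiv0$ is called a weak sub-solution (resp. weak super-solution) of $(S_\lambda)$ if $$\int_\Omega u^{2m+1}\varphi\,dx+\lambda\int_\Omega|\nabla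 u|^{p-2}\nabla u\cdot\nabla\varphi\,dx+\lambda\iint_{\mathbb R^{2N}}\frac{[u(x)-u(y)]^{p-1}(\varphi(x)-\varphi(y))}{|x-y|^{N+sp}}\,dx\,dy\ \le\ (\text{resp. }\ge)\ \int_\Omega\big(g_0u^m+\lambda m\,d(x)^{-\gamma}u^\delta\big)\varphi\,dx$$ for all $\varphi\in\mathbf{WL}$ with $\varphi\ge0$ a.e. in $\Omega$. **Theorem.** If $\underline u\in\mathbf{WL}$ is a weak sub-solution and $\overline u\in\mathbf{WL}$ is a weak super-solution of $(S_\lambda)$, then $\underline u\le\overline u$ a.e. in $\Omega$. -/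

import Mathlib

open MeasureTheory Set Filter Topology
open scoped ContDiff ENNReal

/-- The signed power `[t]^q = |t|^(q-1) t`. -/
noncomputable def signedPow (q t : ℝ) : ℝ := |t| ^ (q - 1) * t

/-- A bounded open connected nonempty set `Ω` with smooth boundary: near each boundary point, `Ω`
is the strict sublevel set of a smooth function with nonvanishing differential at that point. -/
structure IsSmoothBoundedDomain {N : ℕ} (Ω : Set (EuclideanSpace ℝ (Fin N))) : Prop where
  isOpen : IsOpen Ω
  isConnected : IsConnected Ω
  isBounded : Bornology.IsBounded Ω
  smooth_boundary : ∀ x₀ ∈ frontier Ω, ∃ U ∈ 𝓝 x₀, ∃ ρ : EuclideanSpace ℝ (Fin N) → ℝ,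
    ContDiff ℝ ∞ ρ ∧ fderiv ℝ ρ x₀ ≠ 0 ∧ ∀ x ∈ U, x ∈ Ω ↔ ρ x < 0

/-- `G` is a weak (distributional) gradient of `u` on the whole space. -/
structure IsWeakGradient {N : ℕ} (u : EuclideanSpace ℝ (Fin N) → ℝ)
    (G : EuclideanSpace ℝ (Fin N) → EuclideanSpace ℝ (Fin N)) : Prop where
  locallyIntegrable_fun : LocallyIntegrable u volume
  locallyIntegrable_grad : LocallyIntegrable G volume
  integral_eq : ∀ φ : EuclideanSpace ℝ (Fin N) → ℝ, ContDiff ℝ ∞ φ → HasCompactSupport φ →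
    ∀ e : EuclideanSpace ℝ (Fin N),
      ∫ x, u x * fderiv ℝ φ x e = -∫ x, φ x * inner ℝ (G x) e

open Classical in
/-- The weak gradient `∇u` (and `0` if `u` has none). It is determined almost everywhere, see
`IsWeakGradient.weakGradient_ae_eq`. -/
noncomputable def weakGradient {N : ℕ} (u : EuclideanSpace ℝ (Fin N) → ℝ) :
    EuclideanSpace ℝ (Fin N) → EuclideanSpace ℝ (Fin N) :=
  if h : ∃ G, IsWeakGradient u G then h.choose else 0

theorem IsWeakGradient.ae_eq {N : ℕ} {u : EuclideanSpace ℝ (Fin N) → ℝ}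
    {G G' : EuclideanSpace ℝ (Fin N) → EuclideanSpace ℝ (Fin N)}
    (h : IsWeakGradient u G) (h' : IsWeakGradient u G') : G =ᵐ[volume] G' := by
  refine ae_eq_of_integral_contDiff_smul_eq h.locallyIntegrable_grad h'.locallyIntegrable_grad ?_
  intro g hg hgs
  have hi : Integrable (fun x => g x • G x) volume :=
    h.locallyIntegrable_grad.integrable_smul_left_of_hasCompactSupport hg.continuous hgs
  have hi' : Integrable (fun x => g x • G' x) volume :=
    h'.locallyIntegrable_grad.integrable_smul_left_of_hasCompactSupport hg.continuous hgs
  refine ext_inner_left ℝ fun e => ?_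
  rw [← integral_inner hi e, ← integral_inner hi' e]
  have h1 := h.integral_eq g hg hgs e
  have h2 := h'.integral_eq g hg hgs e
  simp_rw [real_inner_comm e] at h1 h2
  simp only [inner_smul_right]
  linarith

theorem IsWeakGradient.weakGradient_ae_eq {N : ℕ} {u : EuclideanSpace ℝ (Fin N) → ℝ}
    {G : EuclideanSpace ℝ (Fin N) → EuclideanSpace ℝ (Fin N)} (h : IsWeakGradient u G) :
    weakGradient u =ᵐ[volume] G := by
  have hex : ∃ G, IsWeakGradient u G := ⟨G, h⟩
  have : weakGradient u = hex.choose := by simp only [weakGradient, dif_pos hex]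
  rw [this]
  exact hex.choose_spec.ae_eq h

/-- The space `W₀^{1,p}(Ω)` of a bounded smooth domain, its elements being extended by zero: the
functions of `W^{1,p}(ℝ^N)` that vanish a.e. outside `Ω`. -/
structure MemW0 {N : ℕ} (Ω : Set (EuclideanSpace ℝ (Fin N))) (p : ℝ)
    (u : EuclideanSpace ℝ (Fin N) → ℝ) : Prop where
  memLp : MemLp u (ENNReal.ofReal p) volume
  exists_grad : ∃ G : EuclideanSpace ℝ (Fin N) → EuclideanSpace ℝ (Fin N),
    IsWeakGradient u G ∧ MemLp G (ENNReal.ofReal p) volume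
  ae_eq_zero : ∀ᵐ x ∂(volume.restrict Ωᶜ), u x = 0

/-- The space `WL = W₀^{1,p}(Ω) ∩ L^{2(m+1)}(Ω)`. -/
def MemWL {N : ℕ} (Ω : Set (EuclideanSpace ℝ (Fin N))) (p m : ℝ)
    (u : EuclideanSpace ℝ (Fin N) → ℝ) : Prop :=
  MemW0 Ω p u ∧ MemLp u (ENNReal.ofReal (2 * (m + 1))) (volume.restrict Ω)

/-- `∫_Ω |∇u|^{p-2} ∇u · ∇φ dx`. -/
noncomputable def localForm {N : ℕ} (Ω : Set (EuclideanSpace ℝ (Fin N))) (p : ℝ)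
    (u φ : EuclideanSpace ℝ (Fin N) → ℝ) : ℝ :=
  ∫ x in Ω, ‖weakGradient u x‖ ^ (p - 2) * inner ℝ (weakGradient u x) (weakGradient φ x)

/-- `∬_{ℝ^{2N}} [u(x)-u(y)]^{p-1} (φ(x)-φ(y)) / |x-y|^{N+sp} dx dy`. -/
noncomputable def nonlocalForm {N : ℕ} (s p : ℝ) (u φ : EuclideanSpace ℝ (Fin N) → ℝ) : ℝ :=
  ∫ z : EuclideanSpace ℝ (Fin N) × EuclideanSpace ℝ (Fin N),
    signedPow (p - 1) (u z.1 - u z.2) * (φ z.1 - φ z.2) / ‖z.1 - z.2‖ ^ ((N : ℝ) + s * p)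

/-- The distance to the boundary of `Ω`. -/
noncomputable def bdryDist {N : ℕ} (Ω : Set (EuclideanSpace ℝ (Fin N)))
    (x : EuclideanSpace ℝ (Fin N)) : ℝ :=
  Metric.infDist x (frontier Ω)

/-- The left-hand side of the weak formulation of
`u^{2m+1} - lam Δ_p u + lam (-Δ)_p^s u = g₀ u^m + lam m d^{-γ} u^δ`. -/
noncomputable def weakLHS {N : ℕ} (Ω : Set (EuclideanSpace ℝ (Fin N))) (p s m lam : ℝ)
    (u φ : EuclideanSpace ℝ (Fin N) → ℝ) : ℝ :=
  (∫ x in Ω, u x ^ (2 * m + 1) * φ x) + lam * localForm Ω p u φ + lam * nonlocalForm s p u φ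

/-- The right-hand side of the same weak formulation. -/
noncomputable def weakRHS {N : ℕ} (Ω : Set (EuclideanSpace ℝ (Fin N))) (m lam δ γ : ℝ)
    (g₀ u φ : EuclideanSpace ℝ (Fin N) → ℝ) : ℝ :=
  ∫ x in Ω, (g₀ x * u x ^ m + lam * m * bdryDist Ω x ^ (-γ) * u x ^ δ) * φ x

/-- Weak sub-solutions; the inequality is tested with nonnegative functions of `WL`. -/
structure IsWeakSubsolution {N : ℕ} (Ω : Set (EuclideanSpace ℝ (Fin N)))
    (p s m lam δ γ : ℝ) (g₀ u : EuclideanSpace ℝ (Fin N) → ℝ) : Prop where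
  memWL : MemWL Ω p m u
  nonneg : ∀ᵐ x ∂(volume.restrict Ω), 0 ≤ u x
  not_ae_zero : ¬ ∀ᵐ x ∂(volume.restrict Ω), u x = 0
  weak_le : ∀ φ : EuclideanSpace ℝ (Fin N) → ℝ, MemWL Ω p m φ →
    (∀ᵐ x ∂(volume.restrict Ω), 0 ≤ φ x) →
    weakLHS Ω p s m lam u φ ≤ weakRHS Ω m lam δ γ g₀ u φ

/-- Weak super-solutions; the inequality is tested with nonnegative functions of `WL`. -/
structure IsWeakSupersolution {N : ℕ} (Ω : Set (EuclideanSpace ℝ (Fin N)))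
    (p s m lam δ γ : ℝ) (g₀ u : EuclideanSpace ℝ (Fin N) → ℝ) : Prop where
  memWL : MemWL Ω p m u
  nonneg : ∀ᵐ x ∂(volume.restrict Ω), 0 ≤ u x
  not_ae_zero : ¬ ∀ᵐ x ∂(volume.restrict Ω), u x = 0
  weak_ge : ∀ φ : EuclideanSpace ℝ (Fin N) → ℝ, MemWL Ω p m φ →
    (∀ᵐ x ∂(volume.restrict Ω), 0 ≤ φ x) →
    weakRHS Ω m lam δ γ g₀ u φ ≤ weakLHS Ω p s m lam u φ

/-! ### Signed powers. -/

section SignedPow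

/-! The proof is the Díaz–Saa method. Let `u` be the sub-solution and `v` the super-solution. For `ε
> 0` and a truncation level `k`, put `U = u + ε`, `V = v + ε`, `T = (min(U, k)^(m+1) - V^(m+1))⁺`;
test the inequality for `u` with `T / U^m`, the one for `v` with `T / V^m`, and subtract.

The absorption terms tend, as `ε → 0`, to `(u^(m+1) - v^(m+1)) T ≥ 0`, with `ε = 0` in `T`. In the
reaction terms `g₀` cancels in the limit; what is left is a nonnegative multiple of `(u^(δ-m) -
v^(δ-m)) T ≤ 0` (and is absent for `m = 0`). The diffusion terms are nonnegative where the
truncation is inactive (`discrete_diazSaa`) and in general at least `-(8m+5)` times the energy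
densities, uniformly in `ε` and `k` (`discrete_diazSaa_lower_bound`). With `k = κ + 1` and `ε ≤ 1`
this error lives only where `u ≥ κ` (at one of the two points, in the nonlocal form), so it vanishes
as `κ → ∞`. The positive part of `u^(m+1) - v^(m+1)` must then be zero.

The algebraic core is the convexity of the perspective `c^(m+1) / a^m`, which gives
`discrete_picone`. The local form needs no separate algebra. Difference quotients of Sobolev
functions converge in `L^p`, so the discrete inequality yields one for the directional derivatives
in each direction `e`; averaging over `e` in the unit ball produces the `p`-Laplacian form
(`exists_directionalForm_eq`, `MemW0.ae_form_lower_bound`). The same quotients show that the test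
functions are admissible (`IsDirLipschitz.exists_weakGradient`).

Two facts justify the limit `ε → 0`. First, `u = 0` a.e. where `v = 0`
(`IsWeakSupersolution.ae_eq_zero_of_eq_zero`). This uses no strong maximum principle: `v` is tested
with `(u - jv)⁺` and `j → ∞`, and the nonlocal term becomes strictly negative unless the claim
holds. Second, `d^(-γ)` is integrable because boundary layers of width `t` have measure `O(t)`. -/

theorem signedPow_neg (r t : ℝ) : signedPow r (-t) = -signedPow r t := by
  simp [signedPow]

theorem signedPow_zero (r : ℝ) : signedPow r 0 = 0 := by simp [signedPow]

theorem signedPow_of_nonneg {r t : ℝ} (hr : 0 < r) (ht : 0 ≤ t) : signedPow r t = t ^ r := by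
  rcases ht.eq_or_lt with rfl | h
  · simp [signedPow, Real.zero_rpow hr.ne']
  · rw [signedPow, abs_of_pos h, Real.rpow_sub_one h.ne']
    field_simp

theorem signedPow_of_nonpos {r t : ℝ} (hr : 0 < r) (ht : t ≤ 0) : signedPow r t = -(-t) ^ r := by
  rw [← signedPow_of_nonneg hr (neg_nonneg.2 ht), signedPow_neg, neg_neg]

theorem abs_signedPow {r : ℝ} (hr : 0 < r) (t : ℝ) : |signedPow r t| = |t| ^ r := by
  rcases le_total 0 t with h | h
  · rw [signedPow_of_nonneg hr h, abs_of_nonneg h, abs_of_nonneg (Real.rpow_nonneg h r)]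
  · rw [signedPow_of_nonpos hr h, abs_neg, abs_of_nonpos h,
      abs_of_nonneg (Real.rpow_nonneg (neg_nonneg.2 h) r)]

theorem signedPow_mul_self {p : ℝ} (hp : 1 < p) (t : ℝ) : signedPow (p - 1) t * t = |t| ^ p := by
  rcases eq_or_ne t 0 with rfl | h
  · simp [Real.zero_rpow (by linarith : p ≠ 0)]
  · have h' : 0 < |t| := abs_pos.2 h
    rw [signedPow, mul_assoc, ← abs_mul_abs_self t, ← mul_assoc, ← Real.rpow_add_one h'.ne',
      ← Real.rpow_add_one h'.ne']
    ring_nf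

theorem signedPow_nonneg {r t : ℝ} (ht : 0 ≤ t) : 0 ≤ signedPow r t :=
  mul_nonneg (Real.rpow_nonneg (abs_nonneg t) _) ht

theorem signedPow_nonpos {r t : ℝ} (ht : t ≤ 0) : signedPow r t ≤ 0 :=
  mul_nonpos_of_nonneg_of_nonpos (Real.rpow_nonneg (abs_nonneg t) _) ht

theorem signedPow_mul_of_nonneg {r s : ℝ} (hr : 0 < r) (hs : 0 ≤ s) (t : ℝ) :
    signedPow r (s * t) = s ^ r * signedPow r t := by
  rcases le_total 0 t with h | h
  · rw [signedPow_of_nonneg hr h, signedPow_of_nonneg hr (mul_nonneg hs h), Real.mul_rpow hs h]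
  · rw [signedPow_of_nonpos hr h, signedPow_of_nonpos hr (mul_nonpos_of_nonneg_of_nonpos hs h),
      ← mul_neg, Real.mul_rpow hs (neg_nonneg.2 h), mul_neg]

theorem continuous_signedPow {r : ℝ} (hr : 0 < r) : Continuous (signedPow r) := by
  have : signedPow r = fun t => (max t 0) ^ r - (max (-t) 0) ^ r := by
    ext t
    rcases le_total 0 t with h | h
    · rw [signedPow_of_nonneg hr h, max_eq_left h, max_eq_right (by linarith),
        Real.zero_rpow hr.ne', sub_zero]
    · rw [signedPow_of_nonpos hr h, max_eq_right h, max_eq_left (by linarith),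
        Real.zero_rpow hr.ne', zero_sub]
  rw [this]
  exact ((continuous_id.max continuous_const).rpow_const fun _ => Or.inr hr.le).sub
    ((continuous_neg.max continuous_const).rpow_const fun _ => Or.inr hr.le)

theorem measurable_signedPow {r : ℝ} : Measurable (signedPow r) := by
  unfold signedPow
  fun_prop

end SignedPow

/-! ### Young-type inequalities for real powers. -/

section Young

theorem rpow_mul_rpow_le_add {p q x y : ℝ} (hq : 0 ≤ q) (hqp : q ≤ p) (hx : 0 ≤ x) (hy : 0 ≤ y) :
    x ^ q * y ^ (p - q) ≤ x ^ p + y ^ p := by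
  have h1 : ∀ z : ℝ, 0 ≤ z → z ^ q * z ^ (p - q) = z ^ p := fun z hz => by
    rw [← Real.rpow_add_of_nonneg hz hq (by linarith)]; ring_nf
  rcases le_total x y with h | h
  · calc x ^ q * y ^ (p - q) ≤ y ^ q * y ^ (p - q) := by gcongr
      _ = y ^ p := h1 y hy
      _ ≤ _ := le_add_of_nonneg_left (Real.rpow_nonneg hx p)
  · have : 0 ≤ p - q := by linarith
    calc x ^ q * y ^ (p - q) ≤ x ^ q * x ^ (p - q) := by gcongr
      _ = x ^ p := h1 x hx
      _ ≤ _ := le_add_of_nonneg_right (Real.rpow_nonneg hy p)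

/-- This is `(x^q - y^q) (x^(p-q) - y^(p-q)) ≥ 0` expanded; both factors have the same sign. The
constant 1 matters: `discrete_diazSaa` has no room for a larger one. -/
theorem rpow_mul_rpow_add_le {p q x y : ℝ} (hq : 0 ≤ q) (hqp : q ≤ p) (hx : 0 ≤ x) (hy : 0 ≤ y) :
    x ^ q * y ^ (p - q) + y ^ q * x ^ (p - q) ≤ x ^ p + y ^ p := by
  have h1 : ∀ z : ℝ, 0 ≤ z → z ^ q * z ^ (p - q) = z ^ p := fun z hz => by
    rw [← Real.rpow_add_of_nonneg hz hq (by linarith)]; ring_nf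
  have h0 : 0 ≤ p - q := by linarith
  rw [← h1 x hx, ← h1 y hy]
  rcases le_total x y with h | h
  · have h2 : x ^ q ≤ y ^ q := by gcongr
    have h3 : x ^ (p - q) ≤ y ^ (p - q) := by gcongr
    nlinarith
  · have h2 : y ^ q ≤ x ^ q := by gcongr
    have h3 : y ^ (p - q) ≤ x ^ (p - q) := by gcongr
    nlinarith

end Young

/-! ### Perspectives of powers and the discrete Picone inequality. -/

section Picone

variable {m : ℝ}

/-- The expression equals `a (c / a)^(m+1)`, the perspective of a convex function, hence convex and
1-homogeneous, hence subadditive. -/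
theorem perspective_rpow_add_le (hm : 0 ≤ m) {a b c d : ℝ} (ha : 0 < a) (hb : 0 < b)
    (hc : 0 ≤ c) (hd : 0 ≤ d) :
    (c + d) ^ (m + 1) / (a + b) ^ m ≤ c ^ (m + 1) / a ^ m + d ^ (m + 1) / b ^ m := by
  have key : ∀ x y : ℝ, 0 < x → 0 ≤ y → y ^ (m + 1) / x ^ m = x * (y / x) ^ (m + 1) := by
    intro x y hx hy
    rw [Real.div_rpow hy hx.le, Real.rpow_add_one hx.ne']
    have := (Real.rpow_pos_of_pos hx m).ne'
    field_simp
  rw [key _ _ (add_pos ha hb) (add_nonneg hc hd), key _ _ ha hc, key _ _ hb hd]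
  have hab := add_pos ha hb
  have := (convexOn_rpow (p := m + 1) (by linarith)).2 (mem_Ici.2 (div_nonneg hc ha.le))
    (mem_Ici.2 (div_nonneg hd hb.le)) (show 0 ≤ a / (a + b) by positivity)
    (show 0 ≤ b / (a + b) by positivity) (by field_simp)
  simp only [smul_eq_mul] at this
  have e : a / (a + b) * (c / a) + b / (a + b) * (d / b) = (c + d) / (a + b) := by field_simp
  rw [e] at this
  calc (a + b) * ((c + d) / (a + b)) ^ (m + 1)
      ≤ (a + b) * (a / (a + b) * (c / a) ^ (m + 1) + b / (a + b) * (d / b) ^ (m + 1)) := by gcongr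
    _ = _ := by field_simp

/-- The tangent line inequality for the perspective `μ ^ (m + 1) / a ^ m` of a power. -/
theorem perspective_rpow_tangent_le (hm : 0 ≤ m) {a μ ρ : ℝ} (ha : 0 < a) (hμ : 0 ≤ μ)
    (hρ : 0 ≤ ρ) :
    (m + 1) * ρ ^ m * μ - m * ρ ^ (m + 1) * a ≤ μ ^ (m + 1) / a ^ m := by
  have h1 : ∀ t : ℝ, 0 ≤ t → (m + 1) * ρ ^ m * t - m * ρ ^ (m + 1) ≤ t ^ (m + 1) := by
    intro t ht
    rcases hρ.eq_or_lt with rfl | hρ'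
    · rw [Real.zero_rpow (by linarith : m + 1 ≠ 0)]
      rcases hm.eq_or_lt with rfl | hm'
      · simp
      · rw [Real.zero_rpow hm'.ne']
        simpa using Real.rpow_nonneg ht _
    · have := one_add_mul_self_le_rpow_one_add (s := t / ρ - 1)
        (by linarith [div_nonneg ht hρ]) (p := m + 1) (by linarith)
      rw [add_sub_cancel, Real.div_rpow ht hρ, le_div_iff₀ (by positivity)] at this
      refine le_trans (le_of_eq ?_) this
      rw [Real.rpow_add_one hρ'.ne']
      field_simp
      ring
  have h2 := h1 (μ / a) (by positivity)
  rw [Real.div_rpow hμ ha.le, Real.rpow_add_one ha.ne'] at h2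
  have h3 := mul_le_mul_of_nonneg_left h2 ha.le
  have := (Real.rpow_pos_of_pos ha m).ne'
  calc _ = a * ((m + 1) * ρ ^ m * (μ / a) - m * ρ ^ (m + 1)) := by field_simp
    _ ≤ _ := h3
    _ = _ := by field_simp

/-- A convex function lies above its tangent at `(a, μ)`, whose slopes `(m+1) ρ^m` and `-m ρ^(m+1)`
depend only on `ρ = μ / a`. A one-sided estimate therefore needs the cone condition at that point
only. -/
theorem perspective_rpow_sub_le (hm : 0 ≤ m) {a b μ ν R : ℝ} (ha : 0 < a) (hb : 0 < b)
    (hμ : 0 ≤ μ) (hν : 0 ≤ ν) (hμR : μ ≤ R * a) :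
    μ ^ (m + 1) / a ^ m - ν ^ (m + 1) / b ^ m ≤
      (m + 1) * R ^ m * |μ - ν| + m * R ^ (m + 1) * |a - b| := by
  have hρ : 0 ≤ μ / a := by positivity
  have hρR : μ / a ≤ R := (div_le_iff₀ ha).2 hμR
  have h1 := perspective_rpow_tangent_le hm hb hν hρ
  have e : μ ^ (m + 1) / a ^ m = (m + 1) * (μ / a) ^ m * μ - m * (μ / a) ^ (m + 1) * a := by
    rw [Real.div_rpow hμ ha.le, Real.div_rpow hμ ha.le, Real.rpow_add_one ha.ne',
      Real.rpow_add_one' hμ (by linarith)]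
    have := (Real.rpow_pos_of_pos ha m).ne'
    field_simp
    ring
  have h2 : (m + 1) * (μ / a) ^ m * (μ - ν) ≤ (m + 1) * R ^ m * |μ - ν| := by
    have : (μ / a) ^ m ≤ R ^ m := by gcongr
    calc _ ≤ (m + 1) * (μ / a) ^ m * |μ - ν| := by gcongr; exact le_abs_self _
      _ ≤ _ := by gcongr
  have h3 : m * (μ / a) ^ (m + 1) * (b - a) ≤ m * R ^ (m + 1) * |a - b| := by
    have : (μ / a) ^ (m + 1) ≤ R ^ (m + 1) := by gcongr
    calc _ ≤ m * (μ / a) ^ (m + 1) * |a - b| := by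
          gcongr; rw [abs_sub_comm]; exact le_abs_self _
      _ ≤ _ := by gcongr
  rw [e]
  linarith

theorem abs_perspective_rpow_sub_le (hm : 0 ≤ m) {a b μ ν R : ℝ} (ha : 0 < a) (hb : 0 < b)
    (hμ : 0 ≤ μ) (hν : 0 ≤ ν) (hμR : μ ≤ R * a) (hνR : ν ≤ R * b) :
    |μ ^ (m + 1) / a ^ m - ν ^ (m + 1) / b ^ m| ≤
      (m + 1) * R ^ m * |μ - ν| + m * R ^ (m + 1) * |a - b| := by
  rw [abs_le']
  refine ⟨perspective_rpow_sub_le hm ha hb hμ hν hμR, ?_⟩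
  rw [neg_sub, abs_sub_comm μ, abs_sub_comm a]
  exact perspective_rpow_sub_le hm hb ha hν hμ hνR

/-- The discrete Picone inequality. -/
theorem discrete_picone {p : ℝ} (hm : 0 ≤ m) (hmp : m < p - 1) {a b c d : ℝ} (ha : 0 < a)
    (hb : 0 < b) (hc : 0 ≤ c) (hd : 0 ≤ d) :
    signedPow (p - 1) (a - b) * (c ^ (m + 1) / a ^ m - d ^ (m + 1) / b ^ m) ≤
      |c - d| ^ (m + 1) * |a - b| ^ (p - (m + 1)) := by
  have key : ∀ {a b c d : ℝ}, 0 < a → 0 < b → 0 ≤ c → 0 ≤ d → b < a →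
      signedPow (p - 1) (a - b) * (c ^ (m + 1) / a ^ m - d ^ (m + 1) / b ^ m) ≤
      |c - d| ^ (m + 1) * |a - b| ^ (p - (m + 1)) := by
    intro a b c d ha hb hc hd hab
    have hab' : 0 < a - b := sub_pos.2 hab
    -- Splitting `a = b + (a - b)` and `c ≤ d + |c - d|` prepares subadditivity of the perspective,
    -- which isolates `|c - d|^(m+1) / (a - b)^m`.
    have h1 : c ^ (m + 1) / a ^ m ≤ (d + |c - d|) ^ (m + 1) / (b + (a - b)) ^ m := by
      rw [add_sub_cancel]
      have : c ≤ d + |c - d| := by linarith [le_abs_self (c - d)]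
      gcongr
    have h2 := h1.trans (perspective_rpow_add_le hm hb hab' hd (abs_nonneg (c - d)))
    rw [signedPow_of_nonneg (by linarith) hab'.le, abs_of_pos hab']
    have e : p - 1 = m + (p - (m + 1)) := by ring
    have := (Real.rpow_pos_of_pos hab' m).ne'
    calc (a - b) ^ (p - 1) * (c ^ (m + 1) / a ^ m - d ^ (m + 1) / b ^ m)
        ≤ (a - b) ^ (p - 1) * (|c - d| ^ (m + 1) / (a - b) ^ m) := by gcongr; linarith
      _ = _ := by rw [e, Real.rpow_add hab']; field_simp
  -- Exchanging the two points changes the sign of both factors on the left.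
  rcases lt_trichotomy a b with h | rfl | h
  · have := key hb ha hd hc h
    rw [← neg_sub a b, signedPow_neg, abs_neg, ← neg_sub c d, abs_neg] at this
    linarith
  · simp only [sub_self, signedPow_zero, zero_mul]
    positivity
  · exact key ha hb hc hd h

/-- Monotonicity of `[a - b]^(p-1) / a^m` in `a` and `b`. -/
theorem signedPow_sub_div_rpow_le {p : ℝ} (hm : 0 ≤ m) (hmp : m < p - 1) {a b c d : ℝ}
    (hc : 0 < c) (hb : 0 ≤ b) (hac : c ≤ a) (hbd : b ≤ d) :
    signedPow (p - 1) (c - d) / c ^ m ≤ signedPow (p - 1) (a - b) / a ^ m := by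
  have ha : 0 < a := hc.trans_le hac
  have hp : 0 < p - 1 := by linarith
  have hAB : c - d ≤ a - b := by linarith
  rcases le_or_gt (c - d) 0 with hB | hB
  · rcases le_or_gt (a - b) 0 with hA | hA
    · rw [signedPow_of_nonpos hp hB, signedPow_of_nonpos hp hA, neg_div, neg_div, neg_le_neg_iff]
      have : 0 ≤ -(a - b) := by linarith
      have : 0 ≤ -(c - d) := by linarith
      gcongr
    · exact (div_nonpos_of_nonpos_of_nonneg (signedPow_nonpos hB) (by positivity)).trans
        (div_nonneg (signedPow_nonneg hA.le) (by positivity))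
  · have hA : 0 < a - b := hB.trans_le hAB
    rw [signedPow_of_nonneg hp hB.le, signedPow_of_nonneg hp hA.le]
    -- The quotient is `((a - b) / a)^m (a - b)^(p-1-m)`, and both factors are monotone because `m <
    -- p - 1`.
    have e : p - 1 = m + (p - 1 - m) := by ring
    have h0 : 0 ≤ p - 1 - m := by linarith
    rw [e, Real.rpow_add hB, Real.rpow_add hA, mul_div_right_comm, mul_div_right_comm,
      ← Real.div_rpow hB.le hc.le, ← Real.div_rpow hA.le ha.le]
    have h1 : (c - d) / c ≤ (a - b) / a := by
      rw [div_le_div_iff₀ hc ha]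
      nlinarith
    gcongr

end Picone

/-! ### The truncated difference of powers and the discrete Díaz–Saa inequality. -/

/-- The truncated positive part `(min(a, k)^(m+1) - c^(m+1))⁺`. -/
noncomputable def truncDiff (m k a c : ℝ) : ℝ := max ((min a k) ^ (m + 1) - c ^ (m + 1)) 0

section TruncDiff

variable {m k : ℝ}

theorem truncDiff_nonneg (m k a c : ℝ) : 0 ≤ truncDiff m k a c := le_max_right _ _

theorem truncDiff_le (hk : 0 < k) {a c : ℝ} (ha : 0 ≤ a) (hc : 0 ≤ c) :
    truncDiff m k a c ≤ (min a k) ^ (m + 1) :=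
  max_le (sub_le_self _ (by positivity)) (by positivity)

theorem truncDiff_eq_zero_of_le (hm : 0 ≤ m) (hk : 0 < k) {a c : ℝ} (ha : 0 ≤ a)
    (h : min a k ≤ c) : truncDiff m k a c = 0 := by
  refine max_eq_right (sub_nonpos.2 ?_)
  gcongr

theorem truncDiff_of_le (hm : 0 ≤ m) {a c : ℝ} (hak : a ≤ k) (hc : 0 ≤ c) (h : c ≤ a) :
    truncDiff m k a c = a ^ (m + 1) - c ^ (m + 1) := by
  rw [truncDiff, min_eq_left hak, max_eq_left]
  rw [sub_nonneg]
  gcongr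

/-- Both numerators are powers of quantities at most `a`, so the Lipschitz bound for perspectives
applies with `R = 1`. -/
theorem truncDiff_div_eq_sub (hm : 0 ≤ m) (hk : 0 < k) {a c : ℝ} (ha : 0 < a) (hc : 0 < c) :
    truncDiff m k a c / a ^ m =
      (min a k) ^ (m + 1) / a ^ m - (min (min a k) c) ^ (m + 1) / a ^ m := by
  rw [← sub_div]
  congr 1
  rcases le_total (min a k) c with h | h
  · rw [truncDiff_eq_zero_of_le hm hk ha.le h, min_eq_left h, sub_self]
  · rw [truncDiff, min_eq_right h, max_eq_left]
    rw [sub_nonneg]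
    gcongr

/-- With the denominator `c^m` the positive part becomes a maximum in the numerator. The ratio of
that maximum to `c` is bounded only if `c` stays away from 0. -/
theorem truncDiff_div_eq_max_sub (hm : 0 ≤ m) (hk : 0 < k) {a c : ℝ} (ha : 0 < a) (hc : 0 < c) :
    truncDiff m k a c / c ^ m = (max (min a k) c) ^ (m + 1) / c ^ m - c := by
  have h0 : c ^ (m + 1) / c ^ m = c := by
    rw [Real.rpow_add_one hc.ne', mul_div_cancel_left₀]
    positivity
  rcases le_total (min a k) c with h | h
  · rw [truncDiff_eq_zero_of_le hm hk ha.le h, max_eq_right h, h0, zero_div, sub_self]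
  · rw [truncDiff, max_eq_left h, max_eq_left, sub_div, h0]
    rw [sub_nonneg]
    gcongr

/-- Each of the two perspectives contributes slopes `m + 1` and `m`. The constant depends neither on
`k` nor on a lower bound for the variables, which makes `discrete_diazSaa_lower_bound` uniform. -/
theorem abs_truncDiff_div_left_sub_le (hm : 0 ≤ m) (hk : 0 < k) {a b c d : ℝ} (ha : 0 < a)
    (hb : 0 < b) (hc : 0 < c) (hd : 0 < d) :
    |truncDiff m k a c / a ^ m - truncDiff m k b d / b ^ m| ≤
      (4 * m + 2) * (|a - b| + |c - d|) := by
  rw [truncDiff_div_eq_sub hm hk ha hc, truncDiff_div_eq_sub hm hk hb hd]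
  have h1 := abs_perspective_rpow_sub_le hm ha hb (μ := min a k) (ν := min b k) (R := 1)
    (by positivity) (by positivity) (by rw [one_mul]; exact min_le_left _ _)
    (by rw [one_mul]; exact min_le_left _ _)
  have h2 := abs_perspective_rpow_sub_le hm ha hb (μ := min (min a k) c) (ν := min (min b k) d)
    (R := 1) (by positivity) (by positivity)
    (by rw [one_mul]; exact (min_le_left _ _).trans (min_le_left _ _))
    (by rw [one_mul]; exact (min_le_left _ _).trans (min_le_left _ _))
  have h3 : |min a k - min b k| ≤ |a - b| := by
    simpa using abs_min_sub_min_le_max a k b k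
  have h4 : |min (min a k) c - min (min b k) d| ≤ |a - b| + |c - d| :=
    (abs_min_sub_min_le_max _ _ _ _).trans (max_le (by linarith [abs_nonneg (c - d)])
      (by linarith [abs_nonneg (a - b)]))
  simp only [Real.one_rpow, mul_one] at h1 h2
  have h5 := abs_sub ((min a k) ^ (m + 1) / a ^ m - (min b k) ^ (m + 1) / b ^ m)
    ((min (min a k) c) ^ (m + 1) / a ^ m - (min (min b k) d) ^ (m + 1) / b ^ m)
  rw [sub_sub_sub_comm]
  refine h5.trans ?_
  have h6 := mul_le_mul_of_nonneg_left h3 (by linarith : 0 ≤ m + 1)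
  have h7 := mul_le_mul_of_nonneg_left h4 (by linarith : 0 ≤ m + 1)
  nlinarith [abs_nonneg (c - d), abs_nonneg (a - b)]

theorem abs_max_min_sub_le {a b c d : ℝ} :
    |max (min a k) c - max (min b k) d| ≤ max |a - b| |c - d| := by
  refine (abs_max_sub_max_le_max _ _ _ _).trans (max_le_max ?_ le_rfl)
  simpa using abs_min_sub_min_le_max a k b k

/-- A Lipschitz constant for `truncDiff m k a c / c ^ m` in the region `c ≥ ε`. -/
noncomputable def truncLip (m k ε : ℝ) : ℝ :=
  (m + 1) * (max (k / ε) 1) ^ m + m * (max (k / ε) 1) ^ (m + 1) + 1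

theorem abs_truncDiff_div_right_sub_le (hm : 0 ≤ m) (hk : 0 < k) {a b c d ε : ℝ} (hε : 0 < ε)
    (ha : 0 < a) (hb : 0 < b) (hc : ε ≤ c) (hd : ε ≤ d) :
    |truncDiff m k a c / c ^ m - truncDiff m k b d / d ^ m| ≤
      truncLip m k ε * (|a - b| + |c - d|) := by
  have hc' := hε.trans_le hc
  have hd' := hε.trans_le hd
  rw [truncDiff_div_eq_max_sub hm hk ha hc', truncDiff_div_eq_max_sub hm hk hb hd']
  set R := max (k / ε) 1 with hR
  have hR0 : 0 < R := lt_max_of_lt_right one_pos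
  have hMR : ∀ x y : ℝ, ε ≤ y → max (min x k) y ≤ R * y := by
    intro x y hy
    have hy' := hε.trans_le hy
    refine max_le ((min_le_right _ _).trans ?_) (le_mul_of_one_le_left hy'.le (le_max_right _ _))
    calc k = k / ε * ε := by field_simp
      _ ≤ R * y := by gcongr; exact le_max_left _ _
  have h1 := abs_perspective_rpow_sub_le hm hc' hd' (μ := max (min a k) c)
    (ν := max (min b k) d) (R := R) (by positivity) (by positivity) (hMR a c hc) (hMR b d hd)
  have h4 : |max (min a k) c - max (min b k) d| ≤ |a - b| + |c - d| :=
    abs_max_min_sub_le.trans (max_le (by linarith [abs_nonneg (c - d)])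
      (by linarith [abs_nonneg (a - b)]))
  rw [sub_sub_sub_comm]
  refine (abs_sub _ _).trans ?_
  have h7 := mul_le_mul_of_nonneg_left h4 (by positivity : 0 ≤ (m + 1) * R ^ m)
  have h8 : 0 ≤ m * R ^ (m + 1) := by positivity
  unfold truncLip
  rw [← hR]
  nlinarith [abs_nonneg (c - d), abs_nonneg (a - b), mul_nonneg h8 (abs_nonneg (a - b))]

/-- The discrete Díaz–Saa inequality below the truncation level. -/
theorem discrete_diazSaa {p : ℝ} (hm : 0 ≤ m) (hmp : m < p - 1) {a b c d : ℝ}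
    (ha : 0 < a) (hb : 0 < b) (hc : 0 < c) (hd : 0 < d) (hak : a ≤ k) (hbk : b ≤ k) :
    0 ≤ signedPow (p - 1) (a - b) * (truncDiff m k a c / a ^ m - truncDiff m k b d / b ^ m) -
      signedPow (p - 1) (c - d) * (truncDiff m k a c / c ^ m - truncDiff m k b d / d ^ m) := by
  have hk : 0 < k := ha.trans_le hak
  -- Only the truncated difference at the first point survives here; it multiplies `[a-b]^(p-1) /
  -- a^m - [c-d]^(p-1) / c^m`, which is nonnegative by monotonicity.
  have mixed : ∀ {a b c d : ℝ}, 0 < a → 0 < b → 0 < c → 0 < d → a ≤ k → b ≤ k → c ≤ a → b ≤ d →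
      0 ≤ signedPow (p - 1) (a - b) * (truncDiff m k a c / a ^ m - truncDiff m k b d / b ^ m) -
      signedPow (p - 1) (c - d) * (truncDiff m k a c / c ^ m - truncDiff m k b d / d ^ m) := by
    intro a b c d ha hb hc hd hak hbk hca hbd
    rw [truncDiff_eq_zero_of_le hm hk hb.le ((min_le_left b k).trans hbd), zero_div, zero_div,
      sub_zero, sub_zero]
    have := mul_le_mul_of_nonneg_left (signedPow_sub_div_rpow_le hm hmp hc hb.le hca hbd)
      (truncDiff_nonneg m k a c)
    calc (0 : ℝ) ≤ _ := sub_nonneg.2 this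
      _ = _ := by ring
  rcases le_total c a with h1 | h1 <;> rcases le_total d b with h2 | h2
  -- With both differences active the expression is `|a-b|^p + |c-d|^p` minus two Picone products,
  -- and these add up to at most the same quantity.
  · have hself : ∀ x : ℝ, 0 < x → x ^ (m + 1) / x ^ m = x := fun x hx => by
      rw [Real.rpow_add_one hx.ne', mul_div_cancel_left₀]
      positivity
    rw [truncDiff_of_le hm hak hc.le h1, truncDiff_of_le hm hbk hd.le h2]
    simp only [sub_div, hself _ ha, hself _ hb, hself _ hc, hself _ hd]
    have e1 := discrete_picone hm hmp ha hb hc.le hd.le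
    have e2 := discrete_picone hm hmp hc hd ha.le hb.le
    have e3 := rpow_mul_rpow_add_le (p := p) (q := m + 1) (by linarith) (by linarith)
      (abs_nonneg (a - b)) (abs_nonneg (c - d))
    have e4 := signedPow_mul_self (by linarith : 1 < p) (a - b)
    have e5 := signedPow_mul_self (by linarith : 1 < p) (c - d)
    linarith
  · exact mixed ha hb hc hd hak hbk h1 h2
  · have := mixed hb ha hd hc hbk hak h2 h1
    rw [← neg_sub a b, ← neg_sub c d, signedPow_neg, signedPow_neg] at this
    linarith
  · rw [truncDiff_eq_zero_of_le hm hk ha.le ((min_le_left a k).trans h1),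
      truncDiff_eq_zero_of_le hm hk hb.le ((min_le_left b k).trans h2)]
    simp

/-- A lower bound for the truncated Díaz–Saa expression without restriction. -/
theorem discrete_diazSaa_lower_bound {p : ℝ} (hm : 0 ≤ m) (hmp : m < p - 1) (hk : 0 < k)
    {a b c d : ℝ} (ha : 0 < a) (hb : 0 < b) (hc : 0 < c) (hd : 0 < d) :
    -(8 * m + 5) * (|a - b| ^ p + |c - d| ^ p) ≤
      signedPow (p - 1) (a - b) * (truncDiff m k a c / a ^ m - truncDiff m k b d / b ^ m) -
      signedPow (p - 1) (c - d) * (truncDiff m k a c / c ^ m - truncDiff m k b d / d ^ m) := by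
  have hp : 1 < p := by linarith
  -- The Lipschitz constant `4m + 2` is doubled by Young's inequality on the cross term.
  have h1 : -((8 * m + 4) * (|a - b| ^ p + |c - d| ^ p)) ≤
      signedPow (p - 1) (a - b) * (truncDiff m k a c / a ^ m - truncDiff m k b d / b ^ m) := by
    refine neg_le_of_abs_le ?_
    rw [abs_mul, abs_signedPow (by linarith)]
    have hA : |a - b| ^ (p - 1) * |a - b| = |a - b| ^ p := by
      rw [← Real.rpow_add_one' (abs_nonneg _) (by linarith)]; ring_nf
    have hB := rpow_mul_rpow_le_add (p := p) (q := p - 1) (by linarith) (by linarith)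
      (abs_nonneg (a - b)) (abs_nonneg (c - d))
    rw [sub_sub_cancel, Real.rpow_one] at hB
    have hC : 0 ≤ |c - d| ^ p := by positivity
    calc |a - b| ^ (p - 1) * |truncDiff m k a c / a ^ m - truncDiff m k b d / b ^ m|
        ≤ |a - b| ^ (p - 1) * ((4 * m + 2) * (|a - b| + |c - d|)) := by
          gcongr; exact abs_truncDiff_div_left_sub_le hm hk ha hb hc hd
      _ = (4 * m + 2) * (|a - b| ^ p + |a - b| ^ (p - 1) * |c - d|) := by rw [← hA]; ring
      _ ≤ (4 * m + 2) * (|a - b| ^ p + (|a - b| ^ p + |c - d| ^ p)) := by gcongr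
      _ ≤ _ := by nlinarith
  -- A Lipschitz bound would degenerate for small `c`, `d`. Picone with the numerators `max (min a
  -- k) c` and `max (min b k) d` avoids this: the `|c - d|^p` from the subtracted `c` and `d`
  -- cancels the one produced by Young.
  have h2 : -(|a - b| ^ p + |c - d| ^ p) ≤
      -(signedPow (p - 1) (c - d) * (truncDiff m k a c / c ^ m - truncDiff m k b d / d ^ m)) := by
    rw [truncDiff_div_eq_max_sub hm hk ha hc, truncDiff_div_eq_max_sub hm hk hb hd]
    have e1 := discrete_picone hm hmp hc hd (c := max (min a k) c) (d := max (min b k) d)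
      (by positivity) (by positivity)
    have e2 := signedPow_mul_self hp (c - d)
    have e3 := rpow_mul_rpow_le_add (p := p) (q := m + 1) (by linarith) (by linarith)
      (abs_nonneg (max (min a k) c - max (min b k) d)) (abs_nonneg (c - d))
    have e4 : |max (min a k) c - max (min b k) d| ^ p ≤ |a - b| ^ p + |c - d| ^ p := by
      have h0 : |max (min a k) c - max (min b k) d| ^ p ≤ (max |a - b| |c - d|) ^ p := by
        gcongr
        exact abs_max_min_sub_le
      refine h0.trans ?_
      have ha' : 0 ≤ |a - b| ^ p := by positivity
      have hc' : 0 ≤ |c - d| ^ p := by positivity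
      rcases max_choice |a - b| |c - d| with h | h <;> rw [h] <;> linarith
    linarith
  linarith

end TruncDiff

/-! ### The `p`-Laplacian form as an average over directions. -/

section Averaging

theorem continuous_directional {E : Type*} [NormedAddCommGroup E] [InnerProductSpace ℝ E] {p : ℝ}
    (hp : 1 < p) (ξ A : E) :
    Continuous fun e : E => signedPow (p - 1) (inner ℝ e ξ) * inner ℝ e A :=
  ((continuous_signedPow (by linarith)).comp (by fun_prop)).mul (by fun_prop)

variable {E : Type*} [NormedAddCommGroup E] [InnerProductSpace ℝ E] [FiniteDimensional ℝ E]
  [MeasurableSpace E] [BorelSpace E]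

/-- The average over directions `e` in the unit ball of the one-dimensional forms
`[⟨e, ξ⟩]^(p-1) ⟨e, A⟩`. -/
noncomputable def directionalForm (p : ℝ) (ξ A : E) : ℝ :=
  ∫ e in Metric.ball (0 : E) 1, signedPow (p - 1) (inner ℝ e ξ) * inner ℝ e A

theorem integrableOn_ball_of_continuous {f : E → ℝ} (hf : Continuous f) (r : ℝ) :
    IntegrableOn f (Metric.ball (0 : E) r) volume :=
  (hf.continuousOn.integrableOn_compact (isCompact_closedBall (0 : E) r)).mono_set
    Metric.ball_subset_closedBall

theorem directionalForm_map (p : ℝ) (f : E ≃ₗᵢ[ℝ] E) (ξ A : E) :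
    directionalForm p (f ξ) (f A) = directionalForm p ξ A := by
  have h := f.measurePreserving.setIntegral_preimage_emb
    f.toHomeomorph.measurableEmbedding
    (fun e => signedPow (p - 1) (inner ℝ e (f ξ)) * inner ℝ e (f A)) (Metric.ball (0 : E) 1)
  rw [directionalForm, ← h]
  simp [directionalForm, LinearIsometryEquiv.inner_map_map]

theorem directionalForm_smul_right (p : ℝ) (ξ A : E) (c : ℝ) :
    directionalForm p ξ (c • A) = c * directionalForm p ξ A := by
  rw [directionalForm, directionalForm, ← integral_const_mul]
  simp only [inner_smul_right]
  congr 1 with e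
  ring

theorem directionalForm_add_right {p : ℝ} (hp : 1 < p) (ξ A B : E) :
    directionalForm p ξ (A + B) = directionalForm p ξ A + directionalForm p ξ B := by
  rw [directionalForm, directionalForm, directionalForm, ← integral_add
    (integrableOn_ball_of_continuous (continuous_directional hp ξ A) 1)
    (integrableOn_ball_of_continuous (continuous_directional hp ξ B) 1)]
  simp only [inner_add_right, mul_add]

/-- The reflection in the hyperplane `A^⊥` fixes `ξ`, sends `A` to `-A`, and preserves the form. -/
theorem directionalForm_eq_zero_of_inner_eq_zero (p : ℝ) {ξ A : E} (h : inner ℝ A ξ = 0) :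
    directionalForm p ξ A = 0 := by
  have h1 : (ℝ ∙ A)ᗮ.reflection A = -A := Submodule.reflection_orthogonalComplement_singleton_eq_neg A
  have h2 : (ℝ ∙ A)ᗮ.reflection ξ = ξ := by
    rw [Submodule.reflection_eq_self_iff, Submodule.mem_orthogonal_singleton_iff_inner_right]
    exact h
  have h3 := directionalForm_map p (ℝ ∙ A)ᗮ.reflection ξ A
  rw [h1, h2, ← neg_one_smul ℝ A, directionalForm_smul_right] at h3
  linarith

theorem directionalForm_smul_self {p : ℝ} (hp : 1 < p) {c : ℝ} (hc : 0 ≤ c) (ξ : E) :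
    directionalForm p (c • ξ) (c • ξ) = c ^ p * directionalForm p ξ ξ := by
  rw [directionalForm, directionalForm, ← integral_const_mul]
  congr 1 with e
  rw [signedPow_mul_self hp, signedPow_mul_self hp, inner_smul_right, abs_mul, abs_of_nonneg hc,
    Real.mul_rpow hc (abs_nonneg _)]

theorem directionalForm_self_pos {p : ℝ} (hp : 1 < p) {ξ : E} (hξ : ξ ≠ 0) :
    0 < directionalForm p ξ ξ := by
  rw [directionalForm, setIntegral_pos_iff_support_of_nonneg_ae]
  · have ho : IsOpen ({e : E | inner ℝ e ξ ≠ (0 : ℝ)} ∩ Metric.ball 0 1) :=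
      (isOpen_ne_fun (by fun_prop) continuous_const).inter Metric.isOpen_ball
    -- This point has norm `1/2`, so it lies in the ball, and it is not orthogonal to `ξ`.
    refine (ho.measure_pos volume ⟨(2 * ‖ξ‖)⁻¹ • ξ, ?_, ?_⟩).trans_le (measure_mono ?_)
    · have := norm_ne_zero_iff.2 hξ
      simp [inner_smul_left, hξ]
    · have := norm_ne_zero_iff.2 hξ
      rw [mem_ball_zero_iff, norm_smul, norm_inv, norm_mul, norm_norm]
      field_simp
      norm_num
    · rintro e ⟨h1, h2⟩
      refine ⟨?_, h2⟩
      rw [Function.mem_support, signedPow_mul_self hp]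
      exact (Real.rpow_pos_of_pos (abs_pos.2 h1) p).ne'
  · refine ae_of_all _ fun e => ?_
    simp only [Pi.zero_apply]
    rw [signedPow_mul_self hp]
    positivity
  · exact integrableOn_ball_of_continuous (continuous_directional hp ξ ξ) 1

/-- The `p`-Laplacian form is the average of its one-dimensional analogues. -/
theorem exists_directionalForm_eq [Nontrivial E] {p : ℝ} (hp : 1 < p) :
    ∃ κ : ℝ, 0 < κ ∧ ∀ ξ A : E,
      directionalForm p ξ A = κ * (‖ξ‖ ^ (p - 2) * inner ℝ ξ A) := by
  obtain ⟨e₀, he₀⟩ := exists_norm_eq E zero_le_one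
  have he₀' : e₀ ≠ 0 := by rintro rfl; simp at he₀
  refine ⟨directionalForm p e₀ e₀, directionalForm_self_pos hp he₀', fun ξ A => ?_⟩
  rcases eq_or_ne ξ 0 with rfl | hξ
  · simp [directionalForm, signedPow_zero]
  have hn : 0 < ‖ξ‖ := norm_pos_iff.2 hξ
  have h1 : directionalForm p ξ ξ = ‖ξ‖ ^ p * directionalForm p e₀ e₀ := by
    have hnorm : ‖‖ξ‖ • e₀‖ = ‖ξ‖ := by rw [norm_smul, norm_norm, he₀, mul_one]
    -- This reflection carries `‖ξ‖ e₀` to `ξ`, the two having equal norm.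
    have := directionalForm_map p (ℝ ∙ (‖ξ‖ • e₀ - ξ))ᗮ.reflection (‖ξ‖ • e₀) (‖ξ‖ • e₀)
    rw [Submodule.reflection_sub hnorm, directionalForm_smul_self hp hn.le] at this
    exact this
  set c : ℝ := inner ℝ ξ A / ‖ξ‖ ^ 2 with hc
  have h2 : A = c • ξ + (A - c • ξ) := by abel
  have h3 : directionalForm p ξ (A - c • ξ) = 0 := by
    refine directionalForm_eq_zero_of_inner_eq_zero p ?_
    rw [inner_sub_left, inner_smul_left, real_inner_self_eq_norm_sq, real_inner_comm]
    simp only [conj_trivial, hc]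
    field_simp
    ring
  rw [h2, directionalForm_add_right hp, h3, add_zero, directionalForm_smul_right, h1, ← h2, hc]
  have : ‖ξ‖ ^ (p - 2) = ‖ξ‖ ^ p / ‖ξ‖ ^ 2 := by
    rw [Real.rpow_sub hn]; norm_num
  rw [this]
  field_simp

/-- A one-dimensional inequality in all directions passes to the `p`-Laplacian forms. -/
theorem plaplace_form_lower_bound [Nontrivial E] {p : ℝ} (hp : 1 < p) {ξ A η B : E} {C : ℝ}
    (h : ∀ e : E, -C * (|inner ℝ e ξ| ^ p + |inner ℝ e η| ^ p) ≤
      signedPow (p - 1) (inner ℝ e ξ) * inner ℝ e A -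
        signedPow (p - 1) (inner ℝ e η) * inner ℝ e B) :
    -C * (‖ξ‖ ^ p + ‖η‖ ^ p) ≤
      ‖ξ‖ ^ (p - 2) * inner ℝ ξ A - ‖η‖ ^ (p - 2) * inner ℝ η B := by
  obtain ⟨κ, hκ, hJ⟩ := exists_directionalForm_eq (E := E) hp
  have hint := fun ξ A : E => integrableOn_ball_of_continuous (continuous_directional hp ξ A) 1
  have h1 : -C * (directionalForm p ξ ξ + directionalForm p η η) ≤
      directionalForm p ξ A - directionalForm p η B := by
    unfold directionalForm
    rw [← integral_add (hint ξ ξ) (hint η η), ← integral_sub (hint ξ A) (hint η B),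
      ← integral_const_mul]
    refine integral_mono (((hint ξ ξ).add (hint η η)).const_mul _) ((hint ξ A).sub (hint η B)) ?_
    intro e
    simpa only [signedPow_mul_self hp] using h e
  have hself : ∀ z : E, ‖z‖ ^ (p - 2) * inner ℝ z z = ‖z‖ ^ p := by
    intro z
    rw [real_inner_self_eq_norm_sq, ← Real.rpow_natCast, ← Real.rpow_add' (norm_nonneg _)] <;> norm_num
    linarith
  rw [hJ, hJ, hJ, hJ, hself, hself] at h1
  refine le_of_mul_le_mul_left ?_ hκ
  linarith

end Averaging

/-! ### `L^p` norms with a real exponent. -/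

section PNorm

variable {α F : Type*} [MeasurableSpace α] {μ : Measure α} [NormedAddCommGroup F] {p : ℝ}

theorem eLpNorm_ofReal_eq (hp : 0 < p) (f : α → F) :
    eLpNorm f (ENNReal.ofReal p) μ = (∫⁻ x, ‖f x‖ₑ ^ p ∂μ) ^ (1 / p) := by
  rw [eLpNorm_eq_lintegral_rpow_enorm_toReal (by simpa using hp) ENNReal.ofReal_ne_top,
    ENNReal.toReal_ofReal hp.le]

theorem eLpNorm_ofReal_rpow (hp : 0 < p) (f : α → F) :
    eLpNorm f (ENNReal.ofReal p) μ ^ p = ∫⁻ x, ‖f x‖ₑ ^ p ∂μ := by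
  rw [eLpNorm_ofReal_eq hp, ← ENNReal.rpow_mul, one_div_mul_cancel hp.ne', ENNReal.rpow_one]

theorem memLp_ofReal_iff (hp : 0 < p) {f : α → F} (hf : AEStronglyMeasurable f μ) :
    MemLp f (ENNReal.ofReal p) μ ↔ ∫⁻ x, ‖f x‖ₑ ^ p ∂μ < ⊤ := by
  rw [MemLp, and_iff_right hf, eLpNorm_lt_top_iff_lintegral_rpow_enorm_lt_top
    (by simpa using hp) ENNReal.ofReal_ne_top, ENNReal.toReal_ofReal hp.le]

theorem MemLp.integrable_norm_rpow_ofReal (hp : 0 < p) {f : α → F}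
    (hf : MemLp f (ENNReal.ofReal p) μ) : Integrable (fun x => ‖f x‖ ^ p) μ := by
  have := hf.integrable_norm_rpow (by simpa using hp) ENNReal.ofReal_ne_top
  rwa [ENNReal.toReal_ofReal hp.le] at this

theorem tendsto_eLpNorm_ofReal_zero (hp : 0 < p) {ι : Type*} {l : Filter ι} {f : ι → α → F} :
    Tendsto (fun i => eLpNorm (f i) (ENNReal.ofReal p) μ) l (𝓝 0) ↔
      Tendsto (fun i => ∫⁻ x, ‖f i x‖ₑ ^ p ∂μ) l (𝓝 0) := by
  constructor
  · intro h
    have := (ENNReal.continuous_rpow_const (y := p)).tendsto 0 |>.comp h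
    rw [ENNReal.zero_rpow_of_pos hp] at this
    simpa only [Function.comp_def, eLpNorm_ofReal_rpow hp] using this
  · intro h
    have := (ENNReal.continuous_rpow_const (y := 1 / p)).tendsto 0 |>.comp h
    rw [ENNReal.zero_rpow_of_pos (by positivity)] at this
    simpa only [Function.comp_def, eLpNorm_ofReal_eq hp] using this

/-- Jensen's inequality for the `p`-th power of a parametric integral. -/
theorem lintegral_enorm_integral_rpow_le {β : Type*} [MeasurableSpace β] {ν : Measure β}
    [IsProbabilityMeasure ν] [SFinite μ] [NormedSpace ℝ F] (hp : 1 ≤ p) {f : β × α → F}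
    (hf : AEStronglyMeasurable f (ν.prod μ)) :
    ∫⁻ x, ‖∫ s, f (s, x) ∂ν‖ₑ ^ p ∂μ ≤ ∫⁻ s, ∫⁻ x, ‖f (s, x)‖ₑ ^ p ∂μ ∂ν := by
  have hp0 : 0 < p := by linarith
  rw [lintegral_lintegral_swap (f := fun s x => ‖f (s, x)‖ₑ ^ p) (hf.enorm.pow_const p)]
  refine lintegral_mono_ae ?_
  filter_upwards [hf.prod_swap.prodMk_left] with x hx
  have hx' : AEStronglyMeasurable (fun s => f (s, x)) ν := hx
  have h1 := eLpNorm_le_eLpNorm_of_exponent_le (p := 1) (q := ENNReal.ofReal p)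
    (by simpa using ENNReal.ofReal_le_ofReal hp) hx'
  rw [← eLpNorm_ofReal_rpow hp0]
  gcongr
  refine (enorm_integral_le_lintegral_enorm _).trans ?_
  rwa [← eLpNorm_one_eq_lintegral_enorm]

end PNorm

/-! ### Translations, the shear `(s, x) ↦ (s, x + s v)`, and continuity of translation in `L^p`. -/

section Translation

variable {E : Type*} [NormedAddCommGroup E] [InnerProductSpace ℝ E] [FiniteDimensional ℝ E]
  [MeasurableSpace E] [BorelSpace E]

/-- The uniform measure on `(0, 1]`. -/
noncomputable abbrev unitMeasure : Measure ℝ := volume.restrict (Ioc (0 : ℝ) 1)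

instance isProbabilityMeasure_unitMeasure : IsProbabilityMeasure unitMeasure :=
  ⟨by simp⟩

/-- Transfers measurability and integrability of functions of `x` to functions of `x + s v`, jointly
in `(s, x)`, as Fubini requires. -/
theorem measurePreserving_shear (v : E) :
    MeasurePreserving (fun z : ℝ × E => (z.1, z.2 + z.1 • v)) (unitMeasure.prod volume)
      (unitMeasure.prod (volume : Measure E)) :=
  (MeasurePreserving.id _).skew_product (by fun_prop)
    (ae_of_all _ fun s => (measurePreserving_add_right volume (s • v)).map_eq)

/-- Since `0 < s ≤ 1`, the factor in `φ` vanishes for `‖x‖ > R + ‖v‖`, so `g` may be cut off to a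
ball, where it is integrable. -/
theorem integrable_prod_comp_sub_mul {g φ : E → ℝ} (hg : LocallyIntegrable g volume)
    (hφ : Continuous φ) (hφs : HasCompactSupport φ) (v : E) :
    Integrable (fun z : ℝ × E => φ (z.2 - z.1 • v) * g z.2) (unitMeasure.prod volume) := by
  obtain ⟨R, hR⟩ := hφs.isCompact.isBounded.subset_closedBall (0 : E)
  obtain ⟨C, hC⟩ := hφ.bounded_above_of_compact_support hφs
  have h1 : Integrable ((Metric.closedBall (0 : E) (R + ‖v‖)).indicator g) volume :=
    (hg.integrableOn_isCompact (isCompact_closedBall _ _)).integrable_indicator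
      measurableSet_closedBall
  have h2 := (h1.comp_snd unitMeasure).bdd_mul (f := fun z : ℝ × E => φ (z.2 - z.1 • v)) (c := C)
    (by fun_prop) (ae_of_all _ fun z => hC _)
  refine h2.congr ?_
  have h3 : ∀ᵐ z : ℝ × E ∂(unitMeasure.prod volume), z.1 ∈ Ioc (0 : ℝ) 1 :=
    Measure.quasiMeasurePreserving_fst.ae (ae_restrict_mem measurableSet_Ioc)
  filter_upwards [h3] with z hz
  by_cases hmem : z.2 ∈ Metric.closedBall (0 : E) (R + ‖v‖)
  · rw [indicator_of_mem hmem]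
  · have : φ (z.2 - z.1 • v) = 0 := by
      by_contra hne
      have h4 := hR (subset_tsupport φ hne)
      rw [mem_closedBall_zero_iff] at h4 hmem
      refine hmem ?_
      calc ‖z.2‖ = ‖(z.2 - z.1 • v) + z.1 • v‖ := by rw [sub_add_cancel]
        _ ≤ ‖z.2 - z.1 • v‖ + ‖z.1 • v‖ := norm_add_le _ _
        _ ≤ R + ‖v‖ := by
          rw [norm_smul, Real.norm_of_nonneg hz.1.le]
          have := mul_le_mul_of_nonneg_right hz.2 (norm_nonneg v)
          linarith
    rw [this, zero_mul, zero_mul]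

theorem integrable_prod_mul_comp_add {g φ : E → ℝ} (hg : LocallyIntegrable g volume)
    (hφ : Continuous φ) (hφs : HasCompactSupport φ) (v : E) :
    Integrable (fun z : ℝ × E => φ z.2 * g (z.2 + z.1 • v)) (unitMeasure.prod volume) := by
  have := (measurePreserving_shear v).integrable_comp_of_integrable
    (integrable_prod_comp_sub_mul hg hφ hφs v)
  simpa [Function.comp_def] using this

theorem locallyIntegrable_integral_translate {g : E → ℝ} (hg : LocallyIntegrable g volume)
    (v : E) : LocallyIntegrable (fun x => ∫ s, g (x + s • v) ∂unitMeasure) volume := by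
  intro x₀
  let f : ContDiffBump x₀ := default
  have h1 := (integrable_prod_mul_comp_add hg f.continuous f.hasCompactSupport v).integral_prod_right
  refine ⟨Metric.closedBall x₀ f.rIn, Metric.closedBall_mem_nhds _ f.rIn_pos, ?_⟩
  refine (h1.integrableOn (s := Metric.closedBall x₀ f.rIn)).congr_fun ?_ measurableSet_closedBall
  intro x hx
  simp [f.one_of_mem_closedBall hx]

theorem tendsto_lintegral_translate_sub {F : Type*} [NormedAddCommGroup F] {p : ℝ} (hp : 1 ≤ p)
    {g : E → F} (hg : MemLp g (ENNReal.ofReal p) volume) :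
    Tendsto (fun h : E => ∫⁻ x, ‖g (x + h) - g x‖ₑ ^ p) (𝓝 0) (𝓝 0) := by
  have hp0 : 0 < p := by linarith
  have : Fact (1 ≤ ENNReal.ofReal p) := ⟨by simpa using ENNReal.ofReal_le_ofReal hp⟩
  rw [← tendsto_eLpNorm_ofReal_zero hp0]
  let T : E → C(E, E) := fun h => ⟨fun x => x + h, by fun_prop⟩
  have hTm : ∀ h, MeasurePreserving (T h) volume volume := fun h =>
    measurePreserving_add_right volume h
  have hTc : Continuous T := ContinuousMap.continuous_of_continuous_uncurry _ (by
    simp only [T, Function.uncurry_def, ContinuousMap.coe_mk]; fun_prop)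
  have h1 : Continuous fun h => Lp.compMeasurePreserving (T h) (hTm h) hg.toLp :=
    continuous_const.compMeasurePreservingLp hTc hTm ENNReal.ofReal_ne_top
  have h2 := (h1.tendsto 0).edist
    (tendsto_const_nhds (x := Lp.compMeasurePreserving (T 0) (hTm 0) hg.toLp))
  rw [edist_self] at h2
  refine h2.congr fun h => ?_
  rw [Lp.edist_def]
  refine eLpNorm_congr_ae ?_
  have h3 : ∀ h, Lp.compMeasurePreserving (T h) (hTm h) hg.toLp =ᵐ[volume] fun x => g (x + h) := by
    intro h
    exact (Lp.coeFn_compMeasurePreserving _ (hTm h)).trans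
      ((hTm h).quasiMeasurePreserving.ae_eq_comp hg.coeFn_toLp)
  filter_upwards [h3 h, h3 0] with x hx hx0
  rw [Pi.sub_apply, hx, hx0, add_zero]

end Translation

/-! ### Increments and difference quotients of Sobolev functions. -/

section WeakGradient

variable {N : ℕ}

theorem locallyIntegrable_comp_add_right {u : EuclideanSpace ℝ (Fin N) → ℝ}
    (hu : LocallyIntegrable u volume) (v : EuclideanSpace ℝ (Fin N)) :
    LocallyIntegrable (fun x => u (x + v)) volume := by
  have h := locallyIntegrable_map_homeomorph (Homeomorph.addRight v) (f := u) (μ := volume)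
  rw [show Measure.map (Homeomorph.addRight v) volume = volume from
    (measurePreserving_add_right volume v).map_eq] at h
  exact h.1 hu

theorem LocallyIntegrable.inner_const_right
    {G : EuclideanSpace ℝ (Fin N) → EuclideanSpace ℝ (Fin N)}
    (hG : LocallyIntegrable G volume) (v : EuclideanSpace ℝ (Fin N)) :
    LocallyIntegrable (fun x => (inner ℝ (G x) v : ℝ)) volume := by
  intro x
  obtain ⟨s, hs, h⟩ := hG x
  exact ⟨s, hs, Integrable.inner_const h v⟩

theorem sub_eq_integral_fderiv {φ : EuclideanSpace ℝ (Fin N) → ℝ} (hφ : ContDiff ℝ ∞ φ)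
    (x v : EuclideanSpace ℝ (Fin N)) :
    φ (x - v) - φ x = -∫ s, fderiv ℝ φ (x - s • v) v ∂unitMeasure := by
  have hd : ∀ s : ℝ, HasDerivAt (fun s : ℝ => φ (x - s • v)) (-(fderiv ℝ φ (x - s • v) v)) s := by
    intro s
    have h1 : HasDerivAt (fun s : ℝ => x - s • v) (-v) s := by
      simpa using ((hasDerivAt_id s).smul_const v).const_sub x
    have h2 := ((hφ.differentiable (by simp)) (x - s • v)).hasFDerivAt.comp_hasDerivAt s h1
    simpa [Function.comp_def] using h2
  have hc : Continuous fun s : ℝ => -(fderiv ℝ φ (x - s • v) v) := by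
    have := hφ.continuous_fderiv (by simp)
    fun_prop
  have h := intervalIntegral.integral_eq_sub_of_hasDerivAt (a := 0) (b := 1) (fun s _ => hd s)
    (hc.intervalIntegrable 0 1)
  rw [intervalIntegral.integral_neg, intervalIntegral.integral_of_le zero_le_one] at h
  simpa using h.symm

/-- The fundamental theorem of calculus by duality: against a test function the translation moves
onto the test function, where the classical formula holds; the weak gradient identity and Fubini
move everything back. -/
theorem IsWeakGradient.translate_sub_ae {u : EuclideanSpace ℝ (Fin N) → ℝ}
    {G : EuclideanSpace ℝ (Fin N) → EuclideanSpace ℝ (Fin N)} (h : IsWeakGradient u G)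
    (v : EuclideanSpace ℝ (Fin N)) :
    ∀ᵐ x, u (x + v) - u x = ∫ s, inner ℝ (G (x + s • v)) v ∂unitMeasure := by
  have hu := h.locallyIntegrable_fun
  have hg := LocallyIntegrable.inner_const_right h.locallyIntegrable_grad v
  refine ae_eq_of_integral_contDiff_smul_eq ((locallyIntegrable_comp_add_right hu v).sub hu)
    (locallyIntegrable_integral_translate hg v) fun φ hφ hφs => ?_
  have hφc := hφ.continuous
  have hψc : Continuous fun x => fderiv ℝ φ x v := by
    have := hφ.continuous_fderiv (by simp)
    fun_prop
  have hψs : HasCompactSupport fun x => fderiv ℝ φ x v := hφs.fderiv_apply ℝ v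
  have i1 : Integrable (fun x => φ x * u (x + v)) volume :=
    (locallyIntegrable_comp_add_right hu v).integrable_smul_left_of_hasCompactSupport hφc hφs
  have i2 : Integrable (fun x => φ x * u x) volume :=
    hu.integrable_smul_left_of_hasCompactSupport hφc hφs
  have e1 : ∫ x, φ x * u (x + v) = ∫ x, φ (x - v) * u x := by
    simpa using integral_add_right_eq_self (μ := volume) (fun x => φ (x - v) * u x) v
  have i3 : Integrable (fun x => φ (x - v) * u x) volume := by
    simpa using i1.comp_sub_right v
  have e2 : ∀ s : ℝ, ∫ x, fderiv ℝ φ (x - s • v) v * u x =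
      -∫ x, φ x * inner ℝ (G (x + s • v)) v := by
    intro s
    have hs : HasCompactSupport fun x => φ (x - s • v) := by
      simpa [Function.comp_def, sub_eq_add_neg] using
        hφs.comp_homeomorph (Homeomorph.addRight (-(s • v)))
    have h1 := h.integral_eq (fun x => φ (x - s • v)) (by fun_prop) hs v
    have h2 : ∀ x, fderiv ℝ (fun x => φ (x - s • v)) x = fderiv ℝ φ (x - s • v) := fun x => by
      simpa [sub_eq_add_neg] using fderiv_comp_add_right (𝕜 := ℝ) (f := φ) (x := x) (-(s • v))
    simp only [h2] at h1
    simp_rw [mul_comm _ (u _)]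
    rw [h1]
    congr 1
    simpa using (integral_add_right_eq_self (μ := volume)
      (fun x => φ (x - s • v) * inner ℝ (G x) v) (s • v)).symm
  simp only [smul_eq_mul]
  calc ∫ x, φ x * (u (x + v) - u x) = ∫ x, (φ (x - v) - φ x) * u x := by
        simp_rw [mul_sub, sub_mul]
        rw [integral_sub i1 i2, integral_sub i3 i2, e1]
    _ = ∫ x, -∫ s, fderiv ℝ φ (x - s • v) v * u x ∂unitMeasure := by
        congr 1 with x
        rw [sub_eq_integral_fderiv hφ, integral_mul_const, neg_mul]
    _ = -∫ s, (∫ x, fderiv ℝ φ (x - s • v) v * u x) ∂unitMeasure := by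
        rw [integral_neg, integral_integral_swap]
        exact (integrable_prod_comp_sub_mul hu hψc hψs v).swap
    _ = ∫ s, (∫ x, φ x * inner ℝ (G (x + s • v)) v) ∂unitMeasure := by
        simp_rw [e2]
        rw [integral_neg, neg_neg]
    _ = ∫ x, ∫ s, φ x * inner ℝ (G (x + s • v)) v ∂unitMeasure := by
        rw [integral_integral_swap]
        exact integrable_prod_mul_comp_add hg hφc hφs v
    _ = _ := by simp_rw [integral_const_mul]

theorem IsWeakGradient.aestronglyMeasurable_inner_shear {u : EuclideanSpace ℝ (Fin N) → ℝ}
    {G : EuclideanSpace ℝ (Fin N) → EuclideanSpace ℝ (Fin N)} (h : IsWeakGradient u G)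
    (v w : EuclideanSpace ℝ (Fin N)) :
    AEStronglyMeasurable (fun z : ℝ × EuclideanSpace ℝ (Fin N) => (inner ℝ (G (z.2 + z.1 • v)) w : ℝ))
      (unitMeasure.prod volume) := by
  have hg : AEStronglyMeasurable (fun x => (inner ℝ (G x) w : ℝ)) volume :=
    (LocallyIntegrable.inner_const_right h.locallyIntegrable_grad w).aestronglyMeasurable
  have h2 : AEStronglyMeasurable
      (fun z : ℝ × EuclideanSpace ℝ (Fin N) => (inner ℝ (G z.2) w : ℝ)) (unitMeasure.prod volume) :=
    hg.comp_snd
  have h3 := h2.comp_measurePreserving (measurePreserving_shear v)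
  exact h3

/-- Jensen's inequality for the integral formula of the increment, followed by translation
invariance of Lebesgue measure. -/
theorem IsWeakGradient.lintegral_translate_sub_le {p : ℝ} (hp : 1 ≤ p)
    {u : EuclideanSpace ℝ (Fin N) → ℝ}
    {G : EuclideanSpace ℝ (Fin N) → EuclideanSpace ℝ (Fin N)} (h : IsWeakGradient u G)
    (v : EuclideanSpace ℝ (Fin N)) :
    ∫⁻ x, ‖u (x + v) - u x‖ₑ ^ p ≤ ∫⁻ x, ‖(inner ℝ (G x) v : ℝ)‖ₑ ^ p := by
  calc ∫⁻ x, ‖u (x + v) - u x‖ₑ ^ p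
      = ∫⁻ x, ‖∫ s, inner ℝ (G (x + s • v)) v ∂unitMeasure‖ₑ ^ p := by
        refine lintegral_congr_ae ?_
        filter_upwards [h.translate_sub_ae v] with x hx
        rw [hx]
    _ ≤ ∫⁻ s, (∫⁻ x, ‖(inner ℝ (G (x + s • v)) v : ℝ)‖ₑ ^ p) ∂unitMeasure :=
        lintegral_enorm_integral_rpow_le hp (h.aestronglyMeasurable_inner_shear v v)
    _ = ∫⁻ s, (∫⁻ x, ‖(inner ℝ (G x) v : ℝ)‖ₑ ^ p) ∂unitMeasure := by
        congr 1 with s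
        exact lintegral_add_right_eq_self (μ := volume)
          (fun x => ‖(inner ℝ (G x) v : ℝ)‖ₑ ^ p) (s • v)
    _ = _ := by simp

theorem IsWeakGradient.ae_integrable_inner_translate {p : ℝ} (hp : 1 ≤ p)
    {u : EuclideanSpace ℝ (Fin N) → ℝ}
    {G : EuclideanSpace ℝ (Fin N) → EuclideanSpace ℝ (Fin N)} (h : IsWeakGradient u G)
    (hG : MemLp G (ENNReal.ofReal p) volume) (v w : EuclideanSpace ℝ (Fin N)) :
    ∀ᵐ x, Integrable (fun s : ℝ => (inner ℝ (G (x + s • v)) w : ℝ)) unitMeasure := by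
  have hp0 : 0 < p := by linarith
  have hm := h.aestronglyMeasurable_inner_shear v w
  have h1 : ∫⁻ x, ∫⁻ s, ‖(inner ℝ (G (x + s • v)) w : ℝ)‖ₑ ^ p ∂unitMeasure < ⊤ := by
    rw [← lintegral_lintegral_swap
      (f := fun s x => ‖(inner ℝ (G (x + s • v)) w : ℝ)‖ₑ ^ p) (hm.enorm.pow_const p)]
    have h2 : ∀ s : ℝ, ∫⁻ x, ‖(inner ℝ (G (x + s • v)) w : ℝ)‖ₑ ^ p =
        ∫⁻ x, ‖(inner ℝ (G x) w : ℝ)‖ₑ ^ p := fun s =>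
      lintegral_add_right_eq_self (μ := volume) (fun x => ‖(inner ℝ (G x) w : ℝ)‖ₑ ^ p) (s • v)
    simp only [h2, lintegral_const, measure_univ, mul_one]
    exact (memLp_ofReal_iff hp0 (hG.inner_const w).1).1 (hG.inner_const w)
  have h3 := ae_lt_top' (hm.enorm.pow_const p).lintegral_prod_left' h1.ne
  filter_upwards [h3, hm.prod_swap.prodMk_left] with x hx hxm
  have hxm' : AEStronglyMeasurable (fun s : ℝ => (inner ℝ (G (x + s • v)) w : ℝ)) unitMeasure := hxm
  exact ((memLp_ofReal_iff hp0 hxm').2 hx).integrable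
    (by simpa using ENNReal.ofReal_le_ofReal hp)

/-- Difference quotients of a Sobolev function converge to the directional derivative. -/
theorem IsWeakGradient.tendsto_differenceQuotient {p : ℝ} (hp : 1 ≤ p)
    {u : EuclideanSpace ℝ (Fin N) → ℝ}
    {G : EuclideanSpace ℝ (Fin N) → EuclideanSpace ℝ (Fin N)} (h : IsWeakGradient u G)
    (hG : MemLp G (ENNReal.ofReal p) volume) (e : EuclideanSpace ℝ (Fin N)) :
    Tendsto (fun t : ℝ => ∫⁻ x, ‖(u (x + t • e) - u x) / t - inner ℝ (G x) e‖ₑ ^ p)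
      (𝓝[>] 0) (𝓝 0) := by
  have hg : MemLp (fun x => (inner ℝ (G x) e : ℝ)) (ENNReal.ofReal p) volume := hG.inner_const e
  have hc := tendsto_lintegral_translate_sub hp hg
  rw [ENNReal.tendsto_nhds_zero] at hc ⊢
  intro ε hε
  obtain ⟨δ, hδ, hδε⟩ := Metric.eventually_nhds_iff.1 (hc ε hε)
  have hδ' : 0 < δ / (‖e‖ + 1) := by positivity
  filter_upwards [Ioo_mem_nhdsGT hδ'] with t ht
  have ht0 : 0 < t := ht.1
  -- The error is the mean over `s` of `⟨G(x + s t e) - G(x), e⟩`. Jensen bounds it by translation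
  -- errors with shifts of norm at most `t ‖e‖ < δ`.
  calc ∫⁻ x, ‖(u (x + t • e) - u x) / t - inner ℝ (G x) e‖ₑ ^ p
      = ∫⁻ x, ‖∫ s, (inner ℝ (G (x + s • t • e)) e - inner ℝ (G x) e) ∂unitMeasure‖ₑ ^ p := by
        refine lintegral_congr_ae ?_
        filter_upwards [h.translate_sub_ae (t • e),
          h.ae_integrable_inner_translate hp hG (t • e) e] with x hx hxi
        rw [hx, integral_sub hxi (integrable_const _), integral_const]
        simp only [inner_smul_right, integral_const_mul]
        rw [mul_div_cancel_left₀ _ ht0.ne']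
        simp
    _ ≤ ∫⁻ s, (∫⁻ x, ‖(inner ℝ (G (x + s • t • e)) e - inner ℝ (G x) e : ℝ)‖ₑ ^ p)
          ∂unitMeasure := by
        refine lintegral_enorm_integral_rpow_le hp
          ((h.aestronglyMeasurable_inner_shear (t • e) e).sub hg.1.comp_snd)
    _ ≤ ∫⁻ s, ε ∂unitMeasure := by
        refine lintegral_mono_ae ?_
        filter_upwards [ae_restrict_mem measurableSet_Ioc] with s hs
        refine hδε ?_
        rw [dist_zero_right, norm_smul, norm_smul, Real.norm_of_nonneg hs.1.le,
          Real.norm_of_nonneg ht0.le]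
        have h1 : t * (‖e‖ + 1) < δ := (lt_div_iff₀ (by positivity)).1 ht.2
        have h2 : t * ‖e‖ ≤ t * (‖e‖ + 1) := by gcongr; linarith
        have h3 : s * (t * ‖e‖) ≤ 1 * (t * ‖e‖) := by gcongr; exact hs.2
        linarith
    _ = ε := by simp

end WeakGradient

/-! ### Stability of Sobolev functions under directionally differentiable Lipschitz maps. -/

section ChainRule

variable {N : ℕ}

/-- `F` is Lipschitz on the plane, has one-sided directional derivatives, and vanishes at `0`. -/
structure IsDirLipschitz (L : ℝ) (F : ℝ → ℝ → ℝ) : Prop where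
  lipschitz : ∀ a b c d : ℝ, |F a c - F b d| ≤ L * (|a - b| + |c - d|)
  zero : F 0 0 = 0
  exists_tendsto : ∀ a c α β : ℝ, ∃ l,
    Tendsto (fun t : ℝ => (F (a + t * α) (c + t * β) - F a c) / t) (𝓝[>] 0) (𝓝 l)

theorem IsDirLipschitz.nonneg {L : ℝ} {F : ℝ → ℝ → ℝ} (hF : IsDirLipschitz L F) : 0 ≤ L := by
  have := (abs_nonneg _).trans (hF.lipschitz 1 0 0 0)
  simpa using this

theorem IsDirLipschitz.continuous {L : ℝ} {F : ℝ → ℝ → ℝ} (hF : IsDirLipschitz L F) :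
    Continuous fun z : ℝ × ℝ => F z.1 z.2 := by
  refine (LipschitzWith.of_dist_le_mul (K := (2 * L).toNNReal) fun z w => ?_).continuous
  have hL := hF.nonneg
  rw [Real.coe_toNNReal _ (by linarith), Real.dist_eq, Prod.dist_eq, Real.dist_eq, Real.dist_eq]
  refine (hF.lipschitz _ _ _ _).trans ?_
  nlinarith [le_max_left |z.1 - w.1| |z.2 - w.2|, le_max_right |z.1 - w.1| |z.2 - w.2|]

theorem IsDirLipschitz.abs_le {L : ℝ} {F : ℝ → ℝ → ℝ} (hF : IsDirLipschitz L F) (a c : ℝ) :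
    |F a c| ≤ L * (|a| + |c|) := by
  simpa [hF.zero] using hF.lipschitz a 0 c 0

theorem IsDirLipschitz.comp_aestronglyMeasurable {α : Type*} [MeasurableSpace α] {μ : Measure α}
    {L : ℝ} {F : ℝ → ℝ → ℝ} (hF : IsDirLipschitz L F) {u v : α → ℝ}
    (hu : AEStronglyMeasurable u μ) (hv : AEStronglyMeasurable v μ) :
    AEStronglyMeasurable (fun x => F (u x) (v x)) μ :=
  hF.continuous.comp_aestronglyMeasurable (hu.prodMk hv)

theorem IsDirLipschitz.comp_memLp {α : Type*} [MeasurableSpace α] {μ : Measure α} {q : ℝ≥0∞}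
    {L : ℝ} {F : ℝ → ℝ → ℝ} (hF : IsDirLipschitz L F) {u v : α → ℝ}
    (hu : MemLp u q μ) (hv : MemLp v q μ) : MemLp (fun x => F (u x) (v x)) q μ := by
  refine ((hu.abs.add hv.abs).const_mul L).mono' (hF.comp_aestronglyMeasurable hu.1 hv.1) ?_
  exact ae_of_all _ fun x => hF.abs_le _ _

/-- The one-sided directional derivative of `F` at `(a, c)` in the direction `(α, β)`. -/
noncomputable def IsDirLipschitz.dirDeriv {L : ℝ} {F : ℝ → ℝ → ℝ} (hF : IsDirLipschitz L F)
    (a c α β : ℝ) : ℝ := (hF.exists_tendsto a c α β).choose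

theorem IsDirLipschitz.tendsto_dirDeriv {L : ℝ} {F : ℝ → ℝ → ℝ} (hF : IsDirLipschitz L F)
    (a c α β : ℝ) : Tendsto (fun t : ℝ => (F (a + t * α) (c + t * β) - F a c) / t) (𝓝[>] 0)
      (𝓝 (hF.dirDeriv a c α β)) :=
  (hF.exists_tendsto a c α β).choose_spec

theorem IsDirLipschitz.abs_quotient_le {L : ℝ} {F : ℝ → ℝ → ℝ} (hF : IsDirLipschitz L F)
    (a c α β : ℝ) {t : ℝ} (ht : 0 < t) :
    |(F (a + t * α) (c + t * β) - F a c) / t| ≤ L * (|α| + |β|) := by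
  rw [abs_div, abs_of_pos ht, div_le_iff₀ ht]
  refine (hF.lipschitz _ _ _ _).trans (le_of_eq ?_)
  rw [add_sub_cancel_left, add_sub_cancel_left, abs_mul, abs_mul, abs_of_pos ht]
  ring

theorem IsDirLipschitz.abs_dirDeriv_le {L : ℝ} {F : ℝ → ℝ → ℝ} (hF : IsDirLipschitz L F)
    (a c α β : ℝ) : |hF.dirDeriv a c α β| ≤ L * (|α| + |β|) := by
  refine le_of_tendsto (hF.tendsto_dirDeriv a c α β).abs ?_
  filter_upwards [self_mem_nhdsWithin] with t ht
  exact hF.abs_quotient_le a c α β ht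

/-- The steps `1 / (n + 1)`. -/
noncomputable def unitStep (n : ℕ) : ℝ := 1 / ((n : ℝ) + 1)

theorem unitStep_pos (n : ℕ) : 0 < unitStep n := by unfold unitStep; positivity

theorem tendsto_unitStep : Tendsto unitStep atTop (𝓝[>] 0) :=
  tendsto_nhdsWithin_iff.2 ⟨tendsto_one_div_add_atTop_nhds_zero_nat,
    Eventually.of_forall unitStep_pos⟩

/-- Dominated convergence: the quotients of `φ` are bounded by its Lipschitz constant times `‖e‖`,
and for steps at most 1 they all vanish outside one ball. -/
theorem tendsto_integral_mul_differenceQuotient {W φ : EuclideanSpace ℝ (Fin N) → ℝ}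
    (hW : LocallyIntegrable W volume) (hφ : ContDiff ℝ ∞ φ) (hφs : HasCompactSupport φ)
    (e : EuclideanSpace ℝ (Fin N)) :
    Tendsto (fun n : ℕ => ∫ x, W x * ((φ (x - unitStep n • e) - φ x) / unitStep n)) atTop
      (𝓝 (∫ x, W x * (-fderiv ℝ φ x e))) := by
  obtain ⟨C, hC⟩ := hφ.lipschitzWith_of_hasCompactSupport hφs (by simp)
  obtain ⟨R, hR⟩ := hφs.isCompact.isBounded.subset_closedBall (0 : EuclideanSpace ℝ (Fin N))
  have hφc := hφ.continuous
  have h1 : Integrable ((Metric.closedBall (0 : EuclideanSpace ℝ (Fin N)) (R + ‖e‖)).indicator W)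
      volume := (hW.integrableOn_isCompact (isCompact_closedBall _ _)).integrable_indicator
      measurableSet_closedBall
  refine tendsto_integral_of_dominated_convergence
    (fun x => ‖(Metric.closedBall (0 : EuclideanSpace ℝ (Fin N)) (R + ‖e‖)).indicator W x‖ *
      (C * ‖e‖)) (fun n => hW.aestronglyMeasurable.mul (by fun_prop)) (h1.norm.mul_const _) ?_ ?_
  · intro n
    refine ae_of_all _ fun x => ?_
    have hn := unitStep_pos n
    have hn1 : unitStep n ≤ 1 := by
      unfold unitStep
      rw [div_le_one (by positivity)]
      linarith [n.cast_nonneg (α := ℝ)]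
    by_cases hx : x ∈ Metric.closedBall (0 : EuclideanSpace ℝ (Fin N)) (R + ‖e‖)
    · rw [indicator_of_mem hx, norm_mul]
      gcongr
      rw [norm_div, Real.norm_of_nonneg hn.le, div_le_iff₀ hn]
      have := hC.dist_le_mul (x - unitStep n • e) x
      rw [dist_eq_norm, dist_eq_norm, sub_sub_cancel_left, norm_neg, norm_smul,
        Real.norm_of_nonneg hn.le] at this
      linarith
    · rw [mem_closedBall_zero_iff, not_le] at hx
      have z1 : φ x = 0 := by
        by_contra hne
        have := mem_closedBall_zero_iff.1 (hR (subset_tsupport φ hne))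
        linarith [norm_nonneg e]
      have z2 : φ (x - unitStep n • e) = 0 := by
        by_contra hne
        have h4 := mem_closedBall_zero_iff.1 (hR (subset_tsupport φ hne))
        have h5 : ‖x‖ - ‖unitStep n • e‖ ≤ ‖x - unitStep n • e‖ := norm_sub_norm_le _ _
        rw [norm_smul, Real.norm_of_nonneg hn.le] at h5
        have := mul_le_mul_of_nonneg_right hn1 (norm_nonneg e)
        linarith
      rw [z1, z2]
      simp only [sub_self, zero_div, mul_zero, norm_zero]
      positivity
  · refine ae_of_all _ fun x => Tendsto.const_mul _ ?_
    have hd : HasDerivAt (fun s : ℝ => φ (x - s • e)) (-(fderiv ℝ φ x e)) 0 := by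
      have h1 : HasDerivAt (fun s : ℝ => x - s • e) (-e) 0 := by
        simpa using ((hasDerivAt_id (0 : ℝ)).smul_const e).const_sub x
      have h2 : HasFDerivAt φ (fderiv ℝ φ x) (x - (0 : ℝ) • e) := by
        rw [zero_smul, sub_zero]
        exact ((hφ.differentiable (by simp)) x).hasFDerivAt
      simpa [Function.comp_def] using h2.comp_hasDerivAt (0 : ℝ) h1
    have h3 := (hasDerivAt_iff_tendsto_slope_zero.1 hd).comp
      (tendsto_unitStep.mono_right (nhdsWithin_mono _ fun t (ht : 0 < t) => ht.ne'))
    refine h3.congr fun n => ?_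
    simp [div_eq_inv_mul]

/-- The distributional derivative is the limit in `L^p` of the difference quotients. -/
theorem integral_mul_fderiv_eq_of_tendsto {p : ℝ} (hp : 1 < p)
    {W D φ : EuclideanSpace ℝ (Fin N) → ℝ} {e : EuclideanSpace ℝ (Fin N)}
    (hW : MemLp W (ENNReal.ofReal p) volume) (hD : MemLp D (ENNReal.ofReal p) volume)
    (h : Tendsto (fun n : ℕ => ∫⁻ x, ‖(W (x + unitStep n • e) - W x) / unitStep n - D x‖ₑ ^ p)
      atTop (𝓝 0)) (hφ : ContDiff ℝ ∞ φ) (hφs : HasCompactSupport φ) :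
    ∫ x, W x * fderiv ℝ φ x e = -∫ x, φ x * D x := by
  have hp1 : (1 : ℝ≥0∞) ≤ ENNReal.ofReal p := by simpa using ENNReal.ofReal_le_ofReal hp.le
  have hWl := hW.locallyIntegrable hp1
  have hDl := hD.locallyIntegrable hp1
  have hφc := hφ.continuous
  have hpq := Real.HolderConjugate.conjExponent hp
  set q := p.conjExponent
  have i0 : Integrable (fun x => φ x * D x) volume :=
    hDl.integrable_smul_left_of_hasCompactSupport hφc hφs
  have i1 : ∀ v, Integrable (fun x => φ x * W (x + v)) volume := fun v =>
    (locallyIntegrable_comp_add_right hWl v).integrable_smul_left_of_hasCompactSupport hφc hφs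
  have i2 : Integrable (fun x => φ x * W x) volume := by simpa using i1 0
  have i3 : ∀ v, Integrable (fun x => φ (x - v) * W x) volume := fun v => by
    simpa using (i1 v).comp_sub_right v
  have e1 : ∀ v, ∫ x, φ x * W (x + v) = ∫ x, φ (x - v) * W x := fun v => by
    simpa using integral_add_right_eq_self (μ := volume) (fun x => φ (x - v) * W x) v
  have i4 : ∀ n : ℕ, Integrable (fun x => φ x * ((W (x + unitStep n • e) - W x) / unitStep n))
      volume := fun n => by
    refine (((i1 (unitStep n • e)).sub i2).div_const (unitStep n)).congr (ae_of_all _ fun x => ?_)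
    simp only [Pi.sub_apply]
    ring
  have e2 : ∀ n : ℕ, ∫ x, φ x * ((W (x + unitStep n • e) - W x) / unitStep n) =
      ∫ x, W x * ((φ (x - unitStep n • e) - φ x) / unitStep n) := by
    intro n
    have a1 : ∀ x, φ x * ((W (x + unitStep n • e) - W x) / unitStep n) =
      (φ x * W (x + unitStep n • e) - φ x * W x) / unitStep n := fun x => by ring
    have a2 : ∀ x, W x * ((φ (x - unitStep n • e) - φ x) / unitStep n) =
      (φ (x - unitStep n • e) * W x - φ x * W x) / unitStep n := fun x => by ring
    simp_rw [a1, a2, integral_div]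
    rw [integral_sub (i1 _) i2, integral_sub (i3 _) i2, e1]
  have l1 := tendsto_integral_mul_differenceQuotient hWl hφ hφs e
  simp_rw [← e2] at l1
  have l2 : Tendsto (fun n : ℕ => ∫ x, φ x * ((W (x + unitStep n • e) - W x) / unitStep n)) atTop
      (𝓝 (∫ x, φ x * D x)) := by
    refine tendsto_integral_of_L1 _ i0.1 (Eventually.of_forall i4) ?_
    have hφq : (∫⁻ x, ‖φ x‖ₑ ^ q) ^ (1 / q) ≠ ⊤ := by
      rw [← eLpNorm_ofReal_eq hpq.symm.pos]
      exact (hφc.memLp_of_hasCompactSupport hφs).2.ne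
    have l3 : Tendsto (fun n : ℕ => (∫⁻ x, ‖φ x‖ₑ ^ q) ^ (1 / q) *
        (∫⁻ x, ‖(W (x + unitStep n • e) - W x) / unitStep n - D x‖ₑ ^ p) ^ (1 / p)) atTop
        (𝓝 0) := by
      have h1 := (ENNReal.continuous_rpow_const (y := 1 / p)).tendsto 0 |>.comp h
      rw [ENNReal.zero_rpow_of_pos (by positivity)] at h1
      simpa using ENNReal.Tendsto.const_mul h1 (Or.inr hφq)
    refine tendsto_of_tendsto_of_tendsto_of_le_of_le tendsto_const_nhds l3
      (fun _ => zero_le) fun n => ?_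
    have hm : AEStronglyMeasurable
        (fun x => (W (x + unitStep n • e) - W x) / unitStep n - D x) volume :=
      (((locallyIntegrable_comp_add_right hWl _).aestronglyMeasurable.sub hW.1).mul_const
        (unitStep n)⁻¹).sub hD.1
    calc ∫⁻ x, ‖φ x * ((W (x + unitStep n • e) - W x) / unitStep n) - φ x * D x‖ₑ
        = ∫⁻ x, ‖φ x‖ₑ * ‖(W (x + unitStep n • e) - W x) / unitStep n - D x‖ₑ := by
          simp_rw [← mul_sub, enorm_mul]
      _ ≤ _ := ENNReal.lintegral_mul_le_Lp_mul_Lq _ hpq.symm hφc.enorm.measurable.aemeasurable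
          hm.enorm
  have := tendsto_nhds_unique l1 l2
  rw [← this, ← integral_neg]
  simp

/-- The increment of `u` over a step `t e` is `t α` up to an error `o(t)` in `L^p`, and likewise for
`v`. By the Lipschitz bound `F` may be evaluated at the linearised arguments, where the quotients
converge pointwise under an `L^p` majorant. Differentiability of `F` almost everywhere plays no
role. -/
theorem IsDirLipschitz.exists_directional {p L : ℝ} (hp : 1 < p) {F : ℝ → ℝ → ℝ}
    (hF : IsDirLipschitz L F) {u v : EuclideanSpace ℝ (Fin N) → ℝ}
    {G H : EuclideanSpace ℝ (Fin N) → EuclideanSpace ℝ (Fin N)}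
    (hG : IsWeakGradient u G) (hH : IsWeakGradient v H)
    (hu : MemLp u (ENNReal.ofReal p) volume) (hv : MemLp v (ENNReal.ofReal p) volume)
    (hGp : MemLp G (ENNReal.ofReal p) volume) (hHp : MemLp H (ENNReal.ofReal p) volume)
    (e : EuclideanSpace ℝ (Fin N)) :
    ∃ D : EuclideanSpace ℝ (Fin N) → ℝ, MemLp D (ENNReal.ofReal p) volume ∧
      ∀ φ : EuclideanSpace ℝ (Fin N) → ℝ, ContDiff ℝ ∞ φ → HasCompactSupport φ →
        ∫ x, F (u x) (v x) * fderiv ℝ φ x e = -∫ x, φ x * D x := by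
  have hp0 : 0 < p := by linarith
  have hp1 : (1 : ℝ≥0∞) ≤ ENNReal.ofReal p := by simpa using ENNReal.ofReal_le_ofReal hp.le
  set α : EuclideanSpace ℝ (Fin N) → ℝ := fun x => inner ℝ (G x) e
  set β : EuclideanSpace ℝ (Fin N) → ℝ := fun x => inner ℝ (H x) e
  have hα : MemLp α (ENNReal.ofReal p) volume := hGp.inner_const e
  have hβ : MemLp β (ENNReal.ofReal p) volume := hHp.inner_const e
  set D : EuclideanSpace ℝ (Fin N) → ℝ := fun x => hF.dirDeriv (u x) (v x) (α x) (β x)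
  set Q : ℕ → EuclideanSpace ℝ (Fin N) → ℝ := fun n x =>
    (F (u x + unitStep n * α x) (v x + unitStep n * β x) - F (u x) (v x)) / unitStep n
  have hQm : ∀ n, AEStronglyMeasurable (Q n) volume := fun n =>
    ((hF.comp_aestronglyMeasurable (hu.1.add (hα.1.const_mul _))
      (hv.1.add (hβ.1.const_mul _))).sub (hF.comp_aestronglyMeasurable hu.1 hv.1)).mul_const
        (unitStep n)⁻¹
  have hQD : ∀ x, Tendsto (fun n => Q n x) atTop (𝓝 (D x)) := fun x =>
    (hF.tendsto_dirDeriv (u x) (v x) (α x) (β x)).comp tendsto_unitStep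
  have hDm : AEStronglyMeasurable D volume :=
    aestronglyMeasurable_of_tendsto_ae _ hQm (ae_of_all _ hQD)
  have hb : MemLp (fun x => L * (|α x| + |β x|)) (ENNReal.ofReal p) volume :=
    (hα.abs.add hβ.abs).const_mul L
  have hD : MemLp D (ENNReal.ofReal p) volume :=
    hb.mono' hDm (ae_of_all _ fun x => hF.abs_dirDeriv_le _ _ _ _)
  refine ⟨D, hD, fun φ hφ hφs => integral_mul_fderiv_eq_of_tendsto hp (hF.comp_memLp hu hv) hD ?_
    hφ hφs⟩
  rw [← tendsto_eLpNorm_ofReal_zero hp0]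
  have hl := hu.locallyIntegrable hp1
  have hl' := hv.locallyIntegrable hp1
  set A : ℕ → EuclideanSpace ℝ (Fin N) → ℝ := fun n x =>
    (u (x + unitStep n • e) - u x) / unitStep n - α x
  set B : ℕ → EuclideanSpace ℝ (Fin N) → ℝ := fun n x =>
    (v (x + unitStep n • e) - v x) / unitStep n - β x
  have hA : ∀ n, AEStronglyMeasurable (A n) volume := fun n =>
    (((locallyIntegrable_comp_add_right hl _).aestronglyMeasurable.sub hu.1).mul_const
        (unitStep n)⁻¹).sub hα.1
  have hB : ∀ n, AEStronglyMeasurable (B n) volume := fun n =>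
    (((locallyIntegrable_comp_add_right hl' _).aestronglyMeasurable.sub hv.1).mul_const
        (unitStep n)⁻¹).sub hβ.1
  have lA : Tendsto (fun n => eLpNorm (A n) (ENNReal.ofReal p) volume) atTop (𝓝 0) :=
    (tendsto_eLpNorm_ofReal_zero hp0).2
      ((hG.tendsto_differenceQuotient hp.le hGp e).comp tendsto_unitStep)
  have lB : Tendsto (fun n => eLpNorm (B n) (ENNReal.ofReal p) volume) atTop (𝓝 0) :=
    (tendsto_eLpNorm_ofReal_zero hp0).2
      ((hH.tendsto_differenceQuotient hp.le hHp e).comp tendsto_unitStep)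
  have lQ : Tendsto (fun n => eLpNorm (fun x => Q n x - D x) (ENNReal.ofReal p) volume) atTop
      (𝓝 0) := by
    rw [tendsto_eLpNorm_ofReal_zero hp0]
    have hb2 := hb.add hb
    have := tendsto_lintegral_of_dominated_convergence' (μ := volume)
      (F := fun n x => ‖Q n x - D x‖ₑ ^ p) (f := fun _ => 0)
      (fun x => ‖L * (|α x| + |β x|) + L * (|α x| + |β x|)‖ₑ ^ p)
      (fun n => ((hQm n).sub hDm).enorm.pow_const p) (fun n => ae_of_all _ fun x => ?_)
      ((memLp_ofReal_iff hp0 hb2.1).1 hb2).ne (ae_of_all _ fun x => ?_)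
    · simpa using this
    · have h1 := hF.abs_quotient_le (u x) (v x) (α x) (β x) (unitStep_pos n)
      have h2 := hF.abs_dirDeriv_le (u x) (v x) (α x) (β x)
      have h3 : ‖Q n x - D x‖ ≤ ‖L * (|α x| + |β x|) + L * (|α x| + |β x|)‖ := by
        rw [Real.norm_eq_abs, Real.norm_eq_abs]
        exact ((abs_sub _ _).trans (add_le_add h1 h2)).trans (le_abs_self _)
      have h4 := enorm_le_iff_norm_le.2 h3
      exact ENNReal.rpow_le_rpow h4 hp0.le
    · have h1 : Tendsto (fun n => Q n x - D x) atTop (𝓝 0) := by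
        simpa using (hQD x).sub_const (D x)
      have h2 := (ENNReal.continuous_rpow_const (y := p)).tendsto 0 |>.comp
        (by simpa using h1.enorm : Tendsto (fun n => ‖Q n x - D x‖ₑ) atTop (𝓝 0))
      simpa [ENNReal.zero_rpow_of_pos hp0, Function.comp_def] using h2
  have lsum : Tendsto (fun n => ENNReal.ofReal L *
      (eLpNorm (A n) (ENNReal.ofReal p) volume + eLpNorm (B n) (ENNReal.ofReal p) volume) +
      eLpNorm (fun x => Q n x - D x) (ENNReal.ofReal p) volume) atTop (𝓝 0) := by
    simpa using (ENNReal.Tendsto.const_mul (lA.add lB) (Or.inr ENNReal.ofReal_ne_top)).add lQ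
  refine tendsto_of_tendsto_of_tendsto_of_le_of_le tendsto_const_nhds lsum
    (fun _ => zero_le) fun n => ?_
  have hn := unitStep_pos n
  have hL := hF.nonneg
  have hAB : AEStronglyMeasurable (fun x => L * (‖A n x‖ + ‖B n x‖)) volume :=
    ((hA n).norm.add (hB n).norm).const_mul L
  calc eLpNorm (fun x => (F (u (x + unitStep n • e)) (v (x + unitStep n • e)) -
        F (u x) (v x)) / unitStep n - D x) (ENNReal.ofReal p) volume
      ≤ eLpNorm (fun x => L * (‖A n x‖ + ‖B n x‖) + ‖Q n x - D x‖) (ENNReal.ofReal p) volume := by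
        refine eLpNorm_mono_real fun x => ?_
        have h1 : |(F (u (x + unitStep n • e)) (v (x + unitStep n • e)) - F (u x) (v x)) /
            unitStep n - Q n x| ≤ L * (‖A n x‖ + ‖B n x‖) := by
          rw [← sub_div, sub_sub_sub_cancel_right, abs_div, abs_of_pos hn, div_le_iff₀ hn]
          refine (hF.lipschitz _ _ _ _).trans (le_of_eq ?_)
          have a1 : ∀ (a b c : ℝ), |a - (b + unitStep n * c)| =
              |(a - b) / unitStep n - c| * unitStep n := by
            intro a b c
            rw [← abs_of_pos hn, ← abs_mul, abs_of_pos hn]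
            congr 1
            field_simp
            ring
          rw [a1, a1, Real.norm_eq_abs, Real.norm_eq_abs]
          ring
        calc _ ≤ |(F (u (x + unitStep n • e)) (v (x + unitStep n • e)) - F (u x) (v x)) /
              unitStep n - Q n x| + |Q n x - D x| := abs_sub_le _ _ _
          _ ≤ _ := by rw [Real.norm_eq_abs (Q n x - D x)]; gcongr
    _ ≤ eLpNorm (fun x => L * (‖A n x‖ + ‖B n x‖)) (ENNReal.ofReal p) volume +
        eLpNorm (fun x => ‖Q n x - D x‖) (ENNReal.ofReal p) volume :=
        eLpNorm_add_le hAB ((hQm n).sub hDm).norm hp1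
    _ ≤ _ := by
        rw [eLpNorm_norm (fun x => Q n x - D x)]
        gcongr
        have : eLpNorm (fun x => L * (‖A n x‖ + ‖B n x‖)) (ENNReal.ofReal p) volume =
            ENNReal.ofReal L *
              eLpNorm (fun x => ‖A n x‖ + ‖B n x‖) (ENNReal.ofReal p) volume := by
          have := eLpNorm_const_smul (μ := volume) L (fun x => ‖A n x‖ + ‖B n x‖)
            (ENNReal.ofReal p)
          rw [Real.enorm_eq_ofReal hL] at this
          exact this
        rw [this]
        gcongr
        refine (eLpNorm_add_le (hA n).norm (hB n).norm hp1).trans (le_of_eq ?_)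
        rw [eLpNorm_norm, eLpNorm_norm]

/-- Sobolev functions are stable under composition with Lipschitz functions having one-sided
directional derivatives. -/
theorem IsDirLipschitz.exists_weakGradient {p L : ℝ} (hp : 1 < p) {F : ℝ → ℝ → ℝ}
    (hF : IsDirLipschitz L F) {u v : EuclideanSpace ℝ (Fin N) → ℝ}
    {G H : EuclideanSpace ℝ (Fin N) → EuclideanSpace ℝ (Fin N)}
    (hG : IsWeakGradient u G) (hH : IsWeakGradient v H)
    (hu : MemLp u (ENNReal.ofReal p) volume) (hv : MemLp v (ENNReal.ofReal p) volume)
    (hGp : MemLp G (ENNReal.ofReal p) volume) (hHp : MemLp H (ENNReal.ofReal p) volume) :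
    ∃ K, IsWeakGradient (fun x => F (u x) (v x)) K ∧ MemLp K (ENNReal.ofReal p) volume := by
  have hp1 : (1 : ℝ≥0∞) ≤ ENNReal.ofReal p := by simpa using ENNReal.ofReal_le_ofReal hp.le
  -- The derivative found for a direction need not be visibly linear in it. Only basis directions
  -- are used; linearity in `e` comes from the derivative of the test function.
  choose D hDp hD using fun i => hF.exists_directional hp hG hH hu hv hGp hHp
    (EuclideanSpace.basisFun (Fin N) ℝ i)
  have hW := (hF.comp_memLp hu hv).locallyIntegrable hp1
  have hKp : MemLp (fun x => ∑ i, D i x • EuclideanSpace.basisFun (Fin N) ℝ i)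
      (ENNReal.ofReal p) volume := by
    refine memLp_finsetSum _ fun i _ => ?_
    refine (hDp i).of_le_mul (c := ‖EuclideanSpace.basisFun (Fin N) ℝ i‖)
      ((hDp i).1.smul_const _) (ae_of_all _ fun x => ?_)
    rw [norm_smul, mul_comm]
  refine ⟨_, ⟨hW, hKp.locallyIntegrable hp1, fun φ hφ hφs e => ?_⟩, hKp⟩
  have he : e = ∑ i, e i • EuclideanSpace.basisFun (Fin N) ℝ i := by
    simpa using ((EuclideanSpace.basisFun (Fin N) ℝ).sum_repr e).symm
  have h1 : ∀ x, fderiv ℝ φ x e =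
      ∑ i, e i * fderiv ℝ φ x (EuclideanSpace.basisFun (Fin N) ℝ i) := fun x => by
    conv_lhs => rw [he]
    simp only [map_sum, map_smul, smul_eq_mul]
  have h2 : ∀ x, (inner ℝ (∑ i, D i x • EuclideanSpace.basisFun (Fin N) ℝ i) e : ℝ) =
      ∑ i, D i x * e i := fun x => by
    simp [sum_inner, inner_smul_left, EuclideanSpace.inner_single_left]
  simp_rw [h1, h2, Finset.mul_sum]
  rw [integral_finsetSum, integral_finsetSum, ← Finset.sum_neg_distrib]
  · refine Finset.sum_congr rfl fun i _ => ?_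
    simp_rw [mul_left_comm _ (e i), mul_comm (D i _) (e i), mul_left_comm _ (e i)]
    rw [integral_const_mul, integral_const_mul, hD i φ hφ hφs, mul_neg]
  · intro i _
    simp_rw [← mul_assoc]
    exact ((((hDp i).locallyIntegrable hp1).integrable_smul_left_of_hasCompactSupport
      hφ.continuous hφs).mul_const _)
  · intro i _
    have hc : Continuous fun x => fderiv ℝ φ x (EuclideanSpace.basisFun (Fin N) ℝ i) := by
      have := hφ.continuous_fderiv (by simp)
      fun_prop
    have := (hW.integrable_smul_left_of_hasCompactSupport hc
      (hφs.fderiv_apply ℝ _)).const_mul (e i)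
    refine this.congr (ae_of_all _ fun x => ?_)
    simp only [smul_eq_mul]
    ring

end ChainRule

/-! ### From discrete inequalities to the local form. -/

section LocalForm

variable {N : ℕ} {Ω : Set (EuclideanSpace ℝ (Fin N))} {p : ℝ}

theorem MemW0.isWeakGradient_weakGradient {u : EuclideanSpace ℝ (Fin N) → ℝ} (hu : MemW0 Ω p u) :
    IsWeakGradient u (weakGradient u) := by
  obtain ⟨G, hG, -⟩ := hu.exists_grad
  have hex : ∃ G, IsWeakGradient u G := ⟨G, hG⟩
  rw [weakGradient, dif_pos hex]
  exact hex.choose_spec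

theorem MemW0.memLp_weakGradient {u : EuclideanSpace ℝ (Fin N) → ℝ} (hu : MemW0 Ω p u) :
    MemLp (weakGradient u) (ENNReal.ofReal p) volume := by
  obtain ⟨G, hG, hGp⟩ := hu.exists_grad
  exact hGp.ae_eq hG.weakGradient_ae_eq.symm

theorem IsDirLipschitz.memW0 {L : ℝ} (hp : 1 < p) {F : ℝ → ℝ → ℝ} (hF : IsDirLipschitz L F)
    {u v : EuclideanSpace ℝ (Fin N) → ℝ} (hu : MemW0 Ω p u) (hv : MemW0 Ω p v) :
    MemW0 Ω p fun x => F (u x) (v x) where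
  memLp := hF.comp_memLp hu.memLp hv.memLp
  exists_grad := hF.exists_weakGradient hp hu.isWeakGradient_weakGradient
    hv.isWeakGradient_weakGradient hu.memLp hv.memLp hu.memLp_weakGradient hv.memLp_weakGradient
  ae_eq_zero := by
    filter_upwards [hu.ae_eq_zero, hv.ae_eq_zero] with x h1 h2
    rw [h1, h2, hF.zero]

theorem IsDirLipschitz.memWL {L m : ℝ} (hp : 1 < p) {F : ℝ → ℝ → ℝ} (hF : IsDirLipschitz L F)
    {u v : EuclideanSpace ℝ (Fin N) → ℝ} (hu : MemWL Ω p m u) (hv : MemWL Ω p m v) :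
    MemWL Ω p m fun x => F (u x) (v x) :=
  ⟨hF.memW0 hp hu.1 hv.1, hF.comp_memLp hu.2 hv.2⟩

/-- `L^p` convergence gives convergence in measure, hence almost everywhere along a subsequence. -/
theorem MemW0.exists_subseq_tendsto (hp : 1 < p) {u : EuclideanSpace ℝ (Fin N) → ℝ}
    (hu : MemW0 Ω p u) (e : EuclideanSpace ℝ (Fin N)) {τ : ℕ → ℝ}
    (hτ : Tendsto τ atTop (𝓝[>] 0)) :
    ∃ ms : ℕ → ℕ, StrictMono ms ∧ ∀ᵐ x, Tendsto
      (fun i => (u (x + τ (ms i) • e) - u x) / τ (ms i)) atTop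
      (𝓝 (inner ℝ e (weakGradient u x))) := by
  have hp0 : 0 < p := by linarith
  have hp1 : (1 : ℝ≥0∞) ≤ ENNReal.ofReal p := by simpa using ENNReal.ofReal_le_ofReal hp.le
  have hl := hu.memLp.locallyIntegrable hp1
  have hi : MemLp (fun x => (inner ℝ (weakGradient u x) e : ℝ)) (ENNReal.ofReal p) volume :=
    hu.memLp_weakGradient.inner_const e
  have h := (tendsto_eLpNorm_ofReal_zero hp0).2
    ((hu.isWeakGradient_weakGradient.tendsto_differenceQuotient hp.le hu.memLp_weakGradient e).comp
      hτ)
  have h2 := tendstoInMeasure_of_tendsto_eLpNorm (p := ENNReal.ofReal p) (by simpa using hp0)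
    (f := fun n x => (u (x + τ n • e) - u x) / τ n) (fun n => ?_) hi.1 h
  · obtain ⟨ms, hms, hx⟩ := h2.exists_seq_tendsto_ae
    refine ⟨ms, hms, ?_⟩
    simpa only [real_inner_comm] using hx
  · exact ((locallyIntegrable_comp_add_right hl _).aestronglyMeasurable.sub hu.memLp.1).mul_const
        (τ n)⁻¹

/-- A discrete inequality between increments passes to directional derivatives. -/
theorem MemW0.ae_directional_lower_bound (hp : 1 < p)
    {u v Φ Ψ : EuclideanSpace ℝ (Fin N) → ℝ} (hu : MemW0 Ω p u) (hv : MemW0 Ω p v)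
    (hΦ : MemW0 Ω p Φ) (hΨ : MemW0 Ω p Ψ) {M : EuclideanSpace ℝ (Fin N) → ℝ}
    {good : EuclideanSpace ℝ (Fin N) → Prop} (hgood : ∀ᵐ x, good x)
    (h : ∀ x, good x → ∃ δ > 0, ∀ y, good y → |u y - u x| < δ →
      -M x * (|u y - u x| ^ p + |v y - v x| ^ p) ≤
        signedPow (p - 1) (u y - u x) * (Φ y - Φ x) -
          signedPow (p - 1) (v y - v x) * (Ψ y - Ψ x)) (e : EuclideanSpace ℝ (Fin N)) :
    ∀ᵐ x, -M x * (|inner ℝ e (weakGradient u x)| ^ p + |inner ℝ e (weakGradient v x)| ^ p) ≤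
      signedPow (p - 1) (inner ℝ e (weakGradient u x)) * inner ℝ e (weakGradient Φ x) -
        signedPow (p - 1) (inner ℝ e (weakGradient v x)) * inner ℝ e (weakGradient Ψ x) := by
  have hp0 : 0 < p := by linarith
  -- Four successive extractions give one sequence of steps along which all four quotients converge
  -- a.e.
  obtain ⟨n₁, hn₁, h₁⟩ := hu.exists_subseq_tendsto hp e tendsto_unitStep
  have t₁ := tendsto_unitStep.comp hn₁.tendsto_atTop
  obtain ⟨n₂, hn₂, h₂⟩ := hv.exists_subseq_tendsto hp e t₁
  have t₂ := t₁.comp hn₂.tendsto_atTop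
  obtain ⟨n₃, hn₃, h₃⟩ := hΦ.exists_subseq_tendsto hp e t₂
  have t₃ := t₂.comp hn₃.tendsto_atTop
  obtain ⟨n₄, hn₄, h₄⟩ := hΨ.exists_subseq_tendsto hp e t₃
  have t₄ := t₃.comp hn₄.tendsto_atTop
  set τ : ℕ → ℝ := ((unitStep ∘ n₁) ∘ n₂) ∘ n₃ with hτ
  have hall : ∀ᵐ x, ∀ i, good (x + (τ ∘ n₄) i • e) := by
    rw [ae_all_iff]
    intro i
    exact (measurePreserving_add_right volume ((τ ∘ n₄) i • e)).quasiMeasurePreserving.ae hgood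
  filter_upwards [h₁, h₂, h₃, h₄, hall, hgood] with x h₁ h₂ h₃ h₄ hx hgx
  replace h₁ := h₁.comp (hn₂.comp (hn₃.comp hn₄)).tendsto_atTop
  replace h₂ := h₂.comp (hn₃.comp hn₄).tendsto_atTop
  replace h₃ := h₃.comp hn₄.tendsto_atTop
  obtain ⟨δ, hδ, hxδ⟩ := h x hgx
  set σ := τ ∘ n₄ with hσ
  set a := fun i => (u (x + σ i • e) - u x) / σ i
  set b := fun i => (v (x + σ i • e) - v x) / σ i
  set c := fun i => (Φ (x + σ i • e) - Φ x) / σ i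
  set d := fun i => (Ψ (x + σ i • e) - Ψ x) / σ i
  have ha : Tendsto a atTop (𝓝 (inner ℝ e (weakGradient u x))) := h₁
  have hb : Tendsto b atTop (𝓝 (inner ℝ e (weakGradient v x))) := h₂
  have hc : Tendsto c atTop (𝓝 (inner ℝ e (weakGradient Φ x))) := h₃
  have hd : Tendsto d atTop (𝓝 (inner ℝ e (weakGradient Ψ x))) := h₄
  have hsp := continuous_signedPow (by linarith : 0 < p - 1)
  have hσ0 : Tendsto σ atTop (𝓝[>] 0) := t₄
  have hσpos : ∀ᶠ i in atTop, 0 < σ i := hσ0.eventually self_mem_nhdsWithin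
  have hclose : ∀ᶠ i in atTop, |u (x + σ i • e) - u x| < δ := by
    have h1 : Tendsto (fun i => |σ i * a i|) atTop (𝓝 0) := by
      simpa using ((hσ0.mono_right nhdsWithin_le_nhds).mul ha).abs
    filter_upwards [h1.eventually_lt_const hδ, hσpos] with i hi hpos
    rwa [mul_div_cancel₀ _ hpos.ne'] at hi
  refine le_of_tendsto_of_tendsto
    (((ha.abs.rpow_const (p := p) (Or.inr hp0.le)).add
      (hb.abs.rpow_const (p := p) (Or.inr hp0.le))).const_mul (-M x))
    ((((hsp.tendsto _).comp ha).mul hc).sub (((hsp.tendsto _).comp hb).mul hd)) ?_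
  filter_upwards [hclose, hσpos] with i hi hpos
  have key := hxδ _ (hx i) hi
  have e1 : ∀ w : EuclideanSpace ℝ (Fin N) → ℝ,
      w (x + σ i • e) - w x = σ i * ((w (x + σ i • e) - w x) / σ i) := fun w =>
    (mul_div_cancel₀ _ hpos.ne').symm
  rw [e1 u, e1 v, e1 Φ, e1 Ψ, abs_mul, abs_mul, abs_of_pos hpos, Real.mul_rpow hpos.le (abs_nonneg _),
    Real.mul_rpow hpos.le (abs_nonneg _), signedPow_mul_of_nonneg (by linarith) hpos.le,
    signedPow_mul_of_nonneg (by linarith) hpos.le] at key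
  -- Both sides scale like `σ^p`, which is divided out before passing to the limit.
  have hpp : σ i ^ (p - 1) * σ i = σ i ^ p := by
    rw [← Real.rpow_add_one hpos.ne']; ring_nf
  refine le_of_mul_le_mul_left ?_ (Real.rpow_pos_of_pos hpos p)
  calc _ = -M x * (σ i ^ p * |a i| ^ p + σ i ^ p * |b i| ^ p) := by ring
    _ ≤ _ := key
    _ = _ := by simp only [Function.comp_apply]; rw [← hpp]; ring

/-- A discrete inequality between increments passes to the `p`-Laplacian forms. -/
theorem MemW0.ae_form_lower_bound [NeZero N] (hp : 1 < p)
    {u v Φ Ψ : EuclideanSpace ℝ (Fin N) → ℝ} (hu : MemW0 Ω p u) (hv : MemW0 Ω p v)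
    (hΦ : MemW0 Ω p Φ) (hΨ : MemW0 Ω p Ψ) {M : EuclideanSpace ℝ (Fin N) → ℝ}
    {good : EuclideanSpace ℝ (Fin N) → Prop} (hgood : ∀ᵐ x, good x)
    (h : ∀ x, good x → ∃ δ > 0, ∀ y, good y → |u y - u x| < δ →
      -M x * (|u y - u x| ^ p + |v y - v x| ^ p) ≤
        signedPow (p - 1) (u y - u x) * (Φ y - Φ x) -
          signedPow (p - 1) (v y - v x) * (Ψ y - Ψ x)) :
    ∀ᵐ x, -M x * (‖weakGradient u x‖ ^ p + ‖weakGradient v x‖ ^ p) ≤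
      ‖weakGradient u x‖ ^ (p - 2) * inner ℝ (weakGradient u x) (weakGradient Φ x) -
        ‖weakGradient v x‖ ^ (p - 2) * inner ℝ (weakGradient v x) (weakGradient Ψ x) := by
  -- The exceptional null set depends on the direction; a countable dense family of directions and
  -- continuity in `e` give a common one.
  have h1 := ae_all_iff.2 fun n : ℕ => hu.ae_directional_lower_bound hp hv hΦ hΨ hgood h
    (TopologicalSpace.denseSeq (EuclideanSpace ℝ (Fin N)) n)
  filter_upwards [h1] with x hx
  refine plaplace_form_lower_bound hp fun e => ?_
  have hsp := continuous_signedPow (by linarith : 0 < p - 1)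
  have hc1 : Continuous fun e : EuclideanSpace ℝ (Fin N) => -M x *
      (|inner ℝ e (weakGradient u x)| ^ p + |inner ℝ e (weakGradient v x)| ^ p) := by
    have hr := Real.continuous_rpow_const (q := p) (by linarith)
    exact continuous_const.mul ((hr.comp (by fun_prop)).add (hr.comp (by fun_prop)))
  have hc2 : Continuous fun e : EuclideanSpace ℝ (Fin N) =>
      signedPow (p - 1) (inner ℝ e (weakGradient u x)) * inner ℝ e (weakGradient Φ x) -
        signedPow (p - 1) (inner ℝ e (weakGradient v x)) * inner ℝ e (weakGradient Ψ x) :=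
    ((hsp.comp (by fun_prop)).mul (by fun_prop)).sub ((hsp.comp (by fun_prop)).mul (by fun_prop))
  exact (isClosed_le hc1 hc2).closure_subset_iff.2 (range_subset_iff.2 hx)
    (TopologicalSpace.denseRange_denseSeq _ e)

theorem MemW0.integrable_norm_weakGradient_rpow (hp : 1 < p) {u : EuclideanSpace ℝ (Fin N) → ℝ}
    (hu : MemW0 Ω p u) : Integrable (fun x => ‖weakGradient u x‖ ^ p) volume :=
  MemLp.integrable_norm_rpow_ofReal (by linarith) hu.memLp_weakGradient

/-- By Cauchy–Schwarz and Young the integrand is at most the sum of the two energy densities. -/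
theorem MemW0.integrable_localForm (hp : 1 < p) {u φ : EuclideanSpace ℝ (Fin N) → ℝ}
    (hu : MemW0 Ω p u) (hφ : MemW0 Ω p φ) :
    Integrable (fun x => ‖weakGradient u x‖ ^ (p - 2) *
      inner ℝ (weakGradient u x) (weakGradient φ x)) volume := by
  refine ((hu.integrable_norm_weakGradient_rpow hp).add
    (hφ.integrable_norm_weakGradient_rpow hp)).mono' ?_ (ae_of_all _ fun x => ?_)
  · exact (hu.memLp_weakGradient.1.norm.aemeasurable.pow_const _).aestronglyMeasurable.mul
      (hu.memLp_weakGradient.1.inner hφ.memLp_weakGradient.1)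
  · set G := weakGradient u x
    set K := weakGradient φ x
    rw [norm_mul, Real.norm_of_nonneg (by positivity)]
    rcases eq_or_ne G 0 with h0 | h0
    · rw [h0]
      simp only [inner_zero_left, norm_zero, mul_zero, Pi.add_apply]
      positivity
    have hG : 0 < ‖G‖ := norm_pos_iff.2 h0
    have h1 := rpow_mul_rpow_le_add (p := p) (q := p - 1) (by linarith) (by linarith) hG.le
      (norm_nonneg K)
    rw [sub_sub_cancel, Real.rpow_one] at h1
    calc ‖G‖ ^ (p - 2) * ‖(inner ℝ G K : ℝ)‖ ≤ ‖G‖ ^ (p - 2) * (‖G‖ * ‖K‖) := by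
          gcongr; exact norm_inner_le_norm _ _
      _ = ‖G‖ ^ (p - 1) * ‖K‖ := by
          rw [← mul_assoc, ← Real.rpow_add_one hG.ne']; ring_nf
      _ ≤ _ := h1

end LocalForm

/-! ### Finiteness of the nonlocal form. -/

section NonlocalForm

variable {N : ℕ} {Ω : Set (EuclideanSpace ℝ (Fin N))} {p s : ℝ}

/-- In polar coordinates the radial exponents are `p - sp - 1 > -1` near 0 and `-1 - sp < -1` at
infinity. -/
theorem integrable_min_one_norm_rpow_div [NeZero N] (hp : 1 < p) (hs : s ∈ Ioo (0 : ℝ) 1) :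
    Integrable (fun h : EuclideanSpace ℝ (Fin N) => min 1 (‖h‖ ^ p) / ‖h‖ ^ ((N : ℝ) + s * p))
      volume := by
  have hsp : 0 < s * p := mul_pos hs.1 (by linarith)
  have hsp' : s * p < p := by nlinarith [hs.2]
  have hN : 0 < N := Nat.pos_of_ne_zero (NeZero.ne N)
  have hpow : ∀ y : ℝ, 0 < y → y ^ (N - 1) / y ^ ((N : ℝ) + s * p) = y ^ (-1 - s * p) := by
    intro y hy
    rw [← Real.rpow_natCast, ← Real.rpow_sub hy, Nat.cast_sub hN]
    congr 1
    push_cast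
    ring
  rw [integrable_fun_norm_addHaar volume (f := fun y : ℝ => min 1 (y ^ p) / y ^ ((N : ℝ) + s * p)),
    finrank_euclideanSpace_fin, ← Ioc_union_Ioi_eq_Ioi zero_le_one]
  refine IntegrableOn.union ?_ ?_
  · have h1 : IntegrableOn (fun y : ℝ => y ^ (p - s * p - 1)) (Ioc 0 1) volume :=
      (intervalIntegrable_iff_integrableOn_Ioc_of_le zero_le_one).1
        (intervalIntegral.intervalIntegrable_rpow' (by linarith))
    refine h1.congr_fun (fun y hy => ?_) measurableSet_Ioc
    have hy1 : y ^ p ≤ 1 := Real.rpow_le_one hy.1.le hy.2 (by linarith)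
    simp only [smul_eq_mul]
    rw [min_eq_right hy1, mul_div_left_comm, hpow y hy.1, ← Real.rpow_add hy.1]
    congr 1
    ring
  · have h1 : IntegrableOn (fun y : ℝ => y ^ (-1 - s * p)) (Ioi 1) volume :=
      integrableOn_Ioi_rpow_of_lt (by linarith) one_pos
    refine h1.congr_fun (fun y hy => ?_) measurableSet_Ioi
    have hy' : (1 : ℝ) < y := hy
    have hy1 : 1 ≤ y ^ p := Real.one_le_rpow hy'.le (by linarith)
    simp only [smul_eq_mul]
    rw [min_eq_left hy1, mul_one_div, hpow y (by linarith)]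

/-- Large shifts are handled by the triangle inequality, small ones by the gradient; one constant
serves both. -/
theorem IsWeakGradient.lintegral_translate_sub_le_min (hp : 1 < p)
    {u : EuclideanSpace ℝ (Fin N) → ℝ}
    {G : EuclideanSpace ℝ (Fin N) → EuclideanSpace ℝ (Fin N)} (hG : IsWeakGradient u G)
    (hu : MemLp u (ENNReal.ofReal p) volume) (h : EuclideanSpace ℝ (Fin N)) :
    ∫⁻ x, ‖u x - u (x + h)‖ₑ ^ p ≤
      ((2 * eLpNorm u (ENNReal.ofReal p) volume) ^ p + eLpNorm G (ENNReal.ofReal p) volume ^ p) *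
        ENNReal.ofReal (min 1 (‖h‖ ^ p)) := by
  have hp0 : 0 < p := by linarith
  have hp1 : (1 : ℝ≥0∞) ≤ ENNReal.ofReal p := by simpa using ENNReal.ofReal_le_ofReal hp.le
  have ht := measurePreserving_add_right (volume : Measure (EuclideanSpace ℝ (Fin N))) h
  rcases min_choice 1 (‖h‖ ^ p) with hmin | hmin <;> rw [hmin]
  · rw [ENNReal.ofReal_one, mul_one, ← eLpNorm_ofReal_rpow hp0]
    refine le_trans ?_ le_self_add
    gcongr
    refine (eLpNorm_sub_le hu.1 (hu.1.comp_measurePreserving ht) hp1).trans (le_of_eq ?_)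
    rw [two_mul]
    congr 1
    exact eLpNorm_comp_measurePreserving hu.1 ht
  · have h1 := hG.lintegral_translate_sub_le hp.le h
    have h2 : ∫⁻ x, ‖(inner ℝ (G x) h : ℝ)‖ₑ ^ p ≤
        eLpNorm G (ENNReal.ofReal p) volume ^ p * ENNReal.ofReal (‖h‖ ^ p) := by
      rw [eLpNorm_ofReal_rpow hp0, ← lintegral_mul_const' _ _ ENNReal.ofReal_ne_top]
      refine lintegral_mono fun x => ?_
      rw [← ENNReal.ofReal_rpow_of_nonneg (norm_nonneg h) hp0.le, ofReal_norm,
        ← ENNReal.mul_rpow_of_nonneg _ _ hp0.le]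
      gcongr
      rw [← ofReal_norm, ← ofReal_norm, ← ofReal_norm,
        ← ENNReal.ofReal_mul (norm_nonneg _)]
      exact ENNReal.ofReal_le_ofReal (norm_inner_le_norm _ _)
    calc ∫⁻ x, ‖u x - u (x + h)‖ₑ ^ p = ∫⁻ x, ‖u (x + h) - u x‖ₑ ^ p := by
          simp_rw [← neg_sub (u _) (u (_ + h)), enorm_neg]
      _ ≤ _ := h1.trans h2
      _ ≤ _ := by gcongr; exact le_add_self

/-- Sobolev functions have finite Gagliardo seminorm. -/
theorem MemW0.integrable_gagliardo [NeZero N] (hp : 1 < p) (hs : s ∈ Ioo (0 : ℝ) 1)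
    {u : EuclideanSpace ℝ (Fin N) → ℝ} (hu : MemW0 Ω p u) :
    Integrable (fun z : EuclideanSpace ℝ (Fin N) × EuclideanSpace ℝ (Fin N) =>
      |u z.1 - u z.2| ^ p / ‖z.1 - z.2‖ ^ ((N : ℝ) + s * p)) volume := by
  have hp0 : 0 < p := by linarith
  have hm : AEStronglyMeasurable (fun z : EuclideanSpace ℝ (Fin N) × EuclideanSpace ℝ (Fin N) =>
      |u z.1 - u z.2| ^ p / ‖z.1 - z.2‖ ^ ((N : ℝ) + s * p)) volume := by
    have h1 : AEMeasurable (fun z : EuclideanSpace ℝ (Fin N) × EuclideanSpace ℝ (Fin N) =>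
        |u z.1 - u z.2|) volume :=
      (hu.memLp.1.comp_fst.sub hu.memLp.1.comp_snd).aemeasurable.abs
    exact ((h1.pow_const p).div (by fun_prop)).aestronglyMeasurable
  -- The variables become `(h, x)` with pair `(x, x + h)`, so that the kernel depends on `h` alone.
  have hT := measurePreserving_prod_add_swap
    (volume : Measure (EuclideanSpace ℝ (Fin N))) (volume : Measure (EuclideanSpace ℝ (Fin N)))
  rw [Measure.volume_eq_prod] at hm ⊢
  rw [← hT.integrable_comp hm]
  refine ⟨hm.comp_measurePreserving hT, ?_⟩
  have hm' := (hm.comp_measurePreserving hT).enorm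
  rw [HasFiniteIntegral, lintegral_prod _ hm']
  set C := (2 * eLpNorm u (ENNReal.ofReal p) volume) ^ p +
    eLpNorm (weakGradient u) (ENNReal.ofReal p) volume ^ p with hC
  have hCtop : C ≠ ⊤ := by
    refine ENNReal.add_ne_top.2 ⟨?_, ?_⟩
    · exact ENNReal.rpow_ne_top_of_nonneg hp0.le
        (ENNReal.mul_ne_top ENNReal.ofNat_ne_top hu.memLp.2.ne)
    · exact ENNReal.rpow_ne_top_of_nonneg hp0.le hu.memLp_weakGradient.2.ne
  have hk := integrable_min_one_norm_rpow_div (N := N) hp hs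
  calc _ ≤ ∫⁻ h : EuclideanSpace ℝ (Fin N),
        C * ‖min 1 (‖h‖ ^ p) / ‖h‖ ^ ((N : ℝ) + s * p)‖ₑ := by
        refine lintegral_mono fun h => ?_
        have e1 : ∀ x, ‖|u x - u (x + h)| ^ p / ‖x - (x + h)‖ ^ ((N : ℝ) + s * p)‖ₑ =
            ‖u x - u (x + h)‖ₑ ^ p * ‖(‖h‖ ^ ((N : ℝ) + s * p))⁻¹‖ₑ := by
          intro x
          rw [sub_add_cancel_left, norm_neg, div_eq_mul_inv, enorm_mul,
            Real.enorm_rpow_of_nonneg (abs_nonneg _) hp0.le, Real.enorm_abs]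
        simp only [Function.comp_apply, e1]
        rw [lintegral_mul_const' _ _ enorm_ne_top, div_eq_mul_inv, enorm_mul, ← mul_assoc]
        gcongr
        refine (hu.isWeakGradient_weakGradient.lintegral_translate_sub_le_min hp hu.memLp h).trans
          (le_of_eq ?_)
        rw [Real.enorm_eq_ofReal (by positivity)]
    _ = C * ∫⁻ h : EuclideanSpace ℝ (Fin N),
        ‖min 1 (‖h‖ ^ p) / ‖h‖ ^ ((N : ℝ) + s * p)‖ₑ := lintegral_const_mul' _ _ hCtop
    _ < ⊤ := ENNReal.mul_lt_top hCtop.lt_top hk.2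

theorem MemW0.integrable_nonlocalForm [NeZero N] (hp : 1 < p) (hs : s ∈ Ioo (0 : ℝ) 1)
    {u φ : EuclideanSpace ℝ (Fin N) → ℝ} (hu : MemW0 Ω p u) (hφ : MemW0 Ω p φ) :
    Integrable (fun z : EuclideanSpace ℝ (Fin N) × EuclideanSpace ℝ (Fin N) =>
      signedPow (p - 1) (u z.1 - u z.2) * (φ z.1 - φ z.2) / ‖z.1 - z.2‖ ^ ((N : ℝ) + s * p))
      volume := by
  refine ((hu.integrable_gagliardo hp hs).add (hφ.integrable_gagliardo hp hs)).mono' ?_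
    (ae_of_all _ fun z => ?_)
  · have h1 : AEMeasurable (fun z : EuclideanSpace ℝ (Fin N) × EuclideanSpace ℝ (Fin N) =>
        u z.1 - u z.2) volume := (hu.memLp.1.comp_fst.sub hu.memLp.1.comp_snd).aemeasurable
    have h2 : AEMeasurable (fun z : EuclideanSpace ℝ (Fin N) × EuclideanSpace ℝ (Fin N) =>
        φ z.1 - φ z.2) volume := (hφ.memLp.1.comp_fst.sub hφ.memLp.1.comp_snd).aemeasurable
    exact (((measurable_signedPow.comp_aemeasurable h1).mul h2).div
      (by fun_prop)).aestronglyMeasurable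
  · simp only [Pi.add_apply]
    rw [← add_div, norm_div, norm_mul, Real.norm_eq_abs, abs_signedPow (by linarith),
      Real.norm_of_nonneg (by positivity : 0 ≤ ‖z.1 - z.2‖ ^ ((N : ℝ) + s * p)), Real.norm_eq_abs]
    have h1 := rpow_mul_rpow_le_add (p := p) (q := p - 1) (by linarith) (by linarith)
      (abs_nonneg (u z.1 - u z.2)) (abs_nonneg (φ z.1 - φ z.2))
    rw [sub_sub_cancel, Real.rpow_one] at h1
    gcongr

end NonlocalForm

/-! ### Boundary layers and integrability of powers of the distance. -/

section BoundaryDistance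

variable {N : ℕ} {Ω : Set (EuclideanSpace ℝ (Fin N))}

theorem continuous_bdryDist (Ω : Set (EuclideanSpace ℝ (Fin N))) : Continuous (bdryDist Ω) :=
  Metric.continuous_infDist_pt _

theorem bdryDist_nonneg (Ω : Set (EuclideanSpace ℝ (Fin N))) (x : EuclideanSpace ℝ (Fin N)) :
    0 ≤ bdryDist Ω x :=
  Metric.infDist_nonneg

/-- About `1/τ` translates of `A` by multiples of `τ e` are disjoint, have equal measure and fit
into one ball. -/
theorem measure_le_of_disjoint_translates {E : Type*} [NormedAddCommGroup E] [NormedSpace ℝ E]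
    [MeasurableSpace E] [BorelSpace E] {μ : Measure E} [μ.IsAddRightInvariant]
    {A : Set E} {x₀ e : E} {r τ : ℝ} (hA : MeasurableSet A) (hAr : A ⊆ Metric.ball x₀ r)
    (hτ : 0 < τ) (hτ1 : τ ≤ 1)
    (hdis : ∀ a ∈ A, ∀ k : ℕ, 0 < k → a + ((k : ℝ) * τ) • e ∉ A) :
    μ A ≤ ENNReal.ofReal τ * μ (Metric.ball x₀ (r + 2 * ‖e‖)) := by
  set n := ⌈1 / τ⌉₊ with hn
  have hn1 : 1 / τ ≤ n := Nat.le_ceil _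
  have hn2 : (n : ℝ) * τ ≤ 2 := by
    have := (Nat.ceil_lt_add_one (by positivity : 0 ≤ 1 / τ)).le
    rw [← hn] at this
    calc (n : ℝ) * τ ≤ (1 / τ + 1) * τ := by gcongr
      _ = 1 + τ := by field_simp
      _ ≤ 2 := by linarith
  set B : ℕ → Set E := fun j => (fun x => x + (-(((j : ℝ) * τ) • e))) ⁻¹' A with hB
  have hBm : ∀ j, MeasurableSet (B j) := fun j => measurable_add_const _ hA
  have hBμ : ∀ j, μ (B j) = μ A := fun j => measure_preimage_add_right μ _ A
  have hlt : ∀ i j : ℕ, i < j → Disjoint (B i) (B j) := by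
    intro i j hij
    rw [Set.disjoint_left]
    intro x hi hj
    refine hdis _ hj (j - i) (Nat.sub_pos_of_lt hij) ?_
    have : x + -(((j : ℝ) * τ) • e) + (((j - i : ℕ) : ℝ) * τ) • e =
        x + -(((i : ℝ) * τ) • e) := by
      rw [Nat.cast_sub hij.le, sub_mul, sub_smul]
      abel
    rw [this]
    exact hi
  have hpair : Pairwise (Function.onFun Disjoint B) := by
    intro i j hij
    rcases lt_or_gt_of_ne hij with h | h
    · exact hlt i j h
    · exact (hlt j i h).symm
  have hsub : (⋃ j ∈ Finset.range n, B j) ⊆ Metric.ball x₀ (r + 2 * ‖e‖) := by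
    refine iUnion₂_subset fun j hj x hx => ?_
    have hx' := hAr hx
    rw [mem_ball_iff_norm] at hx' ⊢
    have hj' : (j : ℝ) ≤ n := by exact_mod_cast (Finset.mem_range.1 hj).le
    calc ‖x - x₀‖ = ‖(x + -(((j : ℝ) * τ) • e) - x₀) + ((j : ℝ) * τ) • e‖ := by congr 1; abel
      _ ≤ ‖x + -(((j : ℝ) * τ) • e) - x₀‖ + ‖((j : ℝ) * τ) • e‖ := norm_add_le _ _
      _ < r + 2 * ‖e‖ := by
        rw [norm_smul, Real.norm_of_nonneg (by positivity)]
        have : (j : ℝ) * τ * ‖e‖ ≤ 2 * ‖e‖ := by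
          gcongr
          exact (mul_le_mul_of_nonneg_right hj' hτ.le).trans hn2
        linarith
  have h1 : (n : ℝ≥0∞) * μ A ≤ μ (Metric.ball x₀ (r + 2 * ‖e‖)) := by
    calc (n : ℝ≥0∞) * μ A = ∑ j ∈ Finset.range n, μ (B j) := by simp [hBμ]
      _ = μ (⋃ j ∈ Finset.range n, B j) :=
        (measure_biUnion_finset (fun i _ j _ hij => hpair hij) fun j _ => hBm j).symm
      _ ≤ _ := measure_mono hsub
  calc μ A = ENNReal.ofReal τ * (ENNReal.ofReal (1 / τ) * μ A) := by
        rw [← mul_assoc, ← ENNReal.ofReal_mul hτ.le, mul_one_div_cancel hτ.ne',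
          ENNReal.ofReal_one, one_mul]
    _ ≤ ENNReal.ofReal τ * ((n : ℝ≥0∞) * μ A) := by
        gcongr
        rw [← ENNReal.ofReal_natCast]
        exact ENNReal.ofReal_le_ofReal hn1
    _ ≤ _ := by gcongr

/-- Near a smooth boundary point, the layer `{d < t}` has measure `O(t)`. -/
theorem IsSmoothBoundedDomain.exists_measure_layer_le_local (hΩ : IsSmoothBoundedDomain Ω)
    {x₀ : EuclideanSpace ℝ (Fin N)} (hx₀ : x₀ ∈ frontier Ω) :
    ∃ r > 0, ∃ C : ℝ, 0 ≤ C ∧ ∀ t > 0,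
      volume (Ω ∩ Metric.ball x₀ r ∩ {x | bdryDist Ω x < t}) ≤ ENNReal.ofReal (C * t) := by
  obtain ⟨U, hU, ρ, hρ, hd, hUρ⟩ := hΩ.smooth_boundary x₀ hx₀
  -- A direction normalised so that `ρ` has derivative 1 along it at `x₀`, hence more than `1/2`
  -- nearby.
  obtain ⟨e₀, he₀⟩ : ∃ e₀, fderiv ℝ ρ x₀ e₀ ≠ 0 := by
    by_contra! h
    exact hd (ContinuousLinearMap.ext h)
  set e := (fderiv ℝ ρ x₀ e₀)⁻¹ • e₀ with he
  have he1 : fderiv ℝ ρ x₀ e = 1 := by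
    rw [he, map_smul, smul_eq_mul, inv_mul_cancel₀ he₀]
  set L := ‖fderiv ℝ ρ x₀‖ + 1 with hL
  have hL0 : 0 < L := by positivity
  have hfc := hρ.continuous_fderiv (by simp)
  have ev1 : ∀ᶠ x in 𝓝 x₀, 1 / 2 < fderiv ℝ ρ x e := by
    have hc : Continuous fun x => fderiv ℝ ρ x e := by fun_prop
    exact hc.continuousAt.eventually (lt_mem_nhds (by simp only [he1]; norm_num))
  have ev2 : ∀ᶠ x in 𝓝 x₀, ‖fderiv ℝ ρ x‖ < L :=
    hfc.norm.continuousAt.eventually (gt_mem_nhds (by rw [hL]; linarith))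
  obtain ⟨R, hR, hball⟩ := Metric.eventually_nhds_iff_ball.1 ((ev1.and ev2).and hU)
  have hdiff : ∀ x, HasFDerivAt ρ (fderiv ℝ ρ x) x := fun x =>
    ((hρ.differentiable (by simp)) x).hasFDerivAt
  set V := (volume (Metric.ball x₀ (R / 2 + 2 * ‖e‖))).toReal with hV
  have hVtop : volume (Metric.ball x₀ (R / 2 + 2 * ‖e‖)) = ENNReal.ofReal V :=
    (ENNReal.ofReal_toReal measure_ball_lt_top.ne).symm
  have hV0 : 0 ≤ V := ENNReal.toReal_nonneg
  -- For `t < t₁` a boundary point within `t` of a layer point stays in the ball of radius `R`, and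
  -- the step `2Lt` is at most 1.
  set t₁ := min (R / 2) (1 / (2 * L)) with ht₁
  have ht₁0 : 0 < t₁ := by positivity
  refine ⟨R / 2, by positivity, V * (2 * L) + V / t₁, by positivity, fun t ht => ?_⟩
  rcases lt_or_ge t t₁ with htt | htt
  · have htR : t < R / 2 := htt.trans_le (min_le_left _ _)
    have htL : 2 * L * t ≤ 1 := by
      have := (htt.trans_le (min_le_right _ _)).le
      rw [le_div_iff₀ (by positivity)] at this
      linarith
    have hlow : ∀ x ∈ Ω ∩ Metric.ball x₀ (R / 2) ∩ {x | bdryDist Ω x < t}, -(L * t) ≤ ρ x := by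
      rintro x ⟨⟨-, hxb⟩, hxt⟩
      obtain ⟨y, hy, hxy⟩ := (Metric.infDist_lt_iff ⟨x₀, hx₀⟩).1 hxt
      have hxR : x ∈ Metric.ball x₀ R := Metric.ball_subset_ball (by linarith) hxb
      have hyR : y ∈ Metric.ball x₀ R := by
        rw [Metric.mem_ball] at hxb ⊢
        linarith [dist_triangle y x x₀, dist_comm x y]
      have hyΩ : y ∉ Ω := by
        rw [hΩ.isOpen.frontier_eq] at hy
        exact hy.2
      have hρy : 0 ≤ ρ y := not_lt.1 fun h => hyΩ ((hUρ y (hball y hyR).2).2 h)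
      have h1 := (convex_ball x₀ R).norm_image_sub_le_of_norm_hasFDerivWithin_le (f := ρ)
        (f' := fun x => fderiv ℝ ρ x) (C := L) (fun z _ => (hdiff z).hasFDerivWithinAt)
        (fun z hz => (hball z hz).1.2.le) hxR hyR
      rw [Real.norm_eq_abs, ← dist_eq_norm, dist_comm] at h1
      have h2 := le_abs_self (ρ y - ρ x)
      have h3 : L * dist x y ≤ L * t := by gcongr
      linarith
    -- On the layer `-Lt ≤ ρ < 0`. A translation by `k · 2Lt` along `e` raises `ρ` by more than
    -- `kLt`, so it leaves the layer.
    refine (measure_le_of_disjoint_translates (x₀ := x₀) (e := e) (r := R / 2) (τ := 2 * L * t)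
      ?_ (fun x hx => hx.1.2) (by positivity) htL ?_).trans ?_
    · exact (hΩ.isOpen.measurableSet.inter measurableSet_ball).inter
        (isOpen_lt (continuous_bdryDist Ω) continuous_const).measurableSet
    · intro a ha k hk hak
      have haR : a ∈ Metric.ball x₀ R := Metric.ball_subset_ball (by linarith) ha.1.2
      have hakR := Metric.ball_subset_ball (by linarith : R / 2 ≤ R) hak.1.2
      obtain ⟨z, hz, hzeq⟩ := domain_mvt (f := ρ) (f' := fun x => fderiv ℝ ρ x)
        (fun z _ => (hdiff z).hasFDerivWithinAt) (convex_ball x₀ R) haR hakR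
      have hzR := (convex_ball x₀ R).segment_subset haR hakR hz
      have h1 := (hball z hzR).1.1
      rw [add_sub_cancel_left, map_smul, smul_eq_mul] at hzeq
      have h2 := hlow a ha
      have h3 := (hUρ _ (hball _ hakR).2).1 hak.1.1
      have hk1 : (1 : ℝ) ≤ k := by exact_mod_cast hk
      have hLt : 0 < L * t := by positivity
      have h4 : (k : ℝ) * (2 * L * t) * (1 / 2) < k * (2 * L * t) * fderiv ℝ ρ z e := by gcongr
      nlinarith
    · rw [hVtop, ← ENNReal.ofReal_mul (by positivity)]
      refine ENNReal.ofReal_le_ofReal ?_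
      have : 0 ≤ V / t₁ * t := by positivity
      linarith
  · calc volume (Ω ∩ Metric.ball x₀ (R / 2) ∩ {x | bdryDist Ω x < t})
        ≤ volume (Metric.ball x₀ (R / 2 + 2 * ‖e‖)) := by
          refine measure_mono fun x hx => Metric.ball_subset_ball ?_ hx.1.2
          linarith [norm_nonneg e]
      _ = ENNReal.ofReal V := hVtop
      _ ≤ _ := by
          refine ENNReal.ofReal_le_ofReal ?_
          have h1 : V ≤ V / t₁ * t := by
            rw [div_mul_eq_mul_div, le_div_iff₀ ht₁0]
            gcongr
          have h2 : 0 ≤ V * (2 * L) * t := by positivity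
          linarith

/-- The layer `{d < t}` of a smooth bounded domain has measure `O(t)`. -/
theorem IsSmoothBoundedDomain.exists_measure_layer_le (hΩ : IsSmoothBoundedDomain Ω)
    (hne : (frontier Ω).Nonempty) :
    ∃ C : ℝ, 0 ≤ C ∧ ∀ t > 0,
      volume (Ω ∩ {x | bdryDist Ω x < t}) ≤ ENNReal.ofReal (C * t) := by
  have hc : IsCompact (frontier Ω) :=
    Metric.isCompact_of_isClosed_isBounded isClosed_frontier
      (hΩ.isBounded.closure.subset frontier_subset_closure)
  obtain ⟨W, hWo, hW, C, hC, hCt⟩ : ∃ W : Set (EuclideanSpace ℝ (Fin N)), IsOpen W ∧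
      frontier Ω ⊆ W ∧ ∃ C : ℝ, 0 ≤ C ∧ ∀ t > 0,
        volume (Ω ∩ W ∩ {x | bdryDist Ω x < t}) ≤ ENNReal.ofReal (C * t) := by
    refine hc.induction_on (p := fun S => ∃ W : Set (EuclideanSpace ℝ (Fin N)), IsOpen W ∧
      S ⊆ W ∧ ∃ C : ℝ, 0 ≤ C ∧ ∀ t > 0,
        volume (Ω ∩ W ∩ {x | bdryDist Ω x < t}) ≤ ENNReal.ofReal (C * t)) ?_ ?_ ?_ ?_
    · exact ⟨∅, isOpen_empty, subset_rfl, 0, le_rfl, by simp⟩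
    · rintro S T hST ⟨W, hW, hTW, h⟩
      exact ⟨W, hW, hST.trans hTW, h⟩
    · rintro S T ⟨W, hW, hSW, C, hC, h⟩ ⟨W', hW', hTW, C', hC', h'⟩
      refine ⟨W ∪ W', hW.union hW', union_subset_union hSW hTW, C + C', add_nonneg hC hC', ?_⟩
      intro t ht
      rw [inter_union_distrib_left, union_inter_distrib_right, add_mul,
        ENNReal.ofReal_add (by positivity) (by positivity)]
      exact (measure_union_le _ _).trans (add_le_add (h t ht) (h' t ht))
    · intro x hx
      obtain ⟨r, hr, C, hC, h⟩ := hΩ.exists_measure_layer_le_local hx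
      exact ⟨Metric.ball x r, mem_nhdsWithin_of_mem_nhds (Metric.ball_mem_nhds x hr),
        Metric.ball x r, Metric.isOpen_ball, subset_rfl, C, hC, h⟩
  -- Points at distance less than `δ` from the boundary lie in the finite cover; for `t ≥ δ` the
  -- whole volume of `Ω` is absorbed into the constant.
  obtain ⟨δ, hδ, hδW⟩ := hc.exists_thickening_subset_open hWo hW
  have hΩv : volume Ω = ENNReal.ofReal (volume Ω).toReal :=
    (ENNReal.ofReal_toReal hΩ.isBounded.measure_lt_top.ne).symm
  have hv0 : 0 ≤ (volume Ω).toReal := ENNReal.toReal_nonneg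
  refine ⟨C + (volume Ω).toReal / δ, by positivity, fun t ht => ?_⟩
  rcases lt_or_ge t δ with h | h
  · refine (measure_mono ?_).trans ((hCt t ht).trans (ENNReal.ofReal_le_ofReal ?_))
    · rintro x ⟨hx, hxt⟩
      refine ⟨⟨hx, hδW ?_⟩, hxt⟩
      rw [Metric.mem_thickening_iff_infDist_lt hne]
      exact lt_trans hxt h
    · have : 0 ≤ (volume Ω).toReal / δ * t := by positivity
      linarith
  · refine (measure_mono inter_subset_left).trans (hΩv.trans_le (ENNReal.ofReal_le_ofReal ?_))
    have h1 : (volume Ω).toReal ≤ (volume Ω).toReal / δ * t := by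
      rw [div_mul_eq_mul_div, le_div_iff₀ hδ]
      gcongr
    have h2 : 0 ≤ C * t := by positivity
    linarith

/-- Powers `d^(-γ)`, `γ < 1`, of the distance to the boundary are integrable. -/
theorem IsSmoothBoundedDomain.integrableOn_bdryDist_rpow (hΩ : IsSmoothBoundedDomain Ω)
    {γ : ℝ} (hγ : γ < 1) : IntegrableOn (fun x => bdryDist Ω x ^ (-γ)) Ω volume := by
  rcases le_or_gt γ 0 with h0 | h0
  · have hc : Continuous fun x => bdryDist Ω x ^ (-γ) :=
      (continuous_bdryDist Ω).rpow_const fun _ => Or.inr (by linarith)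
    exact (hc.continuousOn.integrableOn_compact hΩ.isBounded.isCompact_closure).mono_set
      subset_closure
  -- The distance to the empty set is 0 by convention, and so is its power with the exponent `-γ ≠
  -- 0`.
  rcases (frontier Ω).eq_empty_or_nonempty with hemp | hne
  · have : (fun x => bdryDist Ω x ^ (-γ)) = fun _ => 0 := by
      ext x
      rw [bdryDist, hemp, Metric.infDist_empty, Real.zero_rpow (by linarith)]
    rw [this]
    exact integrableOn_zero
  obtain ⟨C, hC, hCt⟩ := hΩ.exists_measure_layer_le hne
  have hm : Measurable fun x => bdryDist Ω x ^ (-γ) :=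
    (continuous_bdryDist Ω).measurable.pow_const _
  have hnn : ∀ x, 0 ≤ bdryDist Ω x ^ (-γ) := fun x => Real.rpow_nonneg (bdryDist_nonneg Ω x) _
  refine ⟨hm.aestronglyMeasurable, ?_⟩
  -- Layer-cake formula: `d^(-γ) > t` forces `d < t^(-1/γ)`, a layer of measure `O(t^(-1/γ))`,
  -- integrable on `(1, ∞)` since `γ < 1`.
  rw [hasFiniteIntegral_iff_ofReal (ae_of_all _ hnn), lintegral_eq_lintegral_meas_lt _
    (ae_of_all _ hnn) hm.aemeasurable, ← Ioc_union_Ioi_eq_Ioi zero_le_one]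
  refine (lintegral_union_le _ _ _).trans_lt (ENNReal.add_lt_top.2 ⟨?_, ?_⟩)
  · calc _ ≤ ∫⁻ _ in Ioc (0 : ℝ) 1, volume Ω := by
          refine lintegral_mono fun t => ?_
          exact (measure_mono (subset_univ _)).trans (by simp)
      _ < ⊤ := by simpa using hΩ.isBounded.measure_lt_top
  · have h1 : IntegrableOn (fun t : ℝ => C * t ^ (-(1 / γ))) (Ioi 1) volume := by
      refine (integrableOn_Ioi_rpow_of_lt ?_ one_pos).const_mul C
      rw [neg_lt_neg_iff, lt_div_iff₀ h0]
      linarith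
    refine lt_of_le_of_lt (lintegral_mono_ae ?_) h1.lintegral_lt_top
    filter_upwards [ae_restrict_mem measurableSet_Ioi] with t ht
    have ht0 : (0 : ℝ) < t := one_pos.trans ht
    refine le_trans ?_ (hCt (t ^ (-(1 / γ))) (by positivity))
    rw [Measure.restrict_apply (measurableSet_lt measurable_const hm), inter_comm]
    refine measure_mono (inter_subset_inter_right _ fun x hx => ?_)
    have hx' : t < bdryDist Ω x ^ (-γ) := hx
    have h2 := Real.rpow_lt_rpow_of_neg ht0 hx' (by simpa using h0 : -(1 / γ) < 0)
    rw [← Real.rpow_mul (bdryDist_nonneg Ω x)] at h2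
    have h3 : -γ * -(1 / γ) = 1 := by field_simp
    rwa [h3, Real.rpow_one] at h2

end BoundaryDistance

/-! ### One-sided derivatives of maxima and minima. -/

section OneSided

/-- If the two values at 0 agree, the right slope of the maximum is the maximum of the right slopes;
otherwise one function dominates near 0. -/
theorem DifferentiableWithinAt.max_Ioi {f g : ℝ → ℝ} (hf : DifferentiableWithinAt ℝ f (Ioi 0) 0)
    (hg : DifferentiableWithinAt ℝ g (Ioi 0) 0) :
    DifferentiableWithinAt ℝ (fun t => max (f t) (g t)) (Ioi 0) 0 := by
  rcases lt_trichotomy (f 0) (g 0) with h | h | h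
  · have ev : ∀ᶠ t in 𝓝[>] (0 : ℝ), f t < g t :=
      hf.continuousWithinAt.eventually_lt hg.continuousWithinAt h
    exact hg.congr_of_eventuallyEq (ev.mono fun t ht => max_eq_right ht.le) (max_eq_right h.le)
  · have h1 := (hasDerivWithinAt_iff_tendsto_slope' self_notMem_Ioi).1 hf.hasDerivWithinAt
    have h2 := (hasDerivWithinAt_iff_tendsto_slope' self_notMem_Ioi).1 hg.hasDerivWithinAt
    refine ((hasDerivWithinAt_iff_tendsto_slope' self_notMem_Ioi).2
      ((h1.max h2).congr' ?_)).differentiableWithinAt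
    filter_upwards [self_mem_nhdsWithin] with t ht
    have ht' : (0 : ℝ) < t := ht
    simp only [slope_def_field]
    rw [h, max_self, max_div_div_right (by linarith), max_sub_sub_right]
  · have ev : ∀ᶠ t in 𝓝[>] (0 : ℝ), g t < f t :=
      hg.continuousWithinAt.eventually_lt hf.continuousWithinAt h
    exact hf.congr_of_eventuallyEq (ev.mono fun t ht => max_eq_left ht.le) (max_eq_left h.le)

theorem DifferentiableWithinAt.min_Ioi {f g : ℝ → ℝ} (hf : DifferentiableWithinAt ℝ f (Ioi 0) 0)
    (hg : DifferentiableWithinAt ℝ g (Ioi 0) 0) :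
    DifferentiableWithinAt ℝ (fun t => min (f t) (g t)) (Ioi 0) 0 := by
  refine (hf.neg.max_Ioi hg.neg).neg.congr (fun t _ => ?_) ?_ <;>
    simp [max_neg_neg]

theorem DifferentiableWithinAt.exists_tendsto_quotient {f : ℝ → ℝ}
    (hf : DifferentiableWithinAt ℝ f (Ioi 0) 0) :
    ∃ l, Tendsto (fun t => (f t - f 0) / t) (𝓝[>] 0) (𝓝 l) := by
  refine ⟨_, ((hasDerivWithinAt_iff_tendsto_slope' self_notMem_Ioi).1 hf.hasDerivWithinAt).congr
    fun t => ?_⟩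
  rw [slope_def_field, sub_zero]

end OneSided

/-! ### The Díaz–Saa test functions. -/

section TestFunctions

variable {m k ε : ℝ}

/-- The shifted positive part `a⁺ + ε`. -/
noncomputable def shiftPos (ε a : ℝ) : ℝ := max a 0 + ε

theorem le_shiftPos (ε a : ℝ) : ε ≤ shiftPos ε a := le_add_of_nonneg_left (le_max_right _ _)

theorem shiftPos_pos (hε : 0 < ε) (a : ℝ) : 0 < shiftPos ε a := hε.trans_le (le_shiftPos ε a)

theorem shiftPos_of_nonneg {a : ℝ} (ha : 0 ≤ a) : shiftPos ε a = a + ε := by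
  rw [shiftPos, max_eq_left ha]

theorem abs_shiftPos_sub_le (ε a b : ℝ) : |shiftPos ε a - shiftPos ε b| ≤ |a - b| := by
  rw [shiftPos, shiftPos, add_sub_add_right_eq_sub]
  simpa using abs_max_sub_max_le_max a 0 b 0

theorem differentiableWithinAt_shiftPos (ε a α : ℝ) :
    DifferentiableWithinAt ℝ (fun t => shiftPos ε (a + t * α)) (Ioi 0) 0 := by
  unfold shiftPos
  refine DifferentiableWithinAt.add ?_ (differentiableWithinAt_const _)
  exact DifferentiableWithinAt.max_Ioi (by fun_prop) (by fun_prop)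

/-- The test function for the sub-solution. -/
noncomputable def subTest (m k ε a c : ℝ) : ℝ :=
  truncDiff m k (shiftPos ε a) (shiftPos ε c) / shiftPos ε a ^ m

/-- The test function for the super-solution. -/
noncomputable def superTest (m k ε a c : ℝ) : ℝ :=
  truncDiff m k (shiftPos ε a) (shiftPos ε c) / shiftPos ε c ^ m

theorem differentiableWithinAt_truncDiff (hk : 0 < k) (hε : 0 < ε) (a c α β : ℝ) :
    DifferentiableWithinAt ℝ
      (fun t => truncDiff m k (shiftPos ε (a + t * α)) (shiftPos ε (c + t * β))) (Ioi 0) 0 := by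
  unfold truncDiff
  refine DifferentiableWithinAt.max_Ioi (DifferentiableWithinAt.sub ?_ ?_)
    (differentiableWithinAt_const _)
  · refine ((differentiableWithinAt_shiftPos ε a α).min_Ioi
      (differentiableWithinAt_const k)).rpow_const (Or.inl ?_)
    exact (lt_min (shiftPos_pos hε _) hk).ne'
  · exact (differentiableWithinAt_shiftPos ε c β).rpow_const (Or.inl (shiftPos_pos hε _).ne')

theorem isDirLipschitz_subTest (hm : 0 ≤ m) (hk : 0 < k) (hε : 0 < ε) :
    IsDirLipschitz (4 * m + 2) (subTest m k ε) where
  lipschitz a b c d := by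
    refine (abs_truncDiff_div_left_sub_le hm hk (shiftPos_pos hε a) (shiftPos_pos hε b)
      (shiftPos_pos hε c) (shiftPos_pos hε d)).trans ?_
    have := abs_shiftPos_sub_le ε a b
    have := abs_shiftPos_sub_le ε c d
    gcongr
  zero := by
    rw [subTest, truncDiff_eq_zero_of_le hm hk (shiftPos_pos hε 0).le (min_le_left _ _), zero_div]
  exists_tendsto a c α β := by
    have h := (differentiableWithinAt_truncDiff (m := m) hk hε a c α β).div
      ((differentiableWithinAt_shiftPos ε a α).rpow_const (p := m)
        (Or.inl (shiftPos_pos hε _).ne')) (Real.rpow_pos_of_pos (shiftPos_pos hε _) m).ne'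
    obtain ⟨l, hl⟩ := h.exists_tendsto_quotient
    exact ⟨l, by simpa [subTest] using hl⟩

theorem isDirLipschitz_superTest (hm : 0 ≤ m) (hk : 0 < k) (hε : 0 < ε) :
    IsDirLipschitz (truncLip m k ε) (superTest m k ε) where
  lipschitz a b c d := by
    refine (abs_truncDiff_div_right_sub_le hm hk hε (shiftPos_pos hε a) (shiftPos_pos hε b)
      (le_shiftPos ε c) (le_shiftPos ε d)).trans ?_
    have := abs_shiftPos_sub_le ε a b
    have := abs_shiftPos_sub_le ε c d
    have : 0 ≤ truncLip m k ε := by unfold truncLip; positivity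
    gcongr
  zero := by
    rw [superTest, truncDiff_eq_zero_of_le hm hk (shiftPos_pos hε 0).le (min_le_left _ _), zero_div]
  exists_tendsto a c α β := by
    have h := (differentiableWithinAt_truncDiff (m := m) hk hε a c α β).div
      ((differentiableWithinAt_shiftPos ε c β).rpow_const (p := m)
        (Or.inl (shiftPos_pos hε _).ne')) (Real.rpow_pos_of_pos (shiftPos_pos hε _) m).ne'
    obtain ⟨l, hl⟩ := h.exists_tendsto_quotient
    exact ⟨l, by simpa [superTest] using hl⟩

theorem isDirLipschitz_posPart_sub_mul {j : ℝ} (hj : 0 ≤ j) :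
    IsDirLipschitz (1 + j) fun a c => max (a - j * c) 0 where
  lipschitz a b c d := by
    have h1 : |max (a - j * c) 0 - max (b - j * d) 0| ≤ |(a - j * c) - (b - j * d)| := by
      simpa using abs_max_sub_max_le_max (a - j * c) 0 (b - j * d) 0
    have h2 : |(a - j * c) - (b - j * d)| ≤ |a - b| + j * |c - d| := by
      calc _ = |(a - b) - j * (c - d)| := by congr 1; ring
        _ ≤ |a - b| + |j * (c - d)| := abs_sub _ _
        _ = _ := by rw [abs_mul, abs_of_nonneg hj]
    nlinarith [abs_nonneg (a - b), abs_nonneg (c - d), mul_nonneg hj (abs_nonneg (a - b))]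
  zero := by simp
  exists_tendsto a c α β := by
    have h : DifferentiableWithinAt ℝ
        (fun t => max (a + t * α - j * (c + t * β)) 0) (Ioi 0) 0 :=
      DifferentiableWithinAt.max_Ioi (by fun_prop) (differentiableWithinAt_const _)
    obtain ⟨l, hl⟩ := h.exists_tendsto_quotient
    exact ⟨l, by simpa using hl⟩

end TestFunctions

/-! ### The sub-solution vanishes where the super-solution does. -/

section Positivity

variable {N : ℕ} {Ω : Set (EuclideanSpace ℝ (Fin N))} {p s m lam δ γ : ℝ}

/-- After taking positive parts an upper bound alone gives domination. This suits integrands without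
an integrable lower bound uniform in `n`. -/
theorem tendsto_integral_max_zero {α : Type*} [MeasurableSpace α] {μ : Measure α}
    {f : ℕ → α → ℝ} {D : α → ℝ} (hf : ∀ n, AEStronglyMeasurable (f n) μ) (hD : Integrable D μ)
    (hfD : ∀ n, ∀ᵐ x ∂μ, f n x ≤ D x)
    (hlim : ∀ᵐ x ∂μ, Tendsto (fun n => max (f n x) 0) atTop (𝓝 0)) :
    Tendsto (fun n => ∫ x, max (f n x) 0 ∂μ) atTop (𝓝 0) := by
  have := tendsto_integral_of_dominated_convergence (μ := μ) (F := fun n x => max (f n x) 0)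
    (f := fun _ => 0) (fun x => |D x|) (fun n => (hf n).sup aestronglyMeasurable_const) hD.abs
    (fun n => ?_) hlim
  · simpa using this
  · filter_upwards [hfD n] with x hx
    rw [Real.norm_of_nonneg (le_max_right _ _)]
    exact max_le (hx.trans (le_abs_self _)) (abs_nonneg _)

theorem integral_le_integral_max_zero {α : Type*} [MeasurableSpace α] {μ : Measure α}
    {f : α → ℝ} (hf : Integrable f μ) : ∫ x, f x ∂μ ≤ ∫ x, max (f x) 0 ∂μ :=
  integral_mono hf hf.pos_part fun _ => le_max_left _ _

theorem MemW0.ae_nonneg (hΩ : IsOpen Ω) {u : EuclideanSpace ℝ (Fin N) → ℝ} (hu : MemW0 Ω p u)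
    (h : ∀ᵐ x ∂(volume.restrict Ω), 0 ≤ u x) : ∀ᵐ x, 0 ≤ u x := by
  have h1 := (ae_restrict_iff' hΩ.measurableSet).1 h
  have h2 := (ae_restrict_iff' hΩ.measurableSet.compl).1 hu.ae_eq_zero
  filter_upwards [h1, h2] with x h1 h2
  by_cases hx : x ∈ Ω
  · exact h1 hx
  · exact (h2 hx).ge

/-- At a zero of a nonnegative function all forward quotients are nonnegative, so `⟨e, ∇w⟩ ≥ 0` for
every `e`; take `e = -∇w`. -/
theorem MemW0.ae_weakGradient_eq_zero (hp : 1 < p) {w : EuclideanSpace ℝ (Fin N) → ℝ}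
    (hw : MemW0 Ω p w) (h0 : ∀ᵐ x, 0 ≤ w x) : ∀ᵐ x, w x = 0 → weakGradient w x = 0 := by
  have key : ∀ e : EuclideanSpace ℝ (Fin N),
      ∀ᵐ x, w x = 0 → (0 : ℝ) ≤ inner ℝ e (weakGradient w x) := by
    intro e
    obtain ⟨ms, -, h⟩ := hw.exists_subseq_tendsto hp e tendsto_unitStep
    have hall : ∀ᵐ x, ∀ i, 0 ≤ w (x + unitStep (ms i) • e) := ae_all_iff.2 fun i =>
      (measurePreserving_add_right volume (unitStep (ms i) • e)).quasiMeasurePreserving.ae h0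
    filter_upwards [h, hall] with x hx hx' hw0
    refine ge_of_tendsto' hx fun i => ?_
    rw [hw0, sub_zero]
    exact div_nonneg (hx' i) (unitStep_pos _).le
  filter_upwards [ae_all_iff.2 fun n : ℕ =>
    key (TopologicalSpace.denseSeq (EuclideanSpace ℝ (Fin N)) n)] with x hx hw0
  have hall : ∀ e : EuclideanSpace ℝ (Fin N), (0 : ℝ) ≤ inner ℝ e (weakGradient w x) := fun e =>
    (isClosed_le continuous_const (by fun_prop :
      Continuous fun e : EuclideanSpace ℝ (Fin N) => (inner ℝ e (weakGradient w x) : ℝ))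
      ).closure_subset_iff.2 (range_subset_iff.2 fun n => hx n hw0)
      (TopologicalSpace.denseRange_denseSeq _ e)
  have h1 := hall (-weakGradient w x)
  rw [inner_neg_left, real_inner_self_eq_norm_sq] at h1
  exact norm_eq_zero.1 (by nlinarith [norm_nonneg (weakGradient w x)])

theorem memW0_zero (hp : 1 < p) {u : EuclideanSpace ℝ (Fin N) → ℝ} (hu : MemW0 Ω p u) :
    MemW0 Ω p fun _ => 0 :=
  IsDirLipschitz.memW0 (L := 0) (F := fun _ _ => 0) hp
    ⟨by simp, rfl, fun _ _ _ _ => ⟨0, by simp⟩⟩ hu hu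

/-- The bound is uniform in `j`: if `c ≥ d`, the term `-j c` can only lower the increment of the
positive part, which is then at most `|a - b|`. -/
theorem signedPow_mul_posPart_sub_le (hp : 1 < p) {j : ℝ} (hj : 0 ≤ j) (a b c d : ℝ) :
    signedPow (p - 1) (c - d) * (max (a - j * c) 0 - max (b - j * d) 0) ≤
      |a - b| ^ p + |c - d| ^ p := by
  have h0 : |c - d| ^ (p - 1) * |a - b| ≤ |a - b| ^ p + |c - d| ^ p := by
    have := rpow_mul_rpow_le_add (p := p) (q := p - 1) (by linarith) (by linarith)
      (abs_nonneg (c - d)) (abs_nonneg (a - b))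
    rw [sub_sub_cancel, Real.rpow_one] at this
    linarith
  refine le_trans ?_ h0
  have key : ∀ {a b c d : ℝ}, d ≤ c → max (a - j * c) 0 - max (b - j * d) 0 ≤ |a - b| := by
    intro a b c d h
    rw [sub_le_iff_le_add]
    refine max_le ?_ (add_nonneg (abs_nonneg _) (le_max_right _ _))
    have := mul_le_mul_of_nonneg_left h hj
    linarith [le_max_left (b - j * d) 0, le_abs_self (a - b)]
  rcases le_total d c with h | h
  · rw [signedPow_of_nonneg (by linarith) (sub_nonneg.2 h), abs_of_nonneg (sub_nonneg.2 h)]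
    have := key (a := a) (b := b) h
    have : 0 ≤ (c - d) ^ (p - 1) := Real.rpow_nonneg (sub_nonneg.2 h) _
    gcongr
  · rw [signedPow_of_nonpos (by linarith) (sub_nonpos.2 h), abs_of_nonpos (sub_nonpos.2 h),
      abs_sub_comm a]
    have h1 := key (a := b) (b := a) h
    have h2 : 0 ≤ (-(c - d)) ^ (p - 1) := Real.rpow_nonneg (by linarith) _
    have := mul_le_mul_of_nonneg_left h1 h2
    linarith

theorem MemWL.integrable_rpow_abs (hm : 0 ≤ m) {u : EuclideanSpace ℝ (Fin N) → ℝ}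
    (hu : MemWL Ω p m u) : IntegrableOn (fun x => |u x| ^ (2 * (m + 1))) Ω volume :=
  MemLp.integrable_norm_rpow_ofReal (by positivity) hu.2

theorem MemWL.integrableOn_rpow_mul (hm : 0 ≤ m) {u v : EuclideanSpace ℝ (Fin N) → ℝ}
    (hu : MemWL Ω p m u) (hv : MemWL Ω p m v) (hv0 : ∀ᵐ x ∂(volume.restrict Ω), 0 ≤ v x) :
    IntegrableOn (fun x => v x ^ (2 * m + 1) * u x) Ω volume := by
  refine ((hv.integrable_rpow_abs hm).add (hu.integrable_rpow_abs hm)).mono'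
    ((hv.2.1.aemeasurable.pow_const _).aestronglyMeasurable.mul hu.2.1) ?_
  filter_upwards [hv0] with x hx
  have := rpow_mul_rpow_le_add (p := 2 * (m + 1)) (q := 2 * m + 1) (by linarith) (by linarith)
    (abs_nonneg (v x)) (abs_nonneg (u x))
  rw [show 2 * (m + 1) - (2 * m + 1) = 1 by ring, Real.rpow_one] at this
  rw [norm_mul, Real.norm_of_nonneg (Real.rpow_nonneg hx _), Real.norm_eq_abs]
  nth_rewrite 1 [← abs_of_nonneg hx]
  exact this

theorem weakRHS_nonneg (hm : 0 ≤ m) (hlam : 0 < lam) {g₀ v φ : EuclideanSpace ℝ (Fin N) → ℝ}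
    (hg₀ : ∀ᵐ x ∂(volume.restrict Ω), 0 ≤ g₀ x) (hv : ∀ᵐ x ∂(volume.restrict Ω), 0 ≤ v x)
    (hφ : ∀ x, 0 ≤ φ x) : 0 ≤ weakRHS Ω m lam δ γ g₀ v φ := by
  refine integral_nonneg_of_ae ?_
  filter_upwards [hg₀, hv] with x h1 h2
  have h3 : 0 ≤ bdryDist Ω x ^ (-γ) := Real.rpow_nonneg (bdryDist_nonneg Ω x) _
  have h4 := hφ x
  simp only [Pi.zero_apply]
  positivity

theorem tendsto_posPart_sub_mul_eventually {a c : ℝ} (hc : 0 < c) :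
    ∀ᶠ j : ℕ in atTop, max (a - (j : ℝ) * c) 0 = 0 := by
  have h1 : Tendsto (fun j : ℕ => (j : ℝ) * c) atTop atTop :=
    tendsto_natCast_atTop_atTop.atTop_mul_const hc
  filter_upwards [h1.eventually_ge_atTop a] with j hj
  exact max_eq_right (by linarith)

/-- The positive parts of the local forms of a super-solution tested with `(u - jv)⁺` vanish as
`j → ∞`. -/
theorem exists_localForm_posPart_le [NeZero N] (hp : 1 < p) (hΩ : IsOpen Ω)
    {u v : EuclideanSpace ℝ (Fin N) → ℝ} (hu : MemW0 Ω p u) (hv : MemW0 Ω p v)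
    (hv0 : ∀ᵐ x ∂(volume.restrict Ω), 0 ≤ v x) :
    ∃ r : ℕ → ℝ, Tendsto r atTop (𝓝 0) ∧
      ∀ j : ℕ, localForm Ω p v (fun x => max (u x - j * v x) 0) ≤ r j := by
  have hφ : ∀ j : ℕ, MemW0 Ω p fun x => max (u x - j * v x) 0 := fun j =>
    (isDirLipschitz_posPart_sub_mul j.cast_nonneg).memW0 hp hu hv
  have h0 := memW0_zero hp hu
  have hI := fun j => (hv.integrable_localForm hp (hφ j)).integrableOn (s := Ω)
  refine ⟨_, tendsto_integral_max_zero (fun j => (hI j).1)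
    (((hu.integrable_norm_weakGradient_rpow hp).add
      (hv.integrable_norm_weakGradient_rpow hp)).integrableOn (s := Ω)) ?_ ?_,
    fun j => integral_le_integral_max_zero (hI j)⟩
  · intro j
    refine ae_restrict_of_ae ?_
    -- Applied with the zero function paired with `u`, so that only the form of `v` remains and is
    -- bounded above independently of `j`.
    filter_upwards [hu.ae_form_lower_bound (M := fun _ => 1) (good := fun _ => True) hp hv h0 (hφ j)
      (ae_of_all _ fun _ => trivial) (fun x _ => ⟨1, one_pos, fun y _ _ => by
        have := signedPow_mul_posPart_sub_le hp j.cast_nonneg (u y) (u x) (v y) (v x)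
        simp only [sub_self, mul_zero]
        linarith⟩), h0.ae_weakGradient_eq_zero hp (ae_of_all _ fun _ => le_rfl)] with x h1 h2
    rw [h2 rfl, inner_zero_right, mul_zero] at h1
    simp only [Pi.add_apply]
    linarith
  · refine ae_restrict_of_ae ?_
    -- Where `v = 0` also `∇v = 0`; where `v > 0` the test function, and with it its gradient,
    -- vanishes for large `j`.
    filter_upwards [hv.ae_nonneg hΩ hv0, hv.ae_weakGradient_eq_zero hp (hv.ae_nonneg hΩ hv0),
      ae_all_iff.2 fun j => (hφ j).ae_weakGradient_eq_zero hp
        (ae_of_all _ fun _ => le_max_right _ _)] with x h1 h2 h3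
    refine tendsto_const_nhds.congr' ?_
    rcases h1.eq_or_lt with h | h
    · refine Eventually.of_forall fun j => ?_
      rw [h2 h.symm]
      simp
    · filter_upwards [tendsto_posPart_sub_mul_eventually (a := u x) h] with j hj
      rw [h3 j hj]
      simp

theorem tendsto_integral_rpow_mul_posPart (hm : 0 ≤ m) {u v : EuclideanSpace ℝ (Fin N) → ℝ}
    (hu : MemWL Ω p m u) (hv : MemWL Ω p m v) (hu0 : ∀ᵐ x ∂(volume.restrict Ω), 0 ≤ u x)
    (hv0 : ∀ᵐ x ∂(volume.restrict Ω), 0 ≤ v x) :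
    Tendsto (fun j : ℕ => ∫ x in Ω, v x ^ (2 * m + 1) * max (u x - j * v x) 0) atTop (𝓝 0) := by
  have := tendsto_integral_of_dominated_convergence (μ := volume.restrict Ω)
    (F := fun (j : ℕ) x => v x ^ (2 * m + 1) * max (u x - j * v x) 0) (f := fun _ => 0)
    (fun x => v x ^ (2 * m + 1) * u x) (fun j => ?_) (hu.integrableOn_rpow_mul hm hv hv0)
    (fun j => ?_) ?_
  · simpa using this
  · exact (hv.2.1.aemeasurable.pow_const _).aestronglyMeasurable.mul
      ((hu.2.1.sub (hv.2.1.const_mul _)).sup aestronglyMeasurable_const)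
  · filter_upwards [hu0, hv0] with x h1 h2
    have h3 : 0 ≤ (j : ℝ) * v x := by positivity
    rw [norm_mul, Real.norm_of_nonneg (Real.rpow_nonneg h2 _),
      Real.norm_of_nonneg (le_max_right _ _)]
    gcongr
    exact max_le (by linarith) h1
  · filter_upwards [hv0] with x h2
    refine tendsto_const_nhds.congr' ?_
    rcases h2.eq_or_lt with h | h
    · refine Eventually.of_forall fun j => ?_
      simp [← h, Real.zero_rpow (by linarith : 2 * m + 1 ≠ 0)]
    · filter_upwards [tendsto_posPart_sub_mul_eventually (a := u x) h] with j hj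
      rw [hj, mul_zero]

/-- A super-solution is positive almost everywhere where a nonnegative function of `WL` is. -/
theorem IsWeakSupersolution.ae_eq_zero_of_eq_zero [NeZero N] (hp : 1 < p)
    (hs : s ∈ Ioo (0 : ℝ) 1) (hΩ : IsOpen Ω) (hm : 0 ≤ m) (hlam : 0 < lam)
    {g₀ u v : EuclideanSpace ℝ (Fin N) → ℝ} (hg₀ : ∀ᵐ x ∂(volume.restrict Ω), 0 ≤ g₀ x)
    (hv : IsWeakSupersolution Ω p s m lam δ γ g₀ v) (hu : MemWL Ω p m u)
    (hu0 : ∀ᵐ x ∂(volume.restrict Ω), 0 ≤ u x) : ∀ᵐ x, v x = 0 → u x = 0 := by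
  have hun := hu.1.ae_nonneg hΩ hu0
  have hvn := hv.memWL.1.ae_nonneg hΩ hv.nonneg
  have hφ : ∀ j : ℕ, MemWL Ω p m fun x => max (u x - j * v x) 0 := fun j =>
    (isDirLipschitz_posPart_sub_mul j.cast_nonneg).memWL hp hu hv.memWL
  obtain ⟨r, hr, hrle⟩ := exists_localForm_posPart_le hp hΩ hu.1 hv.memWL.1 hv.nonneg
  have hZ := tendsto_integral_rpow_mul_posPart hm hu hv.memWL hu0 hv.nonneg
  set D : EuclideanSpace ℝ (Fin N) × EuclideanSpace ℝ (Fin N) → ℝ := fun z =>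
    |u z.1 - u z.2| ^ p / ‖z.1 - z.2‖ ^ ((N : ℝ) + s * p) +
      |v z.1 - v z.2| ^ p / ‖z.1 - z.2‖ ^ ((N : ℝ) + s * p) with hDdef
  have hD : Integrable D volume :=
    (hu.1.integrable_gagliardo hp hs).add (hv.memWL.1.integrable_gagliardo hp hs)
  have hD0 : ∀ z, 0 ≤ D z := fun z => by positivity
  set f : ℕ → EuclideanSpace ℝ (Fin N) × EuclideanSpace ℝ (Fin N) → ℝ := fun j z =>
    signedPow (p - 1) (v z.1 - v z.2) * (max (u z.1 - j * v z.1) 0 - max (u z.2 - j * v z.2) 0) /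
      ‖z.1 - z.2‖ ^ ((N : ℝ) + s * p) with hf
  have hfint : ∀ j, Integrable (f j) volume := fun j =>
    hv.memWL.1.integrable_nonlocalForm hp hs (hφ j).1
  have hfD : ∀ j z, f j z ≤ D z := by
    intro j z
    simp only [hf, hDdef]
    rw [← add_div]
    gcongr
    exact signedPow_mul_posPart_sub_le hp j.cast_nonneg _ _ _ _
  -- The pointwise limit of `(u - jv)⁺`. It need not be Sobolev, so the limit is taken in the
  -- integrands and `ψ` is never used as a test function.
  set ψ : EuclideanSpace ℝ (Fin N) → ℝ := fun x => if v x = 0 then u x else 0 with hψ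
  set f' : EuclideanSpace ℝ (Fin N) × EuclideanSpace ℝ (Fin N) → ℝ := fun z =>
    signedPow (p - 1) (v z.1 - v z.2) * (ψ z.1 - ψ z.2) / ‖z.1 - z.2‖ ^ ((N : ℝ) + s * p) with hf'
  have hgood : ∀ᵐ z : EuclideanSpace ℝ (Fin N) × EuclideanSpace ℝ (Fin N),
      (0 ≤ u z.1 ∧ 0 ≤ v z.1) ∧ (0 ≤ u z.2 ∧ 0 ≤ v z.2) := by
    rw [Measure.volume_eq_prod]
    exact (Measure.quasiMeasurePreserving_fst.ae (hun.and hvn)).and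
      (Measure.quasiMeasurePreserving_snd.ae (hun.and hvn))
  have hψlim : ∀ x, 0 ≤ u x → 0 ≤ v x →
      Tendsto (fun j : ℕ => max (u x - j * v x) 0) atTop (𝓝 (ψ x)) := by
    intro x h1 h2
    refine tendsto_const_nhds.congr' ?_
    rcases h2.eq_or_lt with h | h
    · refine Eventually.of_forall fun j => ?_
      simp [hψ, ← h, h1]
    · filter_upwards [tendsto_posPart_sub_mul_eventually (a := u x) h] with j hj
      rw [hj, hψ]
      simp [h.ne']
  -- The integrands have an upper bound `D` uniform in `j` but no such lower bound; cutting at `-D`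
  -- supplies one and only increases the integral.
  have hlim : Tendsto (fun j => ∫ z, max (f j z) (-D z)) atTop (𝓝 (∫ z, max (f' z) (-D z))) := by
    refine tendsto_integral_of_dominated_convergence D
      (fun j => (hfint j).1.sup hD.1.neg) hD (fun j => ae_of_all _ fun z => ?_) ?_
    · rw [Real.norm_eq_abs, abs_le]
      exact ⟨le_max_right _ _, max_le (hfD j z) (by linarith [hD0 z])⟩
    · filter_upwards [hgood] with z hz
      refine Tendsto.max ?_ tendsto_const_nhds
      exact (((hψlim _ hz.1.1 hz.1.2).sub (hψlim _ hz.2.1 hz.2.2)).const_mul _).div_const _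
  have hlow : ∀ j : ℕ, -((∫ x in Ω, v x ^ (2 * m + 1) * max (u x - j * v x) 0) / lam + r j) ≤
      ∫ z, max (f j z) (-D z) := by
    intro j
    have h1 := (weakRHS_nonneg (δ := δ) (γ := γ) hm hlam hg₀ hv.nonneg
      (φ := fun x => max (u x - j * v x) 0) fun _ => le_max_right _ _).trans
      (hv.weak_ge _ (hφ j) (ae_of_all _ fun _ => le_max_right _ _))
    have h2 : nonlocalForm s p v (fun x => max (u x - j * v x) 0) ≤ ∫ z, max (f j z) (-D z) :=
      integral_mono (hfint j) ((hfint j).sup hD.neg) fun _ => le_max_left _ _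
    have h3 := hrle j
    unfold weakLHS at h1
    set Z := ∫ x in Ω, v x ^ (2 * m + 1) * max (u x - j * v x) 0
    have h4 : 0 ≤ Z / lam + localForm Ω p v (fun x => max (u x - j * v x) 0) +
        nonlocalForm s p v (fun x => max (u x - j * v x) 0) := by
      have : lam * (Z / lam) = Z := mul_div_cancel₀ _ hlam.ne'
      refine nonneg_of_mul_nonneg_right ?_ hlam
      linarith
    linarith
  have h0 : 0 ≤ ∫ z, max (f' z) (-D z) := by
    refine le_of_tendsto_of_tendsto' ?_ hlim hlow
    simpa using ((hZ.div_const lam).add hr).neg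
  -- If `v` differs at the two points, `ψ` vanishes at the one where `v` is larger, so the factors
  -- have opposite signs. Together with `h0` this forces the cut integrand to vanish a.e.
  have hf'0 : ∀ᵐ z, f' z ≤ 0 := by
    filter_upwards [hgood] with z hz
    refine div_nonpos_of_nonpos_of_nonneg ?_ (by positivity)
    have hψ0 : ∀ x, 0 ≤ u x → 0 ≤ ψ x := fun x hx => by
      simp only [hψ]; split_ifs <;> simp [hx]
    rcases lt_trichotomy (v z.1) (v z.2) with h | h | h
    · have : ψ z.2 = 0 := if_neg (hz.1.2.trans_lt h).ne'
      rw [this, sub_zero]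
      exact mul_nonpos_of_nonpos_of_nonneg (signedPow_nonpos (by linarith)) (hψ0 _ hz.1.1)
    · rw [h, sub_self, signedPow_zero, zero_mul]
    · have : ψ z.1 = 0 := if_neg (hz.2.2.trans_lt h).ne'
      rw [this, zero_sub]
      exact mul_nonpos_of_nonneg_of_nonpos (signedPow_nonneg (by linarith))
        (by linarith [hψ0 _ hz.2.1])
  have hint : Integrable (fun z => max (f' z) (-D z)) volume := by
    refine hD.mono' ?_ ?_
    · refine aestronglyMeasurable_of_tendsto_ae atTop (f := fun (j : ℕ) z => max (f j z) (-D z))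
        (fun j => (hfint j).1.sup hD.1.neg) ?_
      filter_upwards [hgood] with z hz
      refine Tendsto.max ?_ tendsto_const_nhds
      exact (((hψlim _ hz.1.1 hz.1.2).sub (hψlim _ hz.2.1 hz.2.2)).const_mul _).div_const _
    · filter_upwards [hf'0] with z hz
      rw [Real.norm_eq_abs, abs_le]
      exact ⟨le_max_right _ _, max_le (hz.trans (hD0 z)) (by linarith [hD0 z])⟩
  have hzero : ∀ᵐ z, max (f' z) (-D z) = 0 := by
    have hneg : 0 ≤ᵐ[volume] fun z => -max (f' z) (-D z) := by
      filter_upwards [hf'0] with z hz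
      simp only [Pi.zero_apply]
      have := max_le hz (by linarith [hD0 z] : -D z ≤ 0)
      linarith
    have h1 : ∫ z, -max (f' z) (-D z) = 0 := by
      refine le_antisymm ?_ (integral_nonneg_of_ae hneg)
      rw [integral_neg]
      linarith
    filter_upwards [(integral_eq_zero_iff_of_nonneg_ae hneg hint.neg).1 h1] with z hz
    simpa using hz
  have hpair : ∀ᵐ z : EuclideanSpace ℝ (Fin N) × EuclideanSpace ℝ (Fin N),
      ¬(v z.1 = 0 ∧ 0 < u z.1 ∧ 0 < v z.2) := by
    filter_upwards [hzero] with z hz ⟨h1, h2, h3⟩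
    have hne : 0 < ‖z.1 - z.2‖ := by
      rw [norm_pos_iff, sub_ne_zero]
      intro h
      rw [h] at h1
      linarith
    have hK : 0 < ‖z.1 - z.2‖ ^ ((N : ℝ) + s * p) := Real.rpow_pos_of_pos hne _
    have hDpos : 0 < D z := by
      have h4 : 0 < |v z.1 - v z.2| ^ p :=
        Real.rpow_pos_of_pos (abs_pos.2 (by rw [h1]; linarith)) _
      have h5 : 0 ≤ |u z.1 - u z.2| ^ p := by positivity
      simp only [hDdef]
      positivity
    have hfneg : f' z < 0 := by
      have e1 : ψ z.1 = u z.1 := if_pos h1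
      have e2 : ψ z.2 = 0 := if_neg h3.ne'
      have e3 : signedPow (p - 1) (v z.1 - v z.2) < 0 := by
        rw [h1, zero_sub, signedPow_neg, signedPow_of_nonneg (by linarith) h3.le, neg_lt_zero]
        exact Real.rpow_pos_of_pos h3 _
      simp only [hf', e1, e2, sub_zero]
      exact div_neg_of_neg_of_pos (mul_neg_of_neg_of_pos e3 h2) hK
    exact absurd hz (max_lt hfneg (by linarith)).ne
  rw [Measure.volume_eq_prod] at hpair
  -- By Fubini, a point with `v = 0 < u` outside the null set would make `v` vanish a.e., against
  -- the nontriviality of `v`.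
  filter_upwards [Measure.ae_ae_of_ae_prod hpair, hun] with x hx hux hvx
  by_contra hne
  refine hv.not_ae_zero (ae_restrict_of_ae ?_)
  filter_upwards [hx, hvn] with y hy hvy
  by_contra hne'
  exact hy ⟨hvx, lt_of_le_of_ne hux (Ne.symm hne), lt_of_le_of_ne hvy (Ne.symm hne')⟩

end Positivity

/-! ### Lower bounds for the differences of the diffusion forms. -/

section FormComparison

variable {N : ℕ} {Ω : Set (EuclideanSpace ℝ (Fin N))} {p s m κ ε : ℝ}

/-- The constant of the Díaz–Saa lower bound, switched on for arguments `t ≥ κ`. -/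
noncomputable def cutConst (m κ t : ℝ) : ℝ := if κ ≤ t then 8 * m + 5 else 0

theorem measurable_cutConst : Measurable (cutConst m κ) :=
  Measurable.ite measurableSet_Ici measurable_const measurable_const

theorem cutConst_nonneg (hm : 0 ≤ m) (t : ℝ) : 0 ≤ cutConst m κ t := by
  unfold cutConst; split_ifs <;> linarith

theorem cutConst_le (hm : 0 ≤ m) (t : ℝ) : cutConst m κ t ≤ 8 * m + 5 := by
  unfold cutConst; split_ifs <;> linarith

theorem cutConst_eventually_eq_zero (t : ℝ) : ∀ᶠ j : ℕ in atTop, cutConst m (j : ℝ) t = 0 := by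
  filter_upwards [tendsto_natCast_atTop_atTop.eventually_gt_atTop t] with j hj
  exact if_neg (not_le.2 hj)

/-- With truncation level `κ + 1` and `ε ≤ 1`, values below `κ` remain below the truncation after
the shift and the exact inequality applies; otherwise the crude bound does. -/
theorem subTest_superTest_lower_bound (hm : 0 ≤ m) (hmp : m < p - 1) (hκ : 0 ≤ κ) (hε : 0 < ε)
    (hε1 : ε ≤ 1) {a b c d : ℝ} (ha : 0 ≤ a) (hb : 0 ≤ b) (hc : 0 ≤ c) (hd : 0 ≤ d) :
    -max (cutConst m κ a) (cutConst m κ b) * (|a - b| ^ p + |c - d| ^ p) ≤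
      signedPow (p - 1) (a - b) * (subTest m (κ + 1) ε a c - subTest m (κ + 1) ε b d) -
        signedPow (p - 1) (c - d) * (superTest m (κ + 1) ε a c - superTest m (κ + 1) ε b d) := by
  have e1 : a - b = (a + ε) - (b + ε) := by ring
  have e2 : c - d = (c + ε) - (d + ε) := by ring
  simp only [subTest, superTest, shiftPos_of_nonneg ha, shiftPos_of_nonneg hb,
    shiftPos_of_nonneg hc, shiftPos_of_nonneg hd]
  rw [e1, e2]
  by_cases h : κ ≤ a ∨ κ ≤ b
  · have hmax : max (cutConst m κ a) (cutConst m κ b) = 8 * m + 5 := by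
      refine le_antisymm (max_le (cutConst_le hm a) (cutConst_le hm b)) ?_
      rcases h with h | h
      · exact (le_of_eq (if_pos h).symm).trans (le_max_left _ _)
      · exact (le_of_eq (if_pos h).symm).trans (le_max_right _ _)
    rw [hmax]
    exact discrete_diazSaa_lower_bound hm hmp (by linarith) (by linarith) (by linarith)
      (by linarith) (by linarith)
  · rw [not_or, not_le, not_le] at h
    have hmax : max (cutConst m κ a) (cutConst m κ b) = 0 := by
      rw [cutConst, cutConst, if_neg (not_le.2 h.1), if_neg (not_le.2 h.2), max_self]
    rw [hmax, neg_zero, zero_mul]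
    exact discrete_diazSaa hm hmp (by linarith) (by linarith) (by linarith) (by linarith)
      (by linarith) (by linarith)

/-- The error of the local forms. -/
noncomputable def localError (Ω : Set (EuclideanSpace ℝ (Fin N))) (p m : ℝ)
    (u v : EuclideanSpace ℝ (Fin N) → ℝ) (κ : ℝ) : ℝ :=
  ∫ x in Ω, cutConst m κ (u x) * (‖weakGradient u x‖ ^ p + ‖weakGradient v x‖ ^ p)

/-- The error of the nonlocal forms. -/
noncomputable def nonlocalError (s p m : ℝ) (u v : EuclideanSpace ℝ (Fin N) → ℝ) (κ : ℝ) : ℝ :=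
  ∫ z : EuclideanSpace ℝ (Fin N) × EuclideanSpace ℝ (Fin N),
    max (cutConst m κ (u z.1)) (cutConst m κ (u z.2)) *
      (|u z.1 - u z.2| ^ p / ‖z.1 - z.2‖ ^ ((N : ℝ) + s * p) +
        |v z.1 - v z.2| ^ p / ‖z.1 - z.2‖ ^ ((N : ℝ) + s * p))

theorem integrable_cut_mul {α : Type*} [MeasurableSpace α] {μ : Measure α} {c D : α → ℝ} {C : ℝ}
    (hc : AEStronglyMeasurable c μ) (h0 : ∀ x, 0 ≤ c x) (hC : ∀ x, c x ≤ C) (hD : Integrable D μ) :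
    Integrable (fun x => c x * D x) μ :=
  hD.bdd_mul (c := C) hc (ae_of_all _ fun x => by rw [Real.norm_of_nonneg (h0 x)]; exact hC x)

theorem aestronglyMeasurable_cutConst {α : Type*} [MeasurableSpace α] {μ : Measure α} {u : α → ℝ}
    (hu : AEStronglyMeasurable u μ) : AEStronglyMeasurable (fun x => cutConst m κ (u x)) μ :=
  (measurable_cutConst.comp_aemeasurable hu.aemeasurable).aestronglyMeasurable

theorem tendsto_integral_cut_mul {α : Type*} [MeasurableSpace α] {μ : Measure α}
    {c : ℕ → α → ℝ} {D : α → ℝ} {C : ℝ} (hc : ∀ j, AEStronglyMeasurable (c j) μ)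
    (h0 : ∀ j x, 0 ≤ c j x) (hC : ∀ j x, c j x ≤ C) (hD : Integrable D μ)
    (hlim : ∀ x, ∀ᶠ j in atTop, c j x = 0) :
    Tendsto (fun j => ∫ x, c j x * D x ∂μ) atTop (𝓝 0) := by
  have := tendsto_integral_of_dominated_convergence (μ := μ) (F := fun j x => c j x * D x)
    (f := fun _ => 0) (fun x => C * |D x|) (fun j => (hc j).mul hD.1) (hD.abs.const_mul C)
    (fun j => ae_of_all _ fun x => ?_) (ae_of_all _ fun x => ?_)
  · simpa using this
  · rw [norm_mul, Real.norm_of_nonneg (h0 j x), Real.norm_eq_abs]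
    exact mul_le_mul_of_nonneg_right (hC j x) (abs_nonneg _)
  · refine tendsto_const_nhds.congr' ?_
    filter_upwards [hlim x] with j hj
    rw [hj, zero_mul]

theorem tendsto_localError (hp : 1 < p) (hm : 0 ≤ m) {u v : EuclideanSpace ℝ (Fin N) → ℝ}
    (hu : MemW0 Ω p u) (hv : MemW0 Ω p v) :
    Tendsto (fun j : ℕ => localError Ω p m u v j) atTop (𝓝 0) :=
  tendsto_integral_cut_mul (c := fun (j : ℕ) x => cutConst m j (u x))
    (fun _ => aestronglyMeasurable_cutConst hu.memLp.1.restrict)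
    (fun _ _ => cutConst_nonneg hm _) (fun _ _ => cutConst_le hm _)
    ((hu.integrable_norm_weakGradient_rpow hp).add
      (hv.integrable_norm_weakGradient_rpow hp)).integrableOn
    (fun _ => cutConst_eventually_eq_zero _)

theorem tendsto_nonlocalError [NeZero N] (hp : 1 < p) (hs : s ∈ Ioo (0 : ℝ) 1) (hm : 0 ≤ m)
    {u v : EuclideanSpace ℝ (Fin N) → ℝ} (hu : MemW0 Ω p u) (hv : MemW0 Ω p v) :
    Tendsto (fun j : ℕ => nonlocalError s p m u v j) atTop (𝓝 0) :=
  tendsto_integral_cut_mul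
    (c := fun (j : ℕ) (z : EuclideanSpace ℝ (Fin N) × EuclideanSpace ℝ (Fin N)) =>
      max (cutConst m j (u z.1)) (cutConst m j (u z.2)))
    (fun _ => (aestronglyMeasurable_cutConst hu.memLp.1.comp_fst).sup
      (aestronglyMeasurable_cutConst hu.memLp.1.comp_snd))
    (fun _ _ => (cutConst_nonneg hm _).trans (le_max_left _ _))
    (fun _ _ => max_le (cutConst_le hm _) (cutConst_le hm _))
    ((hu.integrable_gagliardo hp hs).add (hv.integrable_gagliardo hp hs))
    (fun z => by
      filter_upwards [cutConst_eventually_eq_zero (m := m) (u z.1),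
        cutConst_eventually_eq_zero (m := m) (u z.2)] with j h1 h2
      rw [h1, h2, max_self])

theorem localForm_sub_lower_bound [NeZero N] (hp : 1 < p) (hm : 0 ≤ m) (hmp : m < p - 1)
    (hκ : 0 ≤ κ) (hε : 0 < ε) (hε1 : ε ≤ 1) {u v : EuclideanSpace ℝ (Fin N) → ℝ}
    (hu : MemW0 Ω p u) (hv : MemW0 Ω p v) (hu0 : ∀ᵐ x, 0 ≤ u x) (hv0 : ∀ᵐ x, 0 ≤ v x) :
    -localError Ω p m u v κ ≤
      localForm Ω p u (fun x => subTest m (κ + 1) ε (u x) (v x)) -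
        localForm Ω p v (fun x => superTest m (κ + 1) ε (u x) (v x)) := by
  have hk : 0 < κ + 1 := by linarith
  have hΦ := (isDirLipschitz_subTest hm hk hε).memW0 hp hu hv
  have hΨ := (isDirLipschitz_superTest hm hk hε).memW0 hp hu hv
  have hD := ((hu.integrable_norm_weakGradient_rpow hp).add
    (hv.integrable_norm_weakGradient_rpow hp)).integrableOn (s := Ω)
  unfold localError localForm
  rw [← integral_sub (hu.integrable_localForm hp hΦ).integrableOn
    (hv.integrable_localForm hp hΨ).integrableOn, ← integral_neg]
  refine integral_mono_ae (integrable_cut_mul (aestronglyMeasurable_cutConst hu.memLp.1.restrict)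
    (fun _ => cutConst_nonneg hm _) (fun _ => cutConst_le hm _) hD).neg
    ((hu.integrable_localForm hp hΦ).integrableOn.sub
      (hv.integrable_localForm hp hΨ).integrableOn) (ae_restrict_of_ae ?_)
  have key := hu.ae_form_lower_bound (M := fun x => cutConst m κ (u x))
    (good := fun x => 0 ≤ u x ∧ 0 ≤ v x) hp hv hΦ hΨ (hu0.and hv0) ?_
  · filter_upwards [key] with x hx
    rw [← neg_mul]
    exact hx
  intro x hx
  by_cases h : κ ≤ u x
  · refine ⟨1, one_pos, fun y hy _ => ?_⟩
    have := subTest_superTest_lower_bound hm hmp hκ hε hε1 hy.1 hx.1 hy.2 hx.2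
    have h2 : cutConst m κ (u x) = 8 * m + 5 := if_pos h
    rwa [max_eq_right (h2 ▸ cutConst_le hm _)] at this
  · rw [not_le] at h
    -- Nearby values of `u` stay below `κ`, so the constant at `x` alone, here 0, governs the
    -- increment.
    refine ⟨κ - u x, by linarith, fun y hy hxy => ?_⟩
    have := subTest_superTest_lower_bound hm hmp hκ hε hε1 hy.1 hx.1 hy.2 hx.2
    have h1 : u y < κ := by linarith [(abs_lt.1 hxy).2]
    have h2 : cutConst m κ (u y) = 0 := if_neg (not_le.2 h1)
    rwa [h2, max_eq_right (cutConst_nonneg hm _)] at this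

theorem nonlocalForm_sub_lower_bound [NeZero N] (hp : 1 < p) (hs : s ∈ Ioo (0 : ℝ) 1)
    (hm : 0 ≤ m) (hmp : m < p - 1) (hκ : 0 ≤ κ) (hε : 0 < ε) (hε1 : ε ≤ 1)
    {u v : EuclideanSpace ℝ (Fin N) → ℝ} (hu : MemW0 Ω p u) (hv : MemW0 Ω p v)
    (hu0 : ∀ᵐ x, 0 ≤ u x) (hv0 : ∀ᵐ x, 0 ≤ v x) :
    -nonlocalError s p m u v κ ≤
      nonlocalForm s p u (fun x => subTest m (κ + 1) ε (u x) (v x)) -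
        nonlocalForm s p v (fun x => superTest m (κ + 1) ε (u x) (v x)) := by
  have hk : 0 < κ + 1 := by linarith
  have hΦ := (isDirLipschitz_subTest hm hk hε).memW0 hp hu hv
  have hΨ := (isDirLipschitz_superTest hm hk hε).memW0 hp hu hv
  have hD := (hu.integrable_gagliardo hp hs).add (hv.integrable_gagliardo hp hs)
  have hgood : ∀ᵐ z : EuclideanSpace ℝ (Fin N) × EuclideanSpace ℝ (Fin N),
      (0 ≤ u z.1 ∧ 0 ≤ v z.1) ∧ (0 ≤ u z.2 ∧ 0 ≤ v z.2) := by
    rw [Measure.volume_eq_prod]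
    exact (Measure.quasiMeasurePreserving_fst.ae (hu0.and hv0)).and
      (Measure.quasiMeasurePreserving_snd.ae (hu0.and hv0))
  unfold nonlocalError nonlocalForm
  rw [← integral_sub (hu.integrable_nonlocalForm hp hs hΦ) (hv.integrable_nonlocalForm hp hs hΨ),
    ← integral_neg]
  refine integral_mono_ae (integrable_cut_mul
    ((aestronglyMeasurable_cutConst hu.memLp.1.comp_fst).sup
      (aestronglyMeasurable_cutConst hu.memLp.1.comp_snd))
    (fun _ => (cutConst_nonneg hm _).trans (le_max_left _ _))
    (fun _ => max_le (cutConst_le hm _) (cutConst_le hm _)) hD).neg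
    ((hu.integrable_nonlocalForm hp hs hΦ).sub (hv.integrable_nonlocalForm hp hs hΨ)) ?_
  filter_upwards [hgood] with z hz
  have := subTest_superTest_lower_bound hm hmp hκ hε hε1 hz.1.1 hz.2.1 hz.1.2 hz.2.2
  simp only [← add_div, ← sub_div, ← mul_div_assoc]
  rw [← neg_div, ← neg_mul]
  gcongr

end FormComparison

/-! ### Bounds and limits of the absorption and reaction terms. -/

section ReactionTerms

variable {m k ε δ : ℝ}

theorem truncDiff_pos_imp_lt (hm : 0 ≤ m) (hk : 0 < k) {a c : ℝ} (ha : 0 ≤ a)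
    (h : 0 < truncDiff m k a c) : c < min a k := by
  by_contra hc
  exact h.ne' (truncDiff_eq_zero_of_le hm hk ha (not_lt.1 hc))

theorem subTest_nonneg (hε : 0 < ε) (a c : ℝ) : 0 ≤ subTest m k ε a c :=
  div_nonneg (truncDiff_nonneg _ _ _ _) (Real.rpow_nonneg (shiftPos_pos hε a).le _)

theorem superTest_nonneg (hε : 0 < ε) (a c : ℝ) : 0 ≤ superTest m k ε a c :=
  div_nonneg (truncDiff_nonneg _ _ _ _) (Real.rpow_nonneg (shiftPos_pos hε c).le _)

/-- Because `r ≤ m`, replacing `U^(r-m)` by `min(U, k)^(r-m)` only increases the product. The bound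
is free of `ε` and dominates the reaction term of the sub-solution. -/
theorem rpow_mul_subTest_le (hk : 0 < k) (hε : 0 < ε) {r a : ℝ} (hr : 0 ≤ r)
    (hrm : r ≤ m) (ha : 0 ≤ a) (c : ℝ) : a ^ r * subTest m k ε a c ≤ k ^ (r + 1) := by
  rw [subTest, shiftPos_of_nonneg ha]
  have hU : 0 < a + ε := by linarith
  have hT : 0 < min (a + ε) k := lt_min hU hk
  have h1 := truncDiff_le (m := m) hk hU.le (shiftPos_pos hε c).le
  calc a ^ r * (truncDiff m k (a + ε) (shiftPos ε c) / (a + ε) ^ m)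
      ≤ (a + ε) ^ r * ((min (a + ε) k) ^ (m + 1) / (a + ε) ^ m) := by
        gcongr
        · exact div_nonneg (truncDiff_nonneg _ _ _ _) (by positivity)
        · linarith
    _ = (min (a + ε) k) ^ (m + 1) * (a + ε) ^ (r - m) := by
        rw [Real.rpow_sub hU]; ring
    _ ≤ (min (a + ε) k) ^ (m + 1) * (min (a + ε) k) ^ (r - m) := by
        refine mul_le_mul_of_nonneg_left ?_ (by positivity)
        exact Real.rpow_le_rpow_of_nonpos hT (min_le_left _ _) (by linarith)
    _ = (min (a + ε) k) ^ (r + 1) := by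
        rw [← Real.rpow_add hT]; ring_nf
    _ ≤ k ^ (r + 1) := by gcongr; exact min_le_right _ _

/-- Depends on `ε`; it serves for integrability at fixed `ε`. Where the test function is nonzero, `c
≤ k`. -/
theorem rpow_mul_superTest_le (hm : 0 ≤ m) (hk : 0 < k) (hε : 0 < ε) {r a c : ℝ} (hr : 0 ≤ r)
    (hc : 0 ≤ c) : c ^ r * superTest m k ε a c ≤ k ^ r * (k ^ (m + 1) / ε ^ m) := by
  rw [superTest]
  have hU := shiftPos_pos hε a
  have hV := shiftPos_pos hε c
  rcases (truncDiff_nonneg m k (shiftPos ε a) (shiftPos ε c)).eq_or_lt with h | h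
  · rw [← h, zero_div, mul_zero]
    positivity
  · have h2 := (truncDiff_pos_imp_lt hm hk hU.le h).trans_le (min_le_right _ _)
    have h3 : truncDiff m k (shiftPos ε a) (shiftPos ε c) ≤ k ^ (m + 1) :=
      (truncDiff_le hk hU.le hV.le).trans (by gcongr; exact min_le_right _ _)
    have h4 : c ≤ k := by
      rw [shiftPos_of_nonneg hc] at h2
      linarith
    have h5 := le_shiftPos ε c
    gcongr

theorem tendsto_shiftPos {a : ℝ} (ha : 0 ≤ a) :
    Tendsto (fun n => shiftPos (unitStep n) a) atTop (𝓝 a) := by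
  have h := tendsto_unitStep.mono_right nhdsWithin_le_nhds
  simpa [shiftPos, max_eq_left ha] using h.const_add a

theorem tendsto_truncDiff (hm : 0 ≤ m) {a c : ℝ} (ha : 0 ≤ a) (hc : 0 ≤ c) :
    Tendsto (fun n => truncDiff m k (shiftPos (unitStep n) a) (shiftPos (unitStep n) c)) atTop
      (𝓝 (truncDiff m k a c)) := by
  have h1 : (0 : ℝ) ≤ m + 1 := by linarith
  exact ((((tendsto_shiftPos ha).min tendsto_const_nhds).rpow_const (Or.inr h1)).sub
    ((tendsto_shiftPos hc).rpow_const (Or.inr h1))).max tendsto_const_nhds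

theorem tendsto_subTest (hm : 0 ≤ m) {a c : ℝ} (ha : 0 < a) (hc : 0 ≤ c) :
    Tendsto (fun n => subTest m k (unitStep n) a c) atTop (𝓝 (truncDiff m k a c / a ^ m)) :=
  (tendsto_truncDiff hm ha.le hc).div ((tendsto_shiftPos ha.le).rpow_const (Or.inr hm))
    (Real.rpow_pos_of_pos ha m).ne'

theorem tendsto_superTest (hm : 0 ≤ m) {a c : ℝ} (ha : 0 ≤ a) (hc : 0 < c) :
    Tendsto (fun n => superTest m k (unitStep n) a c) atTop (𝓝 (truncDiff m k a c / c ^ m)) :=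
  (tendsto_truncDiff hm ha hc.le).div ((tendsto_shiftPos hc.le).rpow_const (Or.inr hm))
    (Real.rpow_pos_of_pos hc m).ne'

theorem truncDiff_shiftPos_eq_zero (hm : 0 ≤ m) (hk : 0 < k) (hε : 0 < ε) {c : ℝ} :
    truncDiff m k (shiftPos ε 0) (shiftPos ε c) = 0 := by
  refine truncDiff_eq_zero_of_le hm hk (shiftPos_pos hε 0).le ((min_le_left _ _).trans ?_)
  rw [shiftPos_of_nonneg le_rfl, zero_add]
  exact le_shiftPos ε c

/-- The function `t^(2m+1) / (t + ε)^m = t^(m+1) (t / (t + ε))^m` is increasing, and the test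
functions vanish unless `c < a`. -/
theorem absorption_diff_nonneg (hm : 0 ≤ m) (hk : 0 < k) (hε : 0 < ε) {a c : ℝ} (ha : 0 ≤ a)
    (hc : 0 ≤ c) :
    0 ≤ a ^ (2 * m + 1) * subTest m k ε a c - c ^ (2 * m + 1) * superTest m k ε a c := by
  rw [subTest, superTest]
  rcases (truncDiff_nonneg m k (shiftPos ε a) (shiftPos ε c)).eq_or_lt with h | h
  · simp [← h]
  have h2 := (truncDiff_pos_imp_lt hm hk (shiftPos_pos hε a).le h).trans_le (min_le_left _ _)
  rw [shiftPos_of_nonneg ha, shiftPos_of_nonneg hc] at h2 h ⊢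
  have hca : c ≤ a := by linarith
  have hU : 0 < a + ε := by linarith
  have hV : 0 < c + ε := by linarith
  have e : ∀ t : ℝ, 0 ≤ t →
      t ^ (2 * m + 1) / (t + ε) ^ m = t ^ (m + 1) * (t / (t + ε)) ^ m := by
    intro t ht
    rw [Real.div_rpow ht (by linarith), show 2 * m + 1 = (m + 1) + m by ring,
      Real.rpow_add_of_nonneg ht (by linarith) hm, mul_div_assoc]
  have h3 : c ^ (2 * m + 1) / (c + ε) ^ m ≤ a ^ (2 * m + 1) / (a + ε) ^ m := by
    rw [e c hc, e a ha]
    have : c / (c + ε) ≤ a / (a + ε) := by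
      rw [div_le_div_iff₀ hV hU]
      nlinarith
    gcongr
  have h4 := mul_le_mul_of_nonneg_right h3 h.le
  calc (0 : ℝ) ≤ _ := sub_nonneg.2 h4
    _ = _ := by ring

theorem tendsto_absorption_diff (hm : 0 ≤ m) (hk : 0 < k) {a c : ℝ} (ha : 0 ≤ a) (hc : 0 ≤ c)
    (hca : c = 0 → a = 0) :
    Tendsto (fun n => a ^ (2 * m + 1) * subTest m k (unitStep n) a c -
      c ^ (2 * m + 1) * superTest m k (unitStep n) a c) atTop
      (𝓝 ((a ^ (m + 1) - c ^ (m + 1)) * truncDiff m k a c)) := by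
  rcases ha.eq_or_lt with rfl | ha'
  · have h0 : truncDiff m k 0 c = 0 :=
      truncDiff_eq_zero_of_le hm hk le_rfl ((min_le_left _ _).trans hc)
    rw [h0, mul_zero]
    refine tendsto_const_nhds.congr fun n => ?_
    simp [subTest, superTest, truncDiff_shiftPos_eq_zero hm hk (unitStep_pos n)]
  · have hc' : 0 < c := lt_of_le_of_ne hc fun h => ha'.ne' (hca h.symm)
    have h := ((tendsto_subTest (k := k) hm ha' hc).const_mul (a ^ (2 * m + 1))).sub
      ((tendsto_superTest (k := k) hm ha hc').const_mul (c ^ (2 * m + 1)))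
    have e : ∀ t S : ℝ, 0 < t → t ^ (2 * m + 1) * (S / t ^ m) = t ^ (m + 1) * S := by
      intro t S ht
      have := (Real.rpow_pos_of_pos ht m).ne'
      rw [show 2 * m + 1 = (m + 1) + m by ring, Real.rpow_add ht]
      field_simp
    rwa [e a _ ha', e c _ hc', ← sub_mul] at h

/-- In the limit the `g` terms cancel and `b (a^(δ-m) - c^(δ-m))` times the truncated difference
remains, which is nonpositive where `c < a`. For `m > 0`, if `c = 0 < a` were allowed, the term `g
c^m` would vanish before the limit and nothing would cancel `g`. -/
theorem tendsto_reaction_diff_max (hm : 0 ≤ m) (hk : 0 < k) {a c g b : ℝ} (ha : 0 ≤ a)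
    (hc : 0 ≤ c) (hca : c = 0 → a = 0) (hb : 0 ≤ b) (hδ : b = 0 ∨ δ ≤ m) :
    Tendsto (fun n => max ((g * a ^ m + b * a ^ δ) * subTest m k (unitStep n) a c -
      (g * c ^ m + b * c ^ δ) * superTest m k (unitStep n) a c) 0) atTop (𝓝 0) := by
  rcases ha.eq_or_lt with rfl | ha'
  · refine tendsto_const_nhds.congr fun n => ?_
    simp [subTest, superTest, truncDiff_shiftPos_eq_zero hm hk (unitStep_pos n)]
  have hc' : 0 < c := lt_of_le_of_ne hc fun h => ha'.ne' (hca h.symm)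
  have h := (((tendsto_subTest (k := k) hm ha' hc).const_mul (g * a ^ m + b * a ^ δ)).sub
    ((tendsto_superTest (k := k) hm ha hc').const_mul (g * c ^ m + b * c ^ δ))).max
      (tendsto_const_nhds (x := (0 : ℝ)))
  convert h using 2
  refine (max_eq_right ?_).symm
  have e : ∀ t S : ℝ, 0 < t → (g * t ^ m + b * t ^ δ) * (S / t ^ m) =
      g * S + b * t ^ (δ - m) * S := by
    intro t S ht
    have := (Real.rpow_pos_of_pos ht m).ne'
    rw [Real.rpow_sub ht]
    field_simp
  rw [e a _ ha', e c _ hc', add_sub_add_left_eq_sub, sub_nonpos]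
  rcases (truncDiff_nonneg m k a c).eq_or_lt with h0 | h0
  · simp [← h0]
  have hlt := (truncDiff_pos_imp_lt hm hk ha h0).trans_le (min_le_left _ _)
  rcases hδ with rfl | hδ
  · simp
  · have : a ^ (δ - m) ≤ c ^ (δ - m) :=
      Real.rpow_le_rpow_of_nonpos hc' hlt.le (by linarith)
    gcongr

end ReactionTerms

/-! ### Conclusion: the limits `ε → 0` and `κ → ∞`. -/

section Comparison

variable {N : ℕ} {Ω : Set (EuclideanSpace ℝ (Fin N))} {p s m lam δ γ k ε : ℝ}

theorem integrable_reaction_mul {α : Type*} [MeasurableSpace α] {μ : Measure α}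
    {g b u φ : α → ℝ} {C C' : ℝ} (hg : Integrable g μ) (hb : Integrable b μ)
    (hu : AEStronglyMeasurable u μ) (hφ : AEStronglyMeasurable φ μ)
    (h1 : ∀ᵐ x ∂μ, ‖u x ^ m * φ x‖ ≤ C) (h2 : (∀ x, b x = 0) ∨ ∀ᵐ x ∂μ, ‖u x ^ δ * φ x‖ ≤ C') :
    Integrable (fun x => (g x * u x ^ m + b x * u x ^ δ) * φ x) μ := by
  have hm1 : ∀ r : ℝ, AEStronglyMeasurable (fun x => u x ^ r * φ x) μ := fun r =>
    (hu.aemeasurable.pow_const r).aestronglyMeasurable.mul hφ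
  have i1 : Integrable (fun x => g x * (u x ^ m * φ x)) μ := hg.mul_bdd (c := C) (hm1 m) h1
  have i2 : Integrable (fun x => b x * (u x ^ δ * φ x)) μ := by
    rcases h2 with h2 | h2
    · simp only [h2, zero_mul]
      exact integrable_zero _ _ _
    · exact hb.mul_bdd (c := C') (hm1 δ) h2
  refine (i1.add i2).congr (ae_of_all _ fun x => ?_)
  simp only [Pi.add_apply]
  ring

/-- The comparison inequality at a fixed truncation level. -/
theorem integral_min_truncDiff_le [NeZero N] (hΩ : IsSmoothBoundedDomain Ω) (hp : 1 < p)
    (hs : s ∈ Ioo (0 : ℝ) 1) (hm : 0 ≤ m) (hmp : m < p - 1) (hlam : 0 < lam)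
    (hδ : 0 < m → δ ∈ Ioo 0 m) (hγ : γ < 1) {g₀ u v : EuclideanSpace ℝ (Fin N) → ℝ}
    (hg₀ : IntegrableOn g₀ Ω volume) (hg₀_nonneg : ∀ᵐ x ∂(volume.restrict Ω), 0 ≤ g₀ x)
    (hu : IsWeakSubsolution Ω p s m lam δ γ g₀ u)
    (hv : IsWeakSupersolution Ω p s m lam δ γ g₀ v) {κ : ℝ} (hκ : 0 ≤ κ) :
    ∫ x in Ω, min ((u x ^ (m + 1) - v x ^ (m + 1)) * truncDiff m (κ + 1) (u x) (v x)) 1 ≤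
      lam * (localError Ω p m u v κ + nonlocalError s p m u v κ) := by
  have hk : 0 < κ + 1 := by linarith
  have : IsFiniteMeasure (volume.restrict Ω) :=
    isFiniteMeasure_restrict.2 hΩ.isBounded.measure_lt_top.ne
  have hun := hu.memWL.1.ae_nonneg hΩ.isOpen hu.nonneg
  have hvn := hv.memWL.1.ae_nonneg hΩ.isOpen hv.nonneg
  have huv := ae_restrict_of_ae (s := Ω) (hv.ae_eq_zero_of_eq_zero hp hs hΩ.isOpen hm hlam
    hg₀_nonneg hu.memWL hu.nonneg)
  have hum := hu.memWL.2.1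
  have hvm := hv.memWL.2.1
  set b : EuclideanSpace ℝ (Fin N) → ℝ := fun x => lam * m * bdryDist Ω x ^ (-γ) with hbdef
  have hb : IntegrableOn b Ω volume := (hΩ.integrableOn_bdryDist_rpow hγ).const_mul _
  have hb0 : ∀ x, 0 ≤ b x := fun x =>
    mul_nonneg (by positivity) (Real.rpow_nonneg (bdryDist_nonneg Ω x) _)
  have hbδ : (∀ x, b x = 0) ∨ δ ∈ Ioo 0 m := by
    rcases hm.eq_or_lt with h | h
    · exact Or.inl fun x => by simp [hbdef, ← h]
    · exact Or.inr (hδ h)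
  set Φ : ℕ → EuclideanSpace ℝ (Fin N) → ℝ := fun n x =>
    subTest m (κ + 1) (unitStep n) (u x) (v x) with hΦdef
  set Ψ : ℕ → EuclideanSpace ℝ (Fin N) → ℝ := fun n x =>
    superTest m (κ + 1) (unitStep n) (u x) (v x) with hΨdef
  have hΦ : ∀ n, MemWL Ω p m (Φ n) := fun n =>
    (isDirLipschitz_subTest hm hk (unitStep_pos n)).memWL hp hu.memWL hv.memWL
  have hΨ : ∀ n, MemWL Ω p m (Ψ n) := fun n =>
    (isDirLipschitz_superTest hm hk (unitStep_pos n)).memWL hp hu.memWL hv.memWL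
  have hΦ0 : ∀ n x, 0 ≤ Φ n x := fun n x => subTest_nonneg (unitStep_pos n) _ _
  have hΨ0 : ∀ n x, 0 ≤ Ψ n x := fun n x => superTest_nonneg (unitStep_pos n) _ _
  have hΦle : ∀ (n : ℕ) (r : ℝ), 0 ≤ r → r ≤ m → ∀ᵐ x ∂(volume.restrict Ω),
      ‖u x ^ r * Φ n x‖ ≤ (κ + 1) ^ (r + 1) := by
    intro n r hr hrm
    filter_upwards [hu.nonneg] with x hx
    rw [Real.norm_of_nonneg (mul_nonneg (Real.rpow_nonneg hx _) (hΦ0 n x))]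
    exact rpow_mul_subTest_le hk (unitStep_pos n) hr hrm hx _
  have hΨle : ∀ (n : ℕ) (r : ℝ), 0 ≤ r → ∀ᵐ x ∂(volume.restrict Ω),
      ‖v x ^ r * Ψ n x‖ ≤ (κ + 1) ^ r * ((κ + 1) ^ (m + 1) / unitStep n ^ m) := by
    intro n r hr
    filter_upwards [hv.nonneg] with x hx
    rw [Real.norm_of_nonneg (mul_nonneg (Real.rpow_nonneg hx _) (hΨ0 n x))]
    exact rpow_mul_superTest_le hm hk (unitStep_pos n) hr hx
  have iu : ∀ n, IntegrableOn (fun x => (g₀ x * u x ^ m + b x * u x ^ δ) * Φ n x) Ω volume :=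
    fun n => integrable_reaction_mul hg₀ hb hum (hΦ n).2.1 (hΦle n m hm le_rfl)
      (hbδ.imp_right fun h => hΦle n δ h.1.le h.2.le)
  have iv : ∀ n, IntegrableOn (fun x => (g₀ x * v x ^ m + b x * v x ^ δ) * Ψ n x) Ω volume :=
    fun n => integrable_reaction_mul hg₀ hb hvm (hΨ n).2.1 (hΨle n m hm)
      (hbδ.imp_right fun h => hΨle n δ h.1.le)
  have ju : ∀ n, IntegrableOn (fun x => u x ^ (2 * m + 1) * Φ n x) Ω volume := fun n =>
    (hΦ n).integrableOn_rpow_mul hm hu.memWL hu.nonneg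
  have jv : ∀ n, IntegrableOn (fun x => v x ^ (2 * m + 1) * Ψ n x) Ω volume := fun n =>
    (hΨ n).integrableOn_rpow_mul hm hv.memWL hv.nonneg
  -- Cutting the left integrand at 1 and the right one at 0 only weakens the subtracted inequality,
  -- and gives what dominated convergence needs on each side.
  have step : ∀ n, ∫ x in Ω, min (u x ^ (2 * m + 1) * Φ n x - v x ^ (2 * m + 1) * Ψ n x) 1 ≤
      (∫ x in Ω, max ((g₀ x * u x ^ m + b x * u x ^ δ) * Φ n x -
        (g₀ x * v x ^ m + b x * v x ^ δ) * Ψ n x) 0) +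
      lam * (localError Ω p m u v κ + nonlocalError s p m u v κ) := by
    intro n
    have hn1 : unitStep n ≤ 1 := by
      unfold unitStep
      rw [div_le_one (by positivity)]
      linarith [n.cast_nonneg (α := ℝ)]
    have h1 := hu.weak_le (Φ n) (hΦ n) (ae_of_all _ (hΦ0 n))
    have h2 := hv.weak_ge (Ψ n) (hΨ n) (ae_of_all _ (hΨ0 n))
    have h3 := localForm_sub_lower_bound hp hm hmp hκ (unitStep_pos n) hn1 hu.memWL.1 hv.memWL.1
      hun hvn
    have h4 := nonlocalForm_sub_lower_bound hp hs hm hmp hκ (unitStep_pos n) hn1 hu.memWL.1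
      hv.memWL.1 hun hvn
    have h5 := integral_mono (((ju n).sub (jv n)).inf (integrable_const 1)) ((ju n).sub (jv n))
      fun x => min_le_left _ _
    have h6 := integral_le_integral_max_zero ((iu n).sub (iv n))
    simp only [Pi.sub_apply] at h5 h6
    rw [integral_sub (ju n) (jv n)] at h5
    rw [integral_sub (iu n) (iv n)] at h6
    unfold weakLHS weakRHS at h1 h2
    have h7 := mul_le_mul_of_nonneg_left (add_le_add h3 h4) hlam.le
    refine h5.trans ?_
    simp only [hbdef] at h6 ⊢
    linarith
  have lR : Tendsto (fun n => ∫ x in Ω, max ((g₀ x * u x ^ m + b x * u x ^ δ) * Φ n x -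
        (g₀ x * v x ^ m + b x * v x ^ δ) * Ψ n x) 0) atTop (𝓝 0) := by
    -- The majorant comes from the sub-solution part alone, the other part being nonnegative and
    -- subtracted.
    refine tendsto_integral_max_zero (D := fun x => g₀ x * (κ + 1) ^ (m + 1) +
      b x * (κ + 1) ^ (δ + 1)) (fun n => ((iu n).sub (iv n)).1)
      ((hg₀.mul_const _).add (hb.mul_const _)) (fun n => ?_) ?_
    · have hδle : ∀ᵐ x ∂(volume.restrict Ω), b x * (u x ^ δ * Φ n x) ≤ b x * (κ + 1) ^ (δ + 1) := by
        rcases hbδ with h | h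
        · exact ae_of_all _ fun x => by simp [h x]
        · filter_upwards [hΦle n δ h.1.le h.2.le] with x hx
          exact mul_le_mul_of_nonneg_left ((le_abs_self _).trans hx) (hb0 x)
      filter_upwards [hΦle n m hm le_rfl, hδle, hg₀_nonneg, hv.nonneg] with x h1 h2 h3 h4
      have h5 := mul_le_mul_of_nonneg_left ((le_abs_self _).trans h1) h3
      have h6 : 0 ≤ (g₀ x * v x ^ m + b x * v x ^ δ) * Ψ n x :=
        mul_nonneg (add_nonneg (mul_nonneg h3 (Real.rpow_nonneg h4 _))
          (mul_nonneg (hb0 x) (Real.rpow_nonneg h4 _))) (hΨ0 n x)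
      calc _ ≤ (g₀ x * u x ^ m + b x * u x ^ δ) * Φ n x := sub_le_self _ h6
        _ = g₀ x * (u x ^ m * Φ n x) + b x * (u x ^ δ * Φ n x) := by ring
        _ ≤ _ := add_le_add h5 h2
    · filter_upwards [hu.nonneg, hv.nonneg, huv] with x h1 h2 h3
      exact tendsto_reaction_diff_max hm hk h1 h2 h3 (hb0 x)
        (hbδ.imp (fun h => h x) fun h => h.2.le)
  have lZ : Tendsto (fun n => ∫ x in Ω,
      min (u x ^ (2 * m + 1) * Φ n x - v x ^ (2 * m + 1) * Ψ n x) 1) atTop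
      (𝓝 (∫ x in Ω, min ((u x ^ (m + 1) - v x ^ (m + 1)) *
        truncDiff m (κ + 1) (u x) (v x)) 1)) := by
    refine tendsto_integral_of_dominated_convergence (fun _ => 1)
      (fun n => ((ju n).sub (jv n)).1.inf aestronglyMeasurable_const) (integrable_const 1)
      (fun n => ?_) ?_
    · filter_upwards [hu.nonneg, hv.nonneg] with x h1 h2
      have h3 := absorption_diff_nonneg hm hk (unitStep_pos n) h1 h2
      rw [Real.norm_of_nonneg (le_min h3 zero_le_one)]
      exact min_le_right _ _
    · filter_upwards [hu.nonneg, hv.nonneg, huv] with x h1 h2 h3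
      exact (tendsto_absorption_diff hm hk h1 h2 h3).min tendsto_const_nhds
  simpa using le_of_tendsto_of_tendsto' lZ (lR.add_const _) step

theorem mainTheorem4 {N : ℕ} (Ω : Set (EuclideanSpace ℝ (Fin N)))
    (hΩ : IsSmoothBoundedDomain Ω)
    (p s m lam δ γ : ℝ) (hp : 1 < p) (hpN : p < N) (hs : s ∈ Ioo (0 : ℝ) 1)
    (hm : 0 ≤ m) (hmp : m < p - 1) (hlam : 0 < lam)
    (hδ : 0 < m → δ ∈ Ioo 0 m) (hγ : γ < 1 / 2)
    (r : ℝ≥0∞) (hr : 2 ≤ r) (g₀ : EuclideanSpace ℝ (Fin N) → ℝ)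
    (hg₀ : MemLp g₀ r (volume.restrict Ω)) (hg₀_nonneg : ∀ᵐ x ∂(volume.restrict Ω), 0 ≤ g₀ x)
    (u v : EuclideanSpace ℝ (Fin N) → ℝ)
    (hu : IsWeakSubsolution Ω p s m lam δ γ g₀ u)
    (hv : IsWeakSupersolution Ω p s m lam δ γ g₀ v) :
    ∀ᵐ x ∂(volume.restrict Ω), u x ≤ v x := by
  have : NeZero N := ⟨by
    rintro rfl
    simp only [Nat.cast_zero] at hpN
    linarith⟩
  have : IsFiniteMeasure (volume.restrict Ω) :=
    isFiniteMeasure_restrict.2 hΩ.isBounded.measure_lt_top.ne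
  have hg₀i : IntegrableOn g₀ Ω volume :=
    hg₀.integrable (le_trans (by norm_num : (1 : ℝ≥0∞) ≤ 2) hr)
  have hum := hu.memWL.2.1.aemeasurable
  have hvm := hv.memWL.2.1.aemeasurable
  have h1 : (0 : ℝ) ≤ m + 1 := by linarith
  have hmeas : AEStronglyMeasurable (fun x => u x ^ (m + 1) - v x ^ (m + 1))
      (volume.restrict Ω) := ((hum.pow_const _).sub (hvm.pow_const _)).aestronglyMeasurable
  have htrunc : ∀ k : ℝ, AEStronglyMeasurable (fun x => truncDiff m k (u x) (v x))
      (volume.restrict Ω) := fun k =>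
    ((((hum.min aemeasurable_const).pow_const _).sub (hvm.pow_const _)).max
      aemeasurable_const).aestronglyMeasurable
  have hnn : ∀ k : ℝ, 0 < k → ∀ a c : ℝ, 0 ≤ a → 0 ≤ c →
      0 ≤ (a ^ (m + 1) - c ^ (m + 1)) * truncDiff m k a c := by
    intro k hk a c ha hc
    rcases (truncDiff_nonneg m k a c).eq_or_lt with h | h
    · simp [← h]
    · have := (truncDiff_pos_imp_lt hm hk ha h).trans_le (min_le_left _ _)
      refine mul_nonneg (sub_nonneg.2 ?_) h.le
      gcongr
  -- Pointwise the truncation is inactive once `j ≥ u x`; the constant 1 dominates since `Ω` has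
  -- finite measure.
  have hlim : Tendsto (fun j : ℕ => ∫ x in Ω, min ((u x ^ (m + 1) - v x ^ (m + 1)) *
      truncDiff m (j + 1) (u x) (v x)) 1) atTop (𝓝 (∫ x in Ω,
        min ((u x ^ (m + 1) - v x ^ (m + 1)) * max (u x ^ (m + 1) - v x ^ (m + 1)) 0) 1)) := by
    refine tendsto_integral_of_dominated_convergence (fun _ => 1)
      (fun j => (hmeas.mul (htrunc _)).inf aestronglyMeasurable_const) (integrable_const 1)
      (fun j => ?_) (ae_of_all _ fun x => ?_)
    · filter_upwards [hu.nonneg, hv.nonneg] with x h1 h2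
      rw [Real.norm_of_nonneg (le_min (hnn _ (by positivity) _ _ h1 h2) zero_le_one)]
      exact min_le_right _ _
    · refine tendsto_const_nhds.congr' ?_
      filter_upwards [tendsto_natCast_atTop_atTop.eventually_ge_atTop (u x)] with j hj
      rw [truncDiff, min_eq_left (by linarith : u x ≤ (j : ℝ) + 1)]
  have hle := le_of_tendsto_of_tendsto' hlim
    (((tendsto_localError hp hm hu.memWL.1 hv.memWL.1).add
      (tendsto_nonlocalError hp hs hm hu.memWL.1 hv.memWL.1)).const_mul lam)
    fun j => integral_min_truncDiff_le hΩ hp hs hm hmp hlam hδ (by linarith) hg₀i hg₀_nonneg hu hv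
      j.cast_nonneg
  rw [add_zero, mul_zero] at hle
  have hsq : ∀ w : ℝ, 0 ≤ min (w * max w 0) 1 := fun w => by
    refine le_min ?_ zero_le_one
    rcases le_total w 0 with h | h
    · rw [max_eq_right h, mul_zero]
    · rw [max_eq_left h]
      positivity
  have hint : Integrable (fun x => min ((u x ^ (m + 1) - v x ^ (m + 1)) *
      max (u x ^ (m + 1) - v x ^ (m + 1)) 0) 1) (volume.restrict Ω) := by
    refine (integrable_const (1 : ℝ)).mono'
      ((hmeas.mul (hmeas.sup aestronglyMeasurable_const)).inf aestronglyMeasurable_const)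
      (ae_of_all _ fun x => ?_)
    rw [Real.norm_of_nonneg (hsq _)]
    exact min_le_right _ _
  -- Both errors have vanished in the limit, so a nonnegative integrand has nonpositive integral.
  have hzero := (integral_eq_zero_iff_of_nonneg (fun x => hsq _) hint).1
    (le_antisymm hle (integral_nonneg fun x => hsq _))
  filter_upwards [hzero, hu.nonneg, hv.nonneg] with x hx hux hvx
  by_contra hlt
  rw [not_le] at hlt
  have hpos : 0 < u x ^ (m + 1) - v x ^ (m + 1) :=
    sub_pos.2 (Real.rpow_lt_rpow hvx hlt (by linarith))
  have hx' : min ((u x ^ (m + 1) - v x ^ (m + 1)) *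
      max (u x ^ (m + 1) - v x ^ (m + 1)) 0) 1 = 0 := hx
  rw [max_eq_left hpos.le] at hx'
  exact (lt_min (mul_pos hpos hpos) one_pos).ne' hx'

end Comparison
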